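/- **Lemma (Poincaré stabilization).** Let $R=\mathbb Z$ or $R=\mathbb Q$. For a continuous map $f:X\to Y$ write $H_*(Y,X;-)$ and $H^*(Y,X;-)$ for the singular (co)homology, with local coefficients pulled back from $Y$, of the pair $(M_f,X)$, where $M_f$ is the mapping cylinder of $f$. Call $f:X\to Y$ an *$m$-dimensional Poincaré pair over $R$* if $X$ and $Y$ are connected finite complexes (spaces of the homotopy type of a finite CW complex), $f$ induces an isomorphism $\pi_1(X)\to\pi_1(Y)=:\pi$, $H_m(Y,X;R)\cong R$, and a generator $[Y,X]\in H_m(Y,X;R)$ induces, for all integers $k$, cap product isomorphisms $$H^k(Y;R\pi)\xrightarrow{\ \cap[Y,X]\ }H_{m-k}(Y,X;R\pi),\qquad H^k(Y,X;R\pi)\xrightarrow{\ \cap[Y,X]\ }H_{m-k}(Y;R\pi)$$ (groups in negative degrees are zero). For $R=\mathbb Z$ this is an $m$-dimensional Poincaré pair, for $R=\mathbb Q$ an $m$-dimensional rational Poincaré pair. Let $\Gamma$ be a group with a classifying space $B\Gamma=K(\Gamma,1)$ that is a finite complex, let $X$ be a connected finite complex with fundamental group $\Gamma$, and let $f:X\to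 B\Gamma$ be a classifying map, that is, a map inducing an isomorphism on fundamental groups. Let $SX=B\Gamma\cup_X B\Gamma$ be the suspension of $X$ over $B\Gamma$, i.e. the union of two copies of the mapping cylinder of $f$ along $X$, with its canonical map $SX\to B\Gamma$. Let $n\ge 0$. If $SX\to B\Gamma$ is an $(n+1)$-dimensional Poincaré pair, then $X\to B\Gamma$ is an $n$-dimensional Poincaré pair. If $SX\to B\Gamma$ is an $(n+1)$-dimensional rational Poincaré pair, then $X\to B\Gamma$ is an $n$-dimensional rational Poincaré pair. -/

import Mathlib

open CategoryTheory

noncomputable section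

namespace PoincareStab

/-! ### Singular simplices and local coefficient systems -/

section LocalCoefficients

/-- The standard topological `n`-simplex. -/
abbrev Simplex (n : ℕ) : Type := stdSimplex ℝ (Fin (n + 1))

/-- The initial vertex of the standard simplex. -/
abbrev v₀ (n : ℕ) : Simplex n := stdSimplex.vertex 0

/-- The affine map of standard simplices induced by a map of vertices. -/
def simplexMap {m n : ℕ} (f : Fin (m + 1) → Fin (n + 1)) : C(Simplex m, Simplex n) :=
  ⟨stdSimplex.map f, stdSimplex.continuous_map f⟩

/-- Inclusion of the face opposite to the vertex `i`. -/
abbrev face {n : ℕ} (i : Fin (n + 2)) : C(Simplex n, Simplex (n + 1)) :=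
  simplexMap i.succAbove

/-- The front `p`-face, spanned by the vertices `0, …, p`. -/
def front {p q n : ℕ} (h : p + q = n) : C(Simplex p, Simplex n) :=
  simplexMap fun i => ⟨i, by omega⟩

/-- The back `q`-face, spanned by the vertices `p, …, p + q`. -/
def back {p q n : ℕ} (h : p + q = n) : C(Simplex q, Simplex n) :=
  simplexMap fun i => ⟨p + i, by omega⟩

theorem simplexMap_comp {l m n : ℕ} (g : Fin (m + 1) → Fin (n + 1))
    (f : Fin (l + 1) → Fin (m + 1)) :
    (simplexMap g).comp (simplexMap f) = simplexMap (g ∘ f) := by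
  ext1 x
  exact stdSimplex.map_comp_apply f g x

instance (n : ℕ) : ContractibleSpace (Simplex n) :=
  (convex_stdSimplex ℝ (Fin (n + 1))).contractibleSpace ⟨_, (v₀ n).2⟩

/-- A local coefficient system of `R`-modules on `Z`: a functor from the fundamental groupoid. -/
abbrev LocalSystem.{w, r, u} (R : Type r) [CommRing R] (Z : Type u) [TopologicalSpace Z] :=
  FundamentalGroupoid Z ⥤ ModuleCat.{w} R

/-- The constant local system `R`. -/
abbrev constSystem (R : Type*) [CommRing R] (Z : Type*) [TopologicalSpace Z] : LocalSystem R Z :=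
  (Functor.const _).obj (ModuleCat.of R R)

/-- The local system with fibre `R[π₁(Z)]`: its fibre at `z` is the free `R`-module on the
homotopy classes of paths from the base point `z₀` to `z`, that is, on the fibre over `z` of the
universal cover; transport is by concatenation of paths. -/
def groupRingSystem.{r, u} (R : Type r) [CommRing R] {Z : Type u} [TopologicalSpace Z] (z₀ : Z) :
    LocalSystem.{max u r} R Z where
  obj z := ModuleCat.of R ((FundamentalGroupoid.mk z₀ ⟶ z) →₀ R)
  map g := ModuleCat.ofHom (Finsupp.lmapDomain R R (· ≫ g))
  map_id z := by
    ext1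
    refine Finsupp.lhom_ext fun γ r => ?_
    simp
  map_comp g h := by
    ext1
    refine Finsupp.lhom_ext fun γ r => ?_
    simp [Finsupp.mapDomain_single]

variable {R : Type*} [CommRing R] {Z : Type*} [TopologicalSpace Z]

/-- The pull-back of a local system along a continuous map. -/
abbrev LocalSystem.pullback {W : Type*} [TopologicalSpace W] (A : LocalSystem R Z) (f : C(W, Z)) :
    LocalSystem R W :=
  FundamentalGroupoid.map f ⋙ A

variable (A : LocalSystem R Z)

/-- The homotopy class of the image in `Z` of any path from `s` to `t` in the (simply connected)
domain of the singular simplex `σ`. -/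
def edge {n : ℕ} (σ : C(Simplex n, Z)) (s t : Simplex n) :
    FundamentalGroupoid.mk (σ s) ⟶ FundamentalGroupoid.mk (σ t) :=
  (Path.Homotopic.Quotient.mk (PathConnectedSpace.somePath s t)).map σ

theorem edge_trans {n : ℕ} (σ : C(Simplex n, Z)) (s t u : Simplex n) :
    edge σ s t ≫ edge σ t u = edge σ s u := by
  have h : (Path.Homotopic.Quotient.mk (PathConnectedSpace.somePath s t)).trans
      (.mk (PathConnectedSpace.somePath t u)) = .mk (PathConnectedSpace.somePath s u) :=
    Subsingleton.elim _ _
  exact ((FundamentalGroupoid.map σ).map_comp (X := ⟨s⟩) (Y := ⟨t⟩) (Z := ⟨u⟩)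
    (.mk (PathConnectedSpace.somePath s t)) (.mk (PathConnectedSpace.somePath t u))).symm.trans
      (congrArg (fun k : Path.Homotopic.Quotient s u => k.map σ) h)

theorem edge_comp {m n : ℕ} (σ : C(Simplex n, Z)) (F : C(Simplex m, Simplex n)) (s t : Simplex m) :
    edge (σ.comp F) s t = edge σ (F s) (F t) := by
  have h : (Path.Homotopic.Quotient.mk (PathConnectedSpace.somePath s t)).map F =
      .mk (PathConnectedSpace.somePath (F s) (F t)) := Subsingleton.elim _ _
  exact congrArg (fun k : Path.Homotopic.Quotient (F s) (F t) => k.map σ) h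

/-- Transport of coefficients inside a singular simplex `σ`, from the point `s` to the
point `t`. -/
def transport {n : ℕ} (σ : C(Simplex n, Z)) (s t : Simplex n) :
    A.obj ⟨σ s⟩ →ₗ[R] A.obj ⟨σ t⟩ :=
  (A.map (edge σ s t)).hom

theorem transport_trans {n : ℕ} (σ : C(Simplex n, Z)) (s t u : Simplex n) (a : A.obj ⟨σ s⟩) :
    transport A σ t u (transport A σ s t a) = transport A σ s u a := by
  simp only [transport]
  rw [← edge_trans σ s t u, A.map_comp, ModuleCat.hom_comp, LinearMap.comp_apply]

theorem transport_comp {m n : ℕ} (σ : C(Simplex n, Z)) (F : C(Simplex m, Simplex n))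
    (s t : Simplex m) (a : A.obj ⟨σ (F s)⟩) :
    transport A (σ.comp F) s t a = transport A σ (F s) (F t) a :=
  congrArg (fun k => (A.map k).hom a) (edge_comp σ F s t)

/-! ### Chains, cochains and the cap product -/

/-- Singular `n`-chains with coefficients in `A`: finite formal sums of singular simplices `σ`
with coefficients in the fibre of `A` at the initial vertex of `σ`. -/
abbrev Chain (n : ℕ) := Π₀ σ : C(Simplex n, Z), A.obj ⟨σ (v₀ n)⟩

/-- Singular `n`-cochains with coefficients in `A`. -/
abbrev Cochain (n : ℕ) := ∀ σ : C(Simplex n, Z), A.obj ⟨σ (v₀ n)⟩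

open scoped Classical in
/-- The boundary operator `∂ (a σ) = ∑ (-1)^i a σ∘dᵢ`; the coefficient is transported to the
initial vertex of the face. -/
def boundary (n : ℕ) : Chain A (n + 1) →ₗ[R] Chain A n :=
  DFinsupp.lsum ℕ fun σ => ∑ i : Fin (n + 2), (-1 : R) ^ (i : ℕ) •
    (DFinsupp.lsingle (M := fun τ : C(Simplex n, Z) => A.obj ⟨τ (v₀ n)⟩) (σ.comp (face i))) ∘ₗ
      transport A σ (v₀ (n + 1)) (face i (v₀ n))

/-- The coboundary operator `(δ φ) σ = ∑ (-1)^i φ (σ∘dᵢ)`, with values transported to the initial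
vertex of `σ`. -/
def coboundary (n : ℕ) : Cochain A n →ₗ[R] Cochain A (n + 1) :=
  LinearMap.pi fun σ => ∑ i : Fin (n + 2), (-1 : R) ^ (i : ℕ) •
    transport A σ (face i (v₀ n)) (v₀ (n + 1)) ∘ₗ LinearMap.proj (σ.comp (face i))

open scoped Classical in
/-- The cap product of a cochain with coefficients in `A` and a chain with coefficients in `R`:
`φ ∩ σ` is the back `q`-face of `σ` with coefficient the value of `φ` on the front `p`-face,
transported to the initial vertex of the back face. -/
def cap {p q n : ℕ} (h : p + q = n) :
    Cochain A p →ₗ[R] Chain (constSystem R Z) n →ₗ[R] Chain A q :=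
  LinearMap.flip <| DFinsupp.lsum ℕ fun σ => LinearMap.toSpanSingleton R (Cochain A p →ₗ[R] Chain A q)
    ((DFinsupp.lsingle (M := fun τ : C(Simplex q, Z) => A.obj ⟨τ (v₀ q)⟩) (σ.comp (back h))) ∘ₗ
      transport A σ (front h (v₀ p)) (back h (v₀ q)) ∘ₗ LinearMap.proj (σ.comp (front h)))

open scoped Classical in
/-- The elementary chain supported on `σ ∘ G` whose coefficient is the value of `φ` on `σ ∘ F`. -/
def capTerm {p q n : ℕ} (σ : C(Simplex n, Z)) (φ : Cochain A p)
    (F : C(Simplex p, Simplex n)) (G : C(Simplex q, Simplex n)) : Chain A q :=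
  DFinsupp.single (β := fun τ : C(Simplex q, Z) => A.obj ⟨τ (v₀ q)⟩) (σ.comp G)
    (transport A σ (F (v₀ p)) (G (v₀ q)) (φ (σ.comp F)))

open scoped Classical in
/-- A singular simplex, as a chain with constant coefficients. -/
def simplexChain (R : Type*) [CommRing R] {n : ℕ} (σ : C(Simplex n, Z)) :
    Chain (constSystem R Z) n :=
  DFinsupp.single (β := fun τ : C(Simplex n, Z) => (constSystem R Z).obj ⟨τ (v₀ n)⟩) σ (1 : R)

theorem cap_simplex {p q n : ℕ} (h : p + q = n) (φ : Cochain A p) (σ : C(Simplex n, Z)) :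
    cap A h φ (simplexChain R σ) = capTerm A σ φ (front h) (back h) := by
  simp [cap, simplexChain, capTerm]

theorem boundary_simplex {n : ℕ} (σ : C(Simplex (n + 1), Z)) :
    boundary (constSystem R Z) n (simplexChain R σ) =
      ∑ i : Fin (n + 2), (-1 : R) ^ (i : ℕ) • simplexChain R (σ.comp (face i)) := by
  simp [boundary, simplexChain, transport]

theorem boundary_capTerm {p q n : ℕ} (σ : C(Simplex n, Z)) (φ : Cochain A p)
    (F : C(Simplex p, Simplex n)) (G : C(Simplex (q + 1), Simplex n)) :
    boundary A q (capTerm A σ φ F G) =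
      ∑ i : Fin (q + 2), (-1 : R) ^ (i : ℕ) • capTerm A σ φ F (G.comp (face i)) := by
  classical
  simp only [boundary, capTerm, DFinsupp.lsum_single, LinearMap.sum_apply, LinearMap.smul_apply,
    LinearMap.comp_apply, DFinsupp.lsingle_apply]
  refine Finset.sum_congr rfl fun i _ => ?_
  rw [transport_comp, transport_trans]
  rfl

theorem capTerm_coboundary {p q n : ℕ} (σ : C(Simplex n, Z)) (φ : Cochain A p)
    (F : C(Simplex (p + 1), Simplex n)) (G : C(Simplex q, Simplex n)) :
    capTerm A σ (coboundary A p φ) F G =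
      ∑ i : Fin (p + 2), (-1 : R) ^ (i : ℕ) • capTerm A σ φ (F.comp (face i)) G := by
  classical
  simp only [coboundary, capTerm, LinearMap.pi_apply, LinearMap.sum_apply, LinearMap.smul_apply,
    LinearMap.comp_apply, LinearMap.proj_apply, map_sum, map_smul]
  rw [← DFinsupp.lsingle_apply (R := R), map_sum]
  refine Finset.sum_congr rfl fun i _ => ?_
  rw [map_smul, transport_comp, transport_trans]
  rfl

theorem capTerm_face {p q n : ℕ} (σ : C(Simplex (n + 1), Z)) (φ : Cochain A p) (i : Fin (n + 2))
    (F : C(Simplex p, Simplex n)) (G : C(Simplex q, Simplex n)) :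
    capTerm A (σ.comp (face i)) φ F G =
      capTerm A σ φ ((face i).comp F) ((face i).comp G) := by
  simp only [capTerm]
  rw [transport_comp]
  rfl

theorem face_comp_front_of_le {p q n : ℕ} (h : p + q = n) (i : Fin (n + 2)) (j : Fin (p + 2))
    (hij : (i : ℕ) = j) :
    (face i).comp (front h) = (front (q := q) (by omega)).comp (face j) := by
  simp only [face, front, simplexMap_comp]
  congr 1
  funext k
  simp only [Function.comp_apply, Fin.succAbove, Fin.lt_def, Fin.ext_iff]
  split_ifs <;> (simp_all; try omega)

theorem face_comp_back_of_le {p q n : ℕ} (h : p + q = n) (i : Fin (n + 2)) (hi : (i : ℕ) ≤ p) :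
    (face i).comp (back h) = back (p := p + 1) (by omega) := by
  simp only [face, back, simplexMap_comp]
  congr 1
  funext k
  simp only [Function.comp_apply, Fin.succAbove, Fin.lt_def, Fin.ext_iff]
  split_ifs <;> simp_all <;> omega

theorem face_comp_front_of_gt {p q n : ℕ} (h : p + q = n) (i : Fin (n + 2)) (hi : p < i) :
    (face i).comp (front h) = front (q := q + 1) (by omega) := by
  simp only [face, front, simplexMap_comp]
  congr 1
  funext k
  simp only [Function.comp_apply, Fin.succAbove, Fin.lt_def, Fin.ext_iff]
  split_ifs <;> (simp_all; try omega)

theorem face_comp_back_of_gt {p q n : ℕ} (h : p + q = n) (i : Fin (n + 2)) (j : Fin (q + 2))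
    (hij : (i : ℕ) = p + j) :
    (face i).comp (back h) = (back (p := p) (by omega)).comp (face j) := by
  simp only [face, back, simplexMap_comp]
  congr 1
  funext k
  simp only [Function.comp_apply, Fin.succAbove, Fin.lt_def, Fin.ext_iff]
  split_ifs <;> simp_all <;> omega

theorem front_comp_face_last {p q n : ℕ} (h : p + 1 + q = n) :
    (front h).comp (face (Fin.last (p + 1))) = front (q := q + 1) (by omega) := by
  simp only [face, front, simplexMap_comp]
  congr 1
  funext k
  simp

theorem back_comp_face_zero {p q n : ℕ} (h : p + (q + 1) = n) :
    (back h).comp (face 0) = back (p := p + 1) (by omega) := by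
  simp only [face, back, simplexMap_comp]
  congr 1
  funext k
  simp
  omega

/-- The Leibniz rule `φ ∩ ∂c = δφ ∩ c + (-1)^p ∂(φ ∩ c)`. -/
theorem cap_boundary {p q n : ℕ} (h : p + q = n) (φ : Cochain A p)
    (c : Chain (constSystem R Z) (n + 1)) :
    cap A h φ (boundary _ n c) =
      cap A (show p + 1 + q = n + 1 by omega) (coboundary A p φ) c +
        (-1 : R) ^ p • boundary A q (cap A (show p + (q + 1) = n + 1 by omega) φ c) := by
  classical
  suffices H : (cap A h φ) ∘ₗ (boundary _ n) =
      cap A (show p + 1 + q = n + 1 by omega) (coboundary A p φ) +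
        (-1 : R) ^ p • (boundary A q) ∘ₗ (cap A (show p + (q + 1) = n + 1 by omega) φ) from
    LinearMap.congr_fun H c
  refine DFinsupp.lhom_ext' fun σ => LinearMap.ext_ring ?_
  change cap A h φ (boundary _ n (simplexChain R σ)) =
      cap A (show p + 1 + q = n + 1 by omega) (coboundary A p φ) (simplexChain R σ) +
        (-1 : R) ^ p • boundary A q
          (cap A (show p + (q + 1) = n + 1 by omega) φ (simplexChain R σ))
  simp only [boundary_simplex, cap_simplex, boundary_capTerm, capTerm_coboundary, map_sum,
    map_smul, capTerm_face]
  rw [Fin.sum_univ_castSucc (n := p + 1), Fin.sum_univ_succ (n := q + 1), front_comp_face_last,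
    back_comp_face_zero, smul_add, Finset.smul_sum]
  rw [← Equiv.sum_comp (finCongr (show (p + 1) + (q + 1) = n + 2 by omega)), Fin.sum_univ_add]
  have h1 : ∀ (i : Fin (n + 2)) (j : Fin (p + 1)), (i : ℕ) = j →
      (-1 : R) ^ (i : ℕ) • capTerm A σ φ ((face i).comp (front h)) ((face i).comp (back h)) =
      (-1 : R) ^ ((j.castSucc : Fin (p + 2)) : ℕ) • capTerm A σ φ
        ((front (show p + 1 + q = n + 1 by omega)).comp (face j.castSucc))
        (back (show p + 1 + q = n + 1 by omega)) := by
    intro i j hij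
    rw [face_comp_front_of_le h i j.castSucc (by simpa using hij),
      face_comp_back_of_le h i (by omega), hij, Fin.val_castSucc]
  have h2 : ∀ (i : Fin (n + 2)) (j : Fin (q + 1)), (i : ℕ) = p + 1 + j →
      (-1 : R) ^ (i : ℕ) • capTerm A σ φ ((face i).comp (front h)) ((face i).comp (back h)) =
      (-1 : R) ^ p • (-1 : R) ^ ((j.succ : Fin (q + 2)) : ℕ) • capTerm A σ φ
        (front (show p + (q + 1) = n + 1 by omega))
        ((back (show p + (q + 1) = n + 1 by omega)).comp (face j.succ)) := by
    intro i j hij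
    rw [face_comp_front_of_gt h i (by omega),
      face_comp_back_of_gt h i j.succ (by simp only [Fin.val_succ]; omega), smul_smul,
      ← pow_add, hij, Fin.val_succ, add_assoc, add_comm 1]
  have h3 : (-1 : R) ^ ((Fin.last (p + 1) : Fin (p + 2)) : ℕ) = -(-1 : R) ^ p := by
    simp [pow_succ]
  rw [Finset.sum_congr rfl fun j _ => h1 _ j (by simp),
    Finset.sum_congr rfl fun j _ => h2 _ j (by simp), h3]
  simp

/-! ### Relative singular homology and cohomology with local coefficients

For a subset `S` of `Z` these are the groups of the pair `(Z, S)`; the absolute groups are the case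
`S = ∅`. -/

/-- The submodule `C_n(S; A)` of chains all of whose simplices lie in `S`. -/
def chainsIn (S : Set Z) (n : ℕ) : Submodule R (Chain A n) where
  carrier := {c | ∀ σ : C(Simplex n, Z), ¬ Set.range σ ⊆ S → c σ = 0}
  add_mem' := fun ha hb σ hσ => by simp [ha σ hσ, hb σ hσ]
  zero_mem' := fun _ _ => rfl
  smul_mem' := fun r c hc σ hσ => by simp [hc σ hσ]

/-- The submodule `C^n(Z, S; A)` of cochains that vanish on all simplices lying in `S`. -/
def relCochains (S : Set Z) (n : ℕ) : Submodule R (Cochain A n) where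
  carrier := {φ | ∀ σ : C(Simplex n, Z), Set.range σ ⊆ S → φ σ = 0}
  add_mem' := fun ha hb σ hσ => by simp [ha σ hσ, hb σ hσ]
  zero_mem' := fun _ _ => rfl
  smul_mem' := fun r c hc σ hσ => by simp [hc σ hσ]

/-- Relative cycles: chains whose boundary lies in `S`. -/
def cycles (S : Set Z) : ∀ n : ℕ, Submodule R (Chain A n)
  | 0 => ⊤
  | n + 1 => (chainsIn A S n).comap (boundary A n)

/-- Relative boundaries: boundaries up to chains in `S`. -/
def boundaries (S : Set Z) (n : ℕ) : Submodule R (Chain A n) :=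
  LinearMap.range (boundary A n) ⊔ chainsIn A S n

/-- The relative homology module `H_n(Z, S; A)`. -/
abbrev Homology (S : Set Z) (n : ℕ) :=
  cycles A S n ⧸ (boundaries A S n).submoduleOf (cycles A S n)

/-- Relative cocycles. -/
def cocycles (S : Set Z) (n : ℕ) : Submodule R (Cochain A n) :=
  relCochains A S n ⊓ LinearMap.ker (coboundary A n)

/-- Relative coboundaries. -/
def coboundaries (S : Set Z) : ∀ n : ℕ, Submodule R (Cochain A n)
  | 0 => ⊥
  | n + 1 => (relCochains A S n).map (coboundary A n)

/-- The relative cohomology module `H^n(Z, S; A)`. -/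
abbrev Cohomology (S : Set Z) (n : ℕ) :=
  cocycles A S n ⧸ (coboundaries A S n).submoduleOf (cocycles A S n)

theorem range_comp_subset {m n : ℕ} (σ : C(Simplex n, Z)) (F : C(Simplex m, Simplex n)) :
    Set.range (σ.comp F) ⊆ Set.range σ := by
  rintro _ ⟨x, rfl⟩
  exact ⟨F x, rfl⟩

theorem cap_mem_chainsIn {S S' T : Set Z} (hS : S' ⊆ S ∨ S' ⊆ T) {p q n : ℕ} (h : p + q = n)
    {φ : Cochain A p} (hφ : φ ∈ relCochains A S p) {c : Chain (constSystem R Z) n}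
    (hc : c ∈ chainsIn (constSystem R Z) S' n) : cap A h φ c ∈ chainsIn A T q := by
  classical
  rw [← DFinsupp.sum_single (f := c), DFinsupp.sum, map_sum]
  refine Submodule.sum_mem _ fun σ hσ => ?_
  have hσ' : Set.range σ ⊆ S' := by
    by_contra hn
    exact (DFinsupp.mem_support_iff.1 hσ) (hc σ hn)
  have hsmul : (DFinsupp.single σ (c σ) : Chain (constSystem R Z) n) =
      (show R from c σ) • simplexChain R σ := by
    rw [simplexChain, ← DFinsupp.single_smul]
    congr 1
    exact (mul_one (show R from c σ)).symm
  rw [hsmul, map_smul, cap_simplex]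
  refine Submodule.smul_mem _ _ ?_
  rcases hS with hS | hS
  · have h0 : φ (σ.comp (front h)) = 0 :=
      hφ _ ((range_comp_subset σ _).trans (hσ'.trans hS))
    rw [capTerm, h0, map_zero, DFinsupp.single_zero]
    exact Submodule.zero_mem _
  · intro τ hτ
    refine DFinsupp.single_eq_of_ne fun hne => hτ ?_
    rw [hne]
    exact (range_comp_subset σ _).trans (hσ'.trans hS)

theorem cap_mem_cycles {S S' T : Set Z} (hS : S' ⊆ S ∨ S' ⊆ T) {p q n : ℕ} (h : p + q = n)
    {φ : Cochain A p} (hφ : φ ∈ cocycles A S p) {c : Chain (constSystem R Z) n}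
    (hc : c ∈ cycles (constSystem R Z) S' n) : cap A h φ c ∈ cycles A T q := by
  cases q with
  | zero => exact Submodule.mem_top
  | succ q =>
    obtain ⟨n, rfl⟩ : ∃ m, n = m + 1 := ⟨p + q, by omega⟩
    have hδ : coboundary A p φ = 0 := hφ.2
    have hL := cap_boundary A (show p + q = n by omega) φ c
    rw [hδ, map_zero, LinearMap.zero_apply, zero_add] at hL
    have hmem := cap_mem_chainsIn A hS (show p + q = n by omega) hφ.1 hc
    rw [hL] at hmem
    have := Submodule.smul_mem _ ((-1 : R) ^ p) hmem
    rwa [smul_smul, ← mul_pow, neg_one_mul, neg_neg, one_pow, one_smul] at this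

theorem cap_mem_boundaries_left {S S' T : Set Z} (hS : S' ⊆ S ∨ S' ⊆ T) {p q n : ℕ}
    (h : p + q = n) {φ : Cochain A p} (hφ : φ ∈ coboundaries A S p)
    {c : Chain (constSystem R Z) n} (hc : c ∈ cycles (constSystem R Z) S' n) :
    cap A h φ c ∈ boundaries A T q := by
  cases p with
  | zero =>
    obtain rfl : φ = 0 := hφ
    rw [map_zero]
    exact Submodule.zero_mem _
  | succ p =>
    obtain ⟨n, rfl⟩ : ∃ m, n = m + 1 := ⟨p + q, by omega⟩
    obtain ⟨ψ, hψ, rfl⟩ := hφ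
    have hL := cap_boundary A (show p + q = n by omega) ψ c
    rw [← sub_eq_iff_eq_add] at hL
    rw [← hL]
    refine Submodule.sub_mem _ (Submodule.mem_sup_right ?_)
      (Submodule.mem_sup_left (Submodule.smul_mem _ _ ⟨_, rfl⟩))
    exact cap_mem_chainsIn A hS _ hψ hc

theorem cap_mem_boundaries_right {S S' T : Set Z} (hS : S' ⊆ S ∨ S' ⊆ T) {p q n : ℕ}
    (h : p + q = n) {φ : Cochain A p} (hφ : φ ∈ cocycles A S p)
    {c : Chain (constSystem R Z) n} (hc : c ∈ boundaries (constSystem R Z) S' n) :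
    cap A h φ c ∈ boundaries A T q := by
  obtain ⟨_, ⟨e, rfl⟩, c', hc', rfl⟩ := Submodule.mem_sup.1 hc
  rw [map_add]
  refine Submodule.add_mem _ (Submodule.mem_sup_left ?_)
    (Submodule.mem_sup_right (cap_mem_chainsIn A hS h hφ.1 hc'))
  have hδ : coboundary A p φ = 0 := hφ.2
  rw [cap_boundary, hδ, map_zero, LinearMap.zero_apply, zero_add]
  exact Submodule.smul_mem _ _ ⟨_, rfl⟩

/-- The cap product on the level of relative cocycles and relative cycles. -/
def capCycles {S S' T : Set Z} (hS : S' ⊆ S ∨ S' ⊆ T) {p q n : ℕ} (h : p + q = n) :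
    cocycles A S p →ₗ[R] cycles (constSystem R Z) S' n →ₗ[R] Homology A T q :=
  LinearMap.mk₂ R
    (fun φ c => Submodule.Quotient.mk ⟨cap A h φ c, cap_mem_cycles A hS h φ.2 c.2⟩)
    (fun φ ψ c => by
      rw [← Submodule.Quotient.mk_add]; congr 1; ext1; simp)
    (fun r φ c => by
      rw [← Submodule.Quotient.mk_smul]; congr 1; ext1; simp)
    (fun φ c d => by
      rw [← Submodule.Quotient.mk_add]; congr 1; ext1; simp)
    (fun r φ c => by
      rw [← Submodule.Quotient.mk_smul]; congr 1; ext1; simp)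

/-- The cap product `H^p(Z, S; A) → H_q(Z, T; A)`, `φ ↦ φ ∩ z`, with a class `z ∈ H_n(Z, S'; R)`,
where `p + q = n` and `S'` is contained in `S` or in `T`. -/
def homologyCap {S S' T : Set Z} (hS : S' ⊆ S ∨ S' ⊆ T) {p q n : ℕ} (h : p + q = n) :
    Homology (constSystem R Z) S' n →ₗ[R] Cohomology A S p →ₗ[R] Homology A T q :=
  Submodule.liftQ _
    (LinearMap.flip (Submodule.liftQ _ (capCycles A hS h) (fun φ hφ => by
      ext c
      exact (Submodule.Quotient.mk_eq_zero _).2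
        (cap_mem_boundaries_left A hS h hφ c.2))))
    (fun c hc => by
      refine Submodule.linearMap_qext _ (LinearMap.ext fun φ => ?_)
      exact (Submodule.Quotient.mk_eq_zero _).2 (cap_mem_boundaries_right A hS h φ.2 hc))

end LocalCoefficients

/-! ### Finite complexes, mapping cylinders and the suspension over `B` -/

section Spaces

/-- `X` is a finite complex: a space homotopy equivalent to a finite CW complex. Every finite CW
complex is one, and so is the union of two mapping cylinders of a map of finite CW complexes along
their common end, also if the map is not cellular. -/
def IsFiniteComplex.{u} (X : Type u) [TopologicalSpace X] : Prop :=
  ∃ (T : Type u) (_ : TopologicalSpace T) (_ : T2Space T)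
    (_ : Topology.CWComplex (Set.univ : Set T)),
    Topology.RelCWComplex.Finite (Set.univ : Set T) ∧
      Nonempty (ContinuousMap.HomotopyEquiv X T)

/-- `B` is a classifying space of the group `Γ` (a space of type `K(Γ, 1)`). -/
structure IsClassifyingSpace (Γ : Type*) [Group Γ] (B : Type*) [TopologicalSpace B] : Prop where
  pathConnected : PathConnectedSpace B
  pi_one : ∀ b : B, Nonempty (FundamentalGroup B b ≃* Γ)
  pi_trivial : ∀ (n : ℕ) (b : B), 2 ≤ n → Subsingleton (HomotopyGroup.Pi n B b)

variable {X Y : Type*} [TopologicalSpace X] [TopologicalSpace Y]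

/-- `f` induces isomorphisms of fundamental groups. -/
def IsPiOneIso (f : C(X, Y)) : Prop :=
  ∀ x : X, Function.Bijective (FundamentalGroup.map f x)

/-- The identifications `(x, 0) ∼ f x` in the disjoint union of `X × [0, 1]` and `Y`. -/
inductive MappingCylinder.Rel (f : C(X, Y)) :
    (X × unitInterval) ⊕ Y → (X × unitInterval) ⊕ Y → Prop
  | glue (x : X) : MappingCylinder.Rel f (Sum.inl (x, 0)) (Sum.inr (f x))

/-- The mapping cylinder of `f`. -/
def MappingCylinder (f : C(X, Y)) := Quot (MappingCylinder.Rel f)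

instance (f : C(X, Y)) : TopologicalSpace (MappingCylinder f) :=
  inferInstanceAs (TopologicalSpace (Quot (MappingCylinder.Rel f)))

/-- The inclusion `x ↦ (x, 1)` of `X` in the mapping cylinder of `f`. -/
def MappingCylinder.top (f : C(X, Y)) : C(X, MappingCylinder f) where
  toFun x := Quot.mk _ (Sum.inl (x, 1))
  continuous_toFun := continuous_quot_mk.comp (by fun_prop)

/-- The projection of the mapping cylinder of `f` onto `Y`, `(x, t) ↦ f x`, `y ↦ y`. -/
def MappingCylinder.proj (f : C(X, Y)) : C(MappingCylinder f, Y) where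
  toFun := Quot.lift (Sum.elim (fun a => f a.1) id) (by rintro _ _ ⟨x⟩; rfl)
  continuous_toFun := continuous_quot_lift _ (by fun_prop)

/-- The identifications `i x ∼ i x` between two copies of `Z`. -/
inductive Double.Rel {Z : Type*} [TopologicalSpace Z] (i : C(X, Z)) : Z ⊕ Z → Z ⊕ Z → Prop
  | glue (x : X) : Double.Rel i (Sum.inl (i x)) (Sum.inr (i x))

/-- The union `Z ∪_X Z` of two copies of `Z` along the image of `i : X → Z`. -/
def Double {Z : Type*} [TopologicalSpace Z] (i : C(X, Z)) := Quot (Double.Rel i)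

instance {Z : Type*} [TopologicalSpace Z] (i : C(X, Z)) : TopologicalSpace (Double i) :=
  inferInstanceAs (TopologicalSpace (Quot (Double.Rel i)))

/-- The suspension `SX = B ∪_X B` of `f : X → B`: the map `f` is replaced by the inclusion of `X`
in the mapping cylinder of `f`, and two copies of the cylinder are glued along `X`. -/
abbrev Suspension (f : C(X, Y)) := Double (MappingCylinder.top f)

/-- The canonical map `SX = B ∪_X B → B`, which is the projection on both copies of `B`. -/
def suspensionMap (f : C(X, Y)) : C(Suspension f, Y) where
  toFun := Quot.lift (Sum.elim (MappingCylinder.proj f) (MappingCylinder.proj f))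
    (by rintro _ _ ⟨x⟩; rfl)
  continuous_toFun := continuous_quot_lift _ (by fun_prop)

/-! ### Poincaré pairs -/

/-- The class `z ∈ H_n(Y, X; R)` of the pair (mapping cylinder of `f`, `X`) induces duality
isomorphisms with coefficients in the local system `A` on `Y`, in all degrees. The groups in
negative degrees are zero, so in the degrees above `n` all groups have to vanish. -/
structure IsDualityClass {R : Type*} [CommRing R] (n : ℕ) (f : C(X, Y)) (A : LocalSystem R Y)
    (z : Homology (constSystem R (MappingCylinder f)) (Set.range (MappingCylinder.top f)) n) :
    Prop where
  /-- `H^p(Y; A) ≅ H_q(Y, X; A)` -/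
  bijective_abs : ∀ (p q : ℕ) (h : p + q = n), Function.Bijective
    (homologyCap (A.pullback (MappingCylinder.proj f)) (S := ∅)
      (T := Set.range (MappingCylinder.top f)) (Or.inr subset_rfl) h z)
  /-- `H^p(Y, X; A) ≅ H_q(Y; A)` -/
  bijective_rel : ∀ (p q : ℕ) (h : p + q = n), Function.Bijective
    (homologyCap (A.pullback (MappingCylinder.proj f)) (S := Set.range (MappingCylinder.top f))
      (T := ∅) (Or.inl subset_rfl) h z)
  cohomology_abs : ∀ k, n < k →
    Subsingleton (Cohomology (A.pullback (MappingCylinder.proj f)) ∅ k)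
  homology_rel : ∀ k, n < k → Subsingleton
    (Homology (A.pullback (MappingCylinder.proj f)) (Set.range (MappingCylinder.top f)) k)
  cohomology_rel : ∀ k, n < k → Subsingleton
    (Cohomology (A.pullback (MappingCylinder.proj f)) (Set.range (MappingCylinder.top f)) k)
  homology_abs : ∀ k, n < k →
    Subsingleton (Homology (A.pullback (MappingCylinder.proj f)) ∅ k)

/-- `f : X → Y` is an `n`-dimensional Poincaré pair over `R`: a `π₁`-isomorphism of finite
connected complexes such that `H_n(Y, X; R) ≅ R` and a generator induces duality isomorphisms with
coefficients in the group ring `R[π₁(Y)]`. For `R = ℤ` this is a Poincaré pair, for `R = ℚ` a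
rational Poincaré pair. -/
structure IsPoincarePair (R : Type*) [CommRing R] (n : ℕ) (f : C(X, Y)) : Prop where
  finite_source : IsFiniteComplex X
  finite_target : IsFiniteComplex Y
  connected_source : PathConnectedSpace X
  connected_target : PathConnectedSpace Y
  piOneIso : IsPiOneIso f
  duality : ∃ e : Homology (constSystem R (MappingCylinder f))
      (Set.range (MappingCylinder.top f)) n ≃ₗ[R] R,
    ∀ y₀ : Y, IsDualityClass n f (groupRingSystem R y₀) (e.symm 1)

end Spaces

end PoincareStab

end

/-! Write `M_f` for the mapping cylinder of `f` and `M` for that of the canonical map `SX → B`.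
Inside `M` the suspension is the union of two copies `T` and `E` of `M_f` that meet in `X`, and both
inclusions `M_f → M` are homotopy equivalences over `B`.

Let `A` be any local system on `B`. As `T → M` is an equivalence, the groups of the pair `(M, T)`
vanish, so in the exact sequence of the triple `(M, SX, T)` the connecting maps `H_{k+1}(M, SX; A) →
H_k(SX, T; A)` and `H^k(SX, T; A) → H^{k+1}(M, SX; A)` are isomorphisms. Excision identifies the
groups of `(SX, T)` with those of `(E, X) = (M_f, X)`. This gives suspension isomorphisms between
`(M_f, X)` in degree `k` and `(M, SX)` in degree `k + 1`. With constant coefficients it sends a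
generator `z` of `H_n(B, X; R)` to a generator of `H_{n+1}(B, SX; R)`.

By the Leibniz rule and naturality, capping with `z` and capping with its suspension form squares,
commutative up to sign: one with corners `H^p(M)`, `H_{q+1}(M, SX)`, `H^p(M_f)`, `H_q(M_f, X)`, the
other with corners `H^p(M_f, X)`, `H_q(M_f)`, `H^{p+1}(M, SX)`, `H_q(M)`. Hence duality for `SX`
gives duality for `X` (`IsDualityClass.of_suspensionEquiv`). Above degree `n` the vanishing is
inherited from the vanishing above `n + 1`, except for `H^{n+1}(M)` and `H_{n+1}(M)`. These are dual
to `H_0(M, SX)` and `H^0(M, SX)`, which vanish because the groups of `(M, T)` do.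

Homotopy invariance and excision with local coefficients are proved here from singular simplices. To
treat all `A`, and homology and cohomology, at once, one works with operators `Op` that send a
simplex to a formal sum of simplices, each with a path class in `B` along which coefficients are
transported. An identity of operators then yields one of chain maps and one of cochain maps. The
prism operator and iterated barycentric subdivision are such operators; both are built by iterated
cones on ordered chains in convex models. Isomorphisms of homology are handled as linear maps of
chains that are isomorphisms of subquotients (`IsSubquotientIso`), so that squares only have to
commute up to denominators. -/

noncomputable section

namespace PoincareStab

/-! ### Operators on singular simplices over a base space -/

section Operators

variable {R : Type*} [CommRing R] {B Z Z' Z'' Z''' : Type*} [TopologicalSpace B]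
  [TopologicalSpace Z] [TopologicalSpace Z'] [TopologicalSpace Z''] [TopologicalSpace Z''']
  {p : C(Z, B)} {p' : C(Z', B)} {p'' : C(Z'', B)} {p''' : C(Z''', B)} {n q r s : ℕ}

/-- The image in the base of the initial vertex of a singular simplex. -/
abbrev basePt (p : C(Z, B)) {n : ℕ} (σ : C(Simplex n, Z)) : FundamentalGroupoid B :=
  (FundamentalGroupoid.map p).obj ⟨σ (v₀ n)⟩

/-- A singular simplex of `Z` with a homotopy class of paths in `B` from `b` to the image of its
initial vertex. -/
abbrev Term (p : C(Z, B)) (b : FundamentalGroupoid B) (n : ℕ) :=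
  Σ σ : C(Simplex n, Z), b ⟶ basePt p σ

/-- Precomposition of the path class of a term. -/
def Term.shift {b b' : FundamentalGroupoid B} (γ : b ⟶ b') (t : Term p b' n) : Term p b n :=
  ⟨t.1, γ ≫ t.2⟩

theorem Term.shift_shift {b b' b'' : FundamentalGroupoid B} (γ : b ⟶ b') (γ' : b' ⟶ b'')
    (t : Term p b'' n) : (t.shift γ').shift γ = t.shift (γ ≫ γ') := by
  simp [Term.shift]

theorem Term.shift_id {b : FundamentalGroupoid B} (t : Term p b n) : t.shift (𝟙 b) = t := by
  simp [Term.shift]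

/-- The type of the path class depends on the simplex. When two simplices are equal only by a proof,
the classes are compared after an `eqToHom`. -/
theorem Term.ext_of_eq {b : FundamentalGroupoid B} {t t' : Term p b n} (h : t.1 = t'.1)
    (hγ : t.2 ≫ eqToHom (by rw [h]) = t'.2) : t = t' := by
  obtain ⟨σ, γ⟩ := t
  obtain ⟨σ', γ'⟩ := t'
  obtain rfl : σ = σ' := h
  simpa using hγ

/-- An operator from the `n`-simplices of `Z` to the `q`-chains of `Z'`, over the base `B`. It
acts on chains and, contravariantly, on cochains with coefficients in any local system on `B`. -/
abbrev Op (R : Type*) [CommRing R] (p : C(Z, B)) (p' : C(Z', B)) (n q : ℕ) :=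
  ∀ σ : C(Simplex n, Z), Term p' (basePt p σ) q →₀ R

namespace Op

/-- The linear extension of an operator to formal sums of terms. -/
def extend (L : Op R p p' n q) (b : FundamentalGroupoid B) :
    (Term p b n →₀ R) →ₗ[R] (Term p' b q →₀ R) :=
  Finsupp.linearCombination R fun t => Finsupp.lmapDomain R R (Term.shift t.2) (L t.1)

/-- Composition of operators. -/
def comp (L' : Op R p' p'' q r) (L : Op R p p' n q) : Op R p p'' n r :=
  fun σ => L'.extend _ (L σ)

/-- The identity operator. -/
def one (p : C(Z, B)) (n : ℕ) : Op R p p n n := fun σ => Finsupp.single ⟨σ, 𝟙 _⟩ 1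

theorem extend_single (L : Op R p p' n q) {b : FundamentalGroupoid B} (t : Term p b n) (a : R) :
    L.extend b (Finsupp.single t a) = a • Finsupp.mapDomain (Term.shift t.2) (L t.1) := by
  simp [extend]

/-- The path of a term is prepended to the paths that `L` produces, so lengthening it at its start
commutes with `L`. This equivariance makes the composition of operators associative. -/
theorem extend_shift (L : Op R p p' n q) {b b' : FundamentalGroupoid B} (γ : b ⟶ b')
    (y : Term p b' n →₀ R) :
    L.extend b (Finsupp.mapDomain (Term.shift γ) y) =
      Finsupp.mapDomain (Term.shift γ) (L.extend b' y) := by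
  induction y using Finsupp.induction_linear with
  | zero => simp
  | add y y' h h' => simp only [Finsupp.mapDomain_add, map_add, h, h']
  | single t a =>
    simp only [Finsupp.mapDomain_single, extend_single, Finsupp.mapDomain_smul]
    rw [← Finsupp.mapDomain_comp]
    congr 2
    funext u
    exact (Term.shift_shift γ t.2 u).symm

theorem extend_add (L L' : Op R p p' n q) (b : FundamentalGroupoid B) :
    (L + L').extend b = L.extend b + L'.extend b := by
  refine Finsupp.lhom_ext fun t a => ?_
  simp only [LinearMap.add_apply, extend_single, Pi.add_apply, Finsupp.mapDomain_add, smul_add]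

theorem extend_sub (L L' : Op R p p' n q) (b : FundamentalGroupoid B) :
    (L - L').extend b = L.extend b - L'.extend b := by
  refine LinearMap.ext fun y => ?_
  rw [LinearMap.sub_apply, eq_sub_iff_add_eq, ← LinearMap.add_apply, ← extend_add, sub_add_cancel]

theorem extend_one (b : FundamentalGroupoid B) : (one p n).extend b = LinearMap.id (R := R) := by
  refine Finsupp.lhom_ext fun t a => ?_
  simp [extend_single, one, Finsupp.mapDomain_single, Term.shift]

theorem extend_comp (L' : Op R p' p'' q r) (L : Op R p p' n q) (b : FundamentalGroupoid B)
    (y : Term p b n →₀ R) : (L'.comp L).extend b y = L'.extend b (L.extend b y) := by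
  induction y using Finsupp.induction_linear with
  | zero => simp
  | add y y' h h' => simp only [map_add, h, h']
  | single t a => simp only [extend_single, comp, map_smul, extend_shift]

theorem comp_assoc (L'' : Op R p'' p''' r s) (L' : Op R p' p'' q r) (L : Op R p p' n q) :
    (L''.comp L').comp L = L''.comp (L'.comp L) :=
  funext fun σ => extend_comp _ _ _ (L σ)

theorem one_comp (L : Op R p p' n q) : (one p' q).comp L = L :=
  funext fun σ => by rw [comp, extend_one, LinearMap.id_apply]

theorem comp_one (L : Op R p p' n q) : L.comp (one p n) = L := by
  funext σ
  rw [comp, one, extend_single, one_smul]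
  have : Term.shift (𝟙 (basePt p σ)) = (id : Term p' (basePt p σ) q → _) :=
    funext fun t => t.shift_id
  exact (congrArg (fun g => Finsupp.mapDomain g (L σ)) this).trans Finsupp.mapDomain_id

theorem comp_add (L' : Op R p' p'' q r) (L₁ L₂ : Op R p p' n q) :
    L'.comp (L₁ + L₂) = L'.comp L₁ + L'.comp L₂ :=
  funext fun _ => map_add _ _ _

theorem comp_sub (L' : Op R p' p'' q r) (L₁ L₂ : Op R p p' n q) :
    L'.comp (L₁ - L₂) = L'.comp L₁ - L'.comp L₂ :=
  funext fun _ => map_sub _ _ _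

theorem add_comp (L₁ L₂ : Op R p' p'' q r) (L : Op R p p' n q) :
    (L₁ + L₂).comp L = L₁.comp L + L₂.comp L :=
  funext fun σ => by simp only [comp, extend_add, LinearMap.add_apply, Pi.add_apply]

theorem sub_comp (L₁ L₂ : Op R p' p'' q r) (L : Op R p p' n q) :
    (L₁ - L₂).comp L = L₁.comp L - L₂.comp L :=
  funext fun σ => by simp only [comp, extend_sub, LinearMap.sub_apply, Pi.sub_apply]

/-! #### The action on chains and cochains -/

variable (A : LocalSystem R B)

open scoped Classical in
/-- A formal sum of terms, applied to a coefficient. -/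
def chainEval (p : C(Z, B)) (n : ℕ) {b : FundamentalGroupoid B} :
    A.obj b →ₗ[R] (Term p b n →₀ R) →ₗ[R] Chain (A.pullback p) n :=
  LinearMap.flip <| Finsupp.linearCombination R fun t =>
    DFinsupp.lsingle (M := fun σ : C(Simplex n, Z) => (A.pullback p).obj ⟨σ (v₀ n)⟩) t.1 ∘ₗ
      (A.map t.2).hom

open scoped Classical in
theorem chainEval_single {b : FundamentalGroupoid B} (x : A.obj b) (t : Term p b n) (a : R) :
    chainEval A p n x (Finsupp.single t a) =
      a • DFinsupp.single (β := fun σ : C(Simplex n, Z) => (A.pullback p).obj ⟨σ (v₀ n)⟩) t.1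
        ((A.map t.2).hom x) := by
  simp [chainEval]

theorem chainEval_shift {b b' : FundamentalGroupoid B} (γ : b ⟶ b') (x : A.obj b)
    (y : Term p b' n →₀ R) :
    chainEval A p n x (Finsupp.mapDomain (Term.shift γ) y) =
      chainEval A p n ((A.map γ).hom x) y := by
  induction y using Finsupp.induction_linear with
  | zero => simp
  | add y y' h h' => simp only [Finsupp.mapDomain_add, map_add, h, h']
  | single t a => simp [chainEval_single, Finsupp.mapDomain_single, Term.shift]

open scoped Classical in
/-- The action of an operator on chains. -/
def chain (L : Op R p p' n q) : Chain (A.pullback p) n →ₗ[R] Chain (A.pullback p') q :=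
  DFinsupp.lsum ℕ fun σ => (chainEval A p' q).flip (L σ)

open scoped Classical in
theorem chain_single (L : Op R p p' n q) (σ : C(Simplex n, Z))
    (x : (A.pullback p).obj ⟨σ (v₀ n)⟩) :
    L.chain A (DFinsupp.single σ x) = chainEval A p' q x (L σ) := by
  simp [chain]

/-- Transport along a composite path is the composite transport, so a coefficient may be kept at `b`
until all operators have been applied. Functoriality of the action on chains follows. -/
theorem chain_chainEval (L : Op R p p' n q) {b : FundamentalGroupoid B} (x : A.obj b)
    (y : Term p b n →₀ R) :
    L.chain A (chainEval A p n x y) = chainEval A p' q x (L.extend b y) := by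
  induction y using Finsupp.induction_linear with
  | zero => simp
  | add y y' h h' => simp only [map_add, h, h']
  | single t a => rw [chainEval_single, map_smul, chain_single, extend_single, map_smul,
      chainEval_shift]

theorem chain_comp (L' : Op R p' p'' q r) (L : Op R p p' n q) (c : Chain (A.pullback p) n) :
    (L'.comp L).chain A c = L'.chain A (L.chain A c) := by
  classical
  suffices h : (L'.comp L).chain A = L'.chain A ∘ₗ L.chain A from LinearMap.congr_fun h c
  refine DFinsupp.lhom_ext fun σ x => ?_
  rw [LinearMap.comp_apply, chain_single, chain_single, chain_chainEval, comp]

theorem chain_one (c : Chain (A.pullback p) n) : (one p n).chain A c = c := by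
  classical
  suffices h : (one p n).chain A = LinearMap.id from LinearMap.congr_fun h c
  refine DFinsupp.lhom_ext fun σ x => ?_
  rw [LinearMap.id_apply, chain_single, one, chainEval_single, one_smul, A.map_id]
  rfl

theorem chain_add (L L' : Op R p p' n q) : (L + L').chain A = L.chain A + L'.chain A := by
  classical
  refine DFinsupp.lhom_ext fun σ x => ?_
  simp only [LinearMap.add_apply, chain_single, Pi.add_apply, map_add]

theorem chain_sub (L L' : Op R p p' n q) : (L - L').chain A = L.chain A - L'.chain A := by
  classical
  refine DFinsupp.lhom_ext fun σ x => ?_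
  simp only [LinearMap.sub_apply, chain_single, Pi.sub_apply, map_sub]

/-- A cochain, applied to a formal sum of terms. -/
def cochainEval {p : C(Z, B)} {n : ℕ} {b : FundamentalGroupoid B} :
    Cochain (A.pullback p) n →ₗ[R] (Term p b n →₀ R) →ₗ[R] A.obj b :=
  LinearMap.flip <| Finsupp.linearCombination R fun t =>
    (A.map (Groupoid.inv t.2)).hom ∘ₗ
      LinearMap.proj (φ := fun σ : C(Simplex n, Z) => (A.pullback p).obj ⟨σ (v₀ n)⟩) t.1

theorem cochainEval_single {b : FundamentalGroupoid B} (φ : Cochain (A.pullback p) n)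
    (t : Term p b n) (a : R) :
    cochainEval A φ (Finsupp.single t a) = a • (A.map (Groupoid.inv t.2)).hom (φ t.1) := by
  simp [cochainEval]

/-- Values of a cochain are transported back to the start of the path, hence the inverse of `γ`. -/
theorem cochainEval_shift {b b' : FundamentalGroupoid B} (γ : b ⟶ b')
    (φ : Cochain (A.pullback p) n) (y : Term p b' n →₀ R) :
    cochainEval A φ (Finsupp.mapDomain (Term.shift γ) y) =
      (A.map (Groupoid.inv γ)).hom (cochainEval A φ y) := by
  induction y using Finsupp.induction_linear with
  | zero => simp
  | add y y' h h' => simp only [Finsupp.mapDomain_add, map_add, h, h']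
  | single t a =>
    rw [Finsupp.mapDomain_single, cochainEval_single, cochainEval_single, map_smul]
    have : Groupoid.inv (t.shift γ).2 = Groupoid.inv t.2 ≫ Groupoid.inv γ := by
      simp [Term.shift, Groupoid.inv_eq_inv]
    rw [this]
    exact congrArg (fun g => a • g.hom (φ t.1)) (A.map_comp (Groupoid.inv t.2) (Groupoid.inv γ))

/-- The action of an operator on cochains. -/
def cochain (L : Op R p p' n q) : Cochain (A.pullback p') q →ₗ[R] Cochain (A.pullback p) n :=
  LinearMap.pi fun σ => (cochainEval A).flip (L σ)

theorem cochain_apply (L : Op R p p' n q) (φ : Cochain (A.pullback p') q) (σ : C(Simplex n, Z)) :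
    L.cochain A φ σ = cochainEval A φ (L σ) := rfl

theorem cochainEval_cochain (L : Op R p p' n q) {b : FundamentalGroupoid B}
    (φ : Cochain (A.pullback p') q) (y : Term p b n →₀ R) :
    cochainEval A (L.cochain A φ) y = cochainEval A φ (L.extend b y) := by
  induction y using Finsupp.induction_linear with
  | zero => simp
  | add y y' h h' => simp only [map_add, h, h']
  | single t a => rw [cochainEval_single, extend_single, map_smul, cochainEval_shift,
      cochain_apply]

theorem cochain_comp (L' : Op R p' p'' q r) (L : Op R p p' n q) (φ : Cochain (A.pullback p'') r) :
    (L'.comp L).cochain A φ = L.cochain A (L'.cochain A φ) :=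
  funext fun σ => by rw [cochain_apply, cochain_apply, cochainEval_cochain, comp]

theorem cochain_one (φ : Cochain (A.pullback p) n) : (one p n).cochain A φ = φ := by
  funext σ
  rw [cochain_apply, one, cochainEval_single, one_smul]
  have : Groupoid.inv (𝟙 (basePt p σ)) = 𝟙 _ := by simp [Groupoid.inv_eq_inv]
  rw [this, A.map_id]
  rfl

theorem cochain_add (L L' : Op R p p' n q) : (L + L').cochain A = L.cochain A + L'.cochain A :=
  LinearMap.ext fun φ => funext fun σ => by
    simp only [LinearMap.add_apply, cochain_apply, Pi.add_apply, map_add]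

theorem cochain_sub (L L' : Op R p p' n q) : (L - L').cochain A = L.cochain A - L'.cochain A :=
  LinearMap.ext fun φ => funext fun σ => by
    simp only [LinearMap.sub_apply, cochain_apply, Pi.sub_apply, map_sub]

/-! #### The boundary operator and push-forward -/

/-- The boundary operator. -/
def bd (p : C(Z, B)) (n : ℕ) : Op R p p (n + 1) n := fun σ =>
  ∑ i : Fin (n + 2), Finsupp.single ⟨σ.comp (face i),
    (FundamentalGroupoid.map p).map (edge σ (v₀ (n + 1)) (face i (v₀ n)))⟩ ((-1 : R) ^ (i : ℕ))

theorem chain_bd : (bd p n).chain A = boundary (A.pullback p) n := by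
  classical
  refine DFinsupp.lhom_ext fun σ x => ?_
  rw [chain_single, bd, map_sum, boundary, DFinsupp.lsum_single, LinearMap.sum_apply]
  refine Finset.sum_congr rfl fun i _ => ?_
  rw [chainEval_single]
  rfl

theorem inv_edge {m : ℕ} (σ : C(Simplex m, Z)) (s t : Simplex m) :
    Groupoid.inv (edge σ s t) = edge σ t s := by
  have h : edge σ s s = 𝟙 _ := by
    have : Path.Homotopic.Quotient.mk (PathConnectedSpace.somePath s s) =
      Path.Homotopic.Quotient.mk (Path.refl s) := Subsingleton.elim _ _
    rw [edge, this]
    rfl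
  rw [Groupoid.inv_eq_inv, ← IsIso.eq_inv_of_hom_inv_id (f := edge σ s t) (g := edge σ t s)]
  rw [edge_trans, h]

/-- Together with `chain_bd` this shows that one operator induces both differentials. Every homotopy
formula for operators therefore holds for homology and for cohomology. -/
theorem cochain_bd : (bd p n).cochain A = coboundary (A.pullback p) n := by
  refine LinearMap.ext fun φ => funext fun σ => ?_
  rw [cochain_apply, bd, map_sum, coboundary, LinearMap.pi_apply, LinearMap.sum_apply]
  refine Finset.sum_congr rfl fun i _ => ?_
  have : Groupoid.inv ((FundamentalGroupoid.map p).map (edge σ (v₀ (n + 1)) (face i (v₀ n)))) =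
      (FundamentalGroupoid.map p).map (edge σ (face i (v₀ n)) (v₀ (n + 1))) := by
    rw [← inv_edge σ (v₀ (n + 1)), Groupoid.inv_eq_inv, Groupoid.inv_eq_inv, Functor.map_inv]
  rw [cochainEval_single, this]
  rfl

/-- The identity class at a point of `B` with two descriptions. -/
def overHom {z : Z} {z' : Z'} (h : p' z' = p z) :
    (FundamentalGroupoid.map p).obj ⟨z⟩ ⟶ (FundamentalGroupoid.map p').obj ⟨z'⟩ :=
  eqToHom (congrArg FundamentalGroupoid.mk h.symm)

/-- Push-forward of simplices along a map over `B`. -/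
def push (g : C(Z, Z')) (hg : ∀ z, p' (g z) = p z) (n : ℕ) : Op R p p' n n := fun σ =>
  Finsupp.single ⟨g.comp σ, overHom (hg (σ (v₀ n)))⟩ 1

/-- The operator carries simplices in `T` to simplices in `T'`. -/
def Carries (L : Op R p p' n q) (T : Set Z) (T' : Set Z') : Prop :=
  ∀ σ : C(Simplex n, Z), Set.range σ ⊆ T → ∀ t ∈ (L σ).support, Set.range t.1 ⊆ T'

variable {L L' : Op R p p' n q} {T : Set Z} {T' : Set Z'} {T'' : Set Z''}

theorem Carries.add (h : L.Carries T T') (h' : L'.Carries T T') : (L + L').Carries T T' := by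
  classical
  intro σ hσ t ht
  rcases Finset.mem_union.1 (Finsupp.support_add ht) with ht | ht
  exacts [h σ hσ t ht, h' σ hσ t ht]

theorem Carries.sub (h : L.Carries T T') (h' : L'.Carries T T') : (L - L').Carries T T' := by
  classical
  intro σ hσ t ht
  rcases Finset.mem_union.1 (Finsupp.support_sub ht) with ht | ht
  exacts [h σ hσ t ht, h' σ hσ t ht]

theorem exists_of_mem_support_extend {L : Op R p p' n q} {b : FundamentalGroupoid B}
    {y : Term p b n →₀ R} {t : Term p' b q} (ht : t ∈ (L.extend b y).support) :
    ∃ u ∈ y.support, ∃ v ∈ (L u.1).support, t = v.shift u.2 := by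
  classical
  rw [extend, Finsupp.linearCombination_apply, Finsupp.sum] at ht
  obtain ⟨u, hu, hut⟩ := Finset.mem_biUnion.1 (Finsupp.support_finsetSum ht)
  have h1 := Finsupp.mapDomain_support (Finsupp.support_smul hut)
  obtain ⟨v, hv, rfl⟩ := Finset.mem_image.1 h1
  exact ⟨u, hu, v, hv, rfl⟩

theorem Carries.comp {L' : Op R p' p'' q r} (h' : L'.Carries T' T'') (h : L.Carries T T') :
    (L'.comp L).Carries T T'' := by
  intro σ hσ t ht
  obtain ⟨u, hu, v, hv, rfl⟩ := exists_of_mem_support_extend ht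
  exact h' u.1 (h σ hσ u hu) v hv

theorem carries_one (T : Set Z) : (one p n : Op R p p n n).Carries T T := by
  intro σ hσ t ht
  obtain rfl := Finset.mem_singleton.1 (Finsupp.support_single_subset ht)
  exact hσ

theorem carries_bd (T : Set Z) : (bd p n : Op R p p (n + 1) n).Carries T T := by
  classical
  intro σ hσ t ht
  obtain ⟨i, -, hi⟩ := Finset.mem_biUnion.1 (Finsupp.support_finsetSum ht)
  obtain rfl := Finset.mem_singleton.1 (Finsupp.support_single_subset hi)
  exact (range_comp_subset σ _).trans hσ

theorem carries_push {g : C(Z, Z')} {hg : ∀ z, p' (g z) = p z} (h : Set.MapsTo g T T') :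
    (push g hg n : Op R p p' n n).Carries T T' := by
  intro σ hσ t ht
  obtain rfl := Finset.mem_singleton.1 (Finsupp.support_single_subset ht)
  rintro _ ⟨x, rfl⟩
  exact h (hσ ⟨x, rfl⟩)

theorem chainEval_mem_chainsIn {b : FundamentalGroupoid B} (x : A.obj b) {y : Term p b n →₀ R}
    (h : ∀ t ∈ y.support, Set.range t.1 ⊆ T) :
    chainEval A p n x y ∈ chainsIn (A.pullback p) T n := by
  classical
  rw [← Finsupp.sum_single y, Finsupp.sum, map_sum]
  refine Submodule.sum_mem _ fun t ht => ?_
  rw [chainEval_single]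
  refine Submodule.smul_mem _ _ fun τ hτ => DFinsupp.single_eq_of_ne fun hne => hτ ?_
  rw [hne]
  exact h t ht

open scoped Classical in
theorem chain_induction {A : LocalSystem R Z} {P : Chain A n → Prop} {T : Set Z} (h0 : P 0)
    (hadd : ∀ c c', P c → P c' → P (c + c'))
    (hsingle : ∀ (σ : C(Simplex n, Z)) (x : A.obj ⟨σ (v₀ n)⟩), Set.range σ ⊆ T →
      P (DFinsupp.single (β := fun σ : C(Simplex n, Z) => A.obj ⟨σ (v₀ n)⟩) σ x))
    {c : Chain A n} (hc : c ∈ chainsIn A T n) : P c := by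
  rw [← DFinsupp.sum_single (f := c), DFinsupp.sum]
  refine Finset.sum_induction _ P hadd h0 fun σ hσ => ?_
  refine hsingle σ (c σ) ?_
  by_contra hn
  exact (DFinsupp.mem_support_iff.1 hσ) (hc σ hn)

theorem Carries.chain_mem (h : L.Carries T T') {c : Chain (A.pullback p) n}
    (hc : c ∈ chainsIn (A.pullback p) T n) : L.chain A c ∈ chainsIn (A.pullback p') T' q := by
  classical
  refine chain_induction (P := fun c => L.chain A c ∈ chainsIn (A.pullback p') T' q) (T := T)
    ?_ ?_ ?_ hc
  · simp
  · intro c c' h1 h2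
    rw [map_add]
    exact Submodule.add_mem _ h1 h2
  · intro σ x hσ
    rw [chain_single]
    exact chainEval_mem_chainsIn A x (h σ hσ)

theorem cochainEval_eq_zero {b : FundamentalGroupoid B} {φ : Cochain (A.pullback p) n}
    {y : Term p b n →₀ R} (h : ∀ t ∈ y.support, φ t.1 = 0) : cochainEval A φ y = 0 := by
  rw [← Finsupp.sum_single y, Finsupp.sum, map_sum]
  refine Finset.sum_eq_zero fun t ht => ?_
  rw [cochainEval_single, h t ht, map_zero, smul_zero]

theorem Carries.cochain_mem (h : L.Carries T T') {φ : Cochain (A.pullback p') q}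
    (hφ : φ ∈ relCochains (A.pullback p') T' q) :
    L.cochain A φ ∈ relCochains (A.pullback p) T n :=
  fun σ hσ => cochainEval_eq_zero A fun t ht => hφ _ (h σ hσ t ht)

end Op

end Operators

/-! ### Ordered chains on a set of vertices -/

section OrderedChains

/-- Formal sums of `q`-tuples of points of `W`; the empty tuple is one of them. -/
abbrev OrdChain (R : Type*) [CommRing R] (W : Type*) (q : ℕ) := (Fin q → W) →₀ R

namespace OrdChain

variable {R : Type*} [CommRing R] {W W' V V' : Type*} {q n : ℕ}

/-- The boundary of an ordered chain. -/
def bdry (q : ℕ) : OrdChain R W (q + 1) →ₗ[R] OrdChain R W q :=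
  Finsupp.linearCombination R fun w =>
    ∑ i : Fin (q + 1), Finsupp.single (w ∘ i.succAbove) ((-1 : R) ^ (i : ℕ))

/-- The cone with apex `b`. -/
def cone (b : W) (q : ℕ) : OrdChain R W q →ₗ[R] OrdChain R W (q + 1) :=
  Finsupp.lmapDomain R R fun w => (Fin.cons b w : Fin (q + 1) → W)

/-- The chain map induced by a map of vertices. -/
def map (g : W → W') (q : ℕ) : OrdChain R W q →ₗ[R] OrdChain R W' q :=
  Finsupp.lmapDomain R R fun w => g ∘ w

theorem bdry_single (w : Fin (q + 1) → W) :
    bdry q (Finsupp.single w (1 : R)) =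
      ∑ i : Fin (q + 1), Finsupp.single (w ∘ i.succAbove) ((-1 : R) ^ (i : ℕ)) := by
  simp [bdry]

theorem cone_single (b : W) (w : Fin q → W) (a : R) :
    cone b q (Finsupp.single w a) = Finsupp.single (Fin.cons b w : Fin (q + 1) → W) a := by
  simp [cone, Finsupp.mapDomain_single]

theorem map_single (g : W → W') (w : Fin q → W) (a : R) :
    map g q (Finsupp.single w a) = Finsupp.single (g ∘ w) a := by
  simp [map, Finsupp.mapDomain_single]

theorem hom_ext {M : Type*} [AddCommGroup M] [Module R M] {F G : OrdChain R W q →ₗ[R] M}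
    (h : ∀ w, F (Finsupp.single w 1) = G (Finsupp.single w 1)) : F = G :=
  Finsupp.lhom_ext' fun w => LinearMap.ext_ring (h w)

theorem cons_comp_succAbove_succ (b : W) (w : Fin (q + 1) → W) (i : Fin (q + 1)) :
    (Fin.cons b w : Fin (q + 2) → W) ∘ i.succ.succAbove =
      (Fin.cons b (w ∘ i.succAbove) : Fin (q + 1) → W) := by
  funext j
  refine Fin.cases ?_ (fun k => ?_) j
  · simp
  · simp [Fin.succ_succAbove_succ]

/-- Omitting the apex returns `y`. Omitting a vertex of `y` commutes with coning, and the sign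
changes because the index is shifted by one. -/
theorem bdry_cone (b : W) (y : OrdChain R W (q + 1)) :
    bdry (q + 1) (cone b (q + 1) y) = y - cone b q (bdry q y) := by
  suffices h : bdry (q + 1) ∘ₗ cone b (q + 1) = LinearMap.id - cone b q ∘ₗ bdry (R := R) q from
    LinearMap.congr_fun h y
  refine hom_ext fun w => ?_
  simp only [LinearMap.comp_apply, LinearMap.sub_apply, LinearMap.id_apply, cone_single,
    bdry_single, map_sum]
  rw [Fin.sum_univ_succ, sub_eq_add_neg, ← Finset.sum_neg_distrib]
  congr 1
  · simp only [Fin.val_zero, pow_zero]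
    congr 1
  · refine Finset.sum_congr rfl fun i _ => ?_
    rw [cons_comp_succAbove_succ, Fin.val_succ, pow_succ, mul_neg_one, Finsupp.single_neg]

/-- The chains are augmented: a single point has the empty tuple as its boundary, and there is no
correction term. -/
theorem bdry_cone_zero (b : W) (y : OrdChain R W 0) : bdry 0 (cone b 0 y) = y := by
  suffices h : bdry 0 ∘ₗ cone b 0 = LinearMap.id (R := R) from LinearMap.congr_fun h y
  refine hom_ext fun w => ?_
  simp only [LinearMap.comp_apply, LinearMap.id_apply, cone_single, bdry_single]
  rw [Fin.sum_univ_succ, Fin.sum_univ_zero, add_zero, Fin.val_zero, pow_zero]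
  congr 1

/-- Every nonempty tuple is the cone on its tail from its first vertex. Inductions can thus use the
cone formula in place of double sums over faces. -/
theorem cone_tail (w : Fin (q + 1) → W) :
    (Finsupp.single w 1 : OrdChain R W (q + 1)) =
      cone (w 0) q (Finsupp.single (Fin.tail w) 1) := by
  rw [cone_single, Fin.cons_self_tail]

theorem bdry_bdry (y : OrdChain R W (q + 2)) : bdry q (bdry (q + 1) y) = 0 := by
  suffices h : bdry q ∘ₗ bdry (q + 1) = (0 : OrdChain R W (q + 2) →ₗ[R] _) from
    LinearMap.congr_fun h y
  clear y
  induction q with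
  | zero =>
    refine hom_ext fun w => ?_
    rw [LinearMap.comp_apply, cone_tail, bdry_cone, map_sub, bdry_cone_zero, sub_self]
    rfl
  | succ q ih =>
    refine hom_ext fun w => ?_
    have := LinearMap.congr_fun ih (Finsupp.single (Fin.tail w) 1)
    rw [LinearMap.comp_apply] at this
    rw [LinearMap.comp_apply, cone_tail, bdry_cone, map_sub, bdry_cone, this]
    simp

theorem map_bdry (g : W → W') (y : OrdChain R W (q + 1)) :
    map g q (bdry q y) = bdry q (map g (q + 1) y) := by
  suffices h : map g q ∘ₗ bdry q = bdry q ∘ₗ map (R := R) g (q + 1) from LinearMap.congr_fun h y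
  refine hom_ext fun w => ?_
  simp only [LinearMap.comp_apply, map_single, bdry_single, map_sum]
  rfl

theorem map_cone (g : W → W') (b : W) (y : OrdChain R W q) :
    map g (q + 1) (cone b q y) = cone (g b) q (map g q y) := by
  suffices h : map g (q + 1) ∘ₗ cone b q = cone (g b) q ∘ₗ map (R := R) g q from
    LinearMap.congr_fun h y
  refine hom_ext fun w => ?_
  simp only [LinearMap.comp_apply, map_single, cone_single]
  congr 1
  funext j
  refine Fin.cases ?_ (fun k => ?_) j <;> simp

theorem map_zero_eq (g g' : W → W') : map (R := R) g 0 = map g' 0 := by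
  refine hom_ext fun w => ?_
  rw [map_single, map_single]
  congr 1
  exact Subsingleton.elim _ _

/-! #### Homotopies by iterated cones -/

/-- The homotopy between `F` and `G` obtained by iterated cones with apices `α`. -/
def coneHomotopy (F G : ∀ q, OrdChain R W q →ₗ[R] OrdChain R W' q)
    (α : ∀ q, (Fin (q + 1) → W) → W') : ∀ q, OrdChain R W q →ₗ[R] OrdChain R W' (q + 1)
  | 0 => 0
  | q + 1 => Finsupp.linearCombination R fun w => cone (α q w) (q + 1)
      (F (q + 1) (Finsupp.single w 1) - G (q + 1) (Finsupp.single w 1) -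
        coneHomotopy F G α q (bdry q (Finsupp.single w 1)))

theorem coneHomotopy_single (F G : ∀ q, OrdChain R W q →ₗ[R] OrdChain R W' q)
    (α : ∀ q, (Fin (q + 1) → W) → W') (w : Fin (q + 1) → W) :
    coneHomotopy F G α (q + 1) (Finsupp.single w 1) = cone (α q w) (q + 1)
      (F (q + 1) (Finsupp.single w 1) - G (q + 1) (Finsupp.single w 1) -
        coneHomotopy F G α q (bdry q (Finsupp.single w 1))) := by
  simp [coneHomotopy]

/-- By induction the chain `F w - G w - H (∂w)` inside the cone is a cycle, and the cone formula
says that the cone on a cycle bounds it. The induction starts because `F` and `G` agree on the empty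
tuple. -/
theorem bdry_coneHomotopy {F G : ∀ q, OrdChain R W q →ₗ[R] OrdChain R W' q}
    (hF : ∀ q y, bdry q (F (q + 1) y) = F q (bdry q y))
    (hG : ∀ q y, bdry q (G (q + 1) y) = G q (bdry q y)) (h0 : F 0 = G 0)
    (α : ∀ q, (Fin (q + 1) → W) → W') (y : OrdChain R W (q + 1)) :
    bdry (q + 1) (coneHomotopy F G α (q + 1) y) =
      F (q + 1) y - G (q + 1) y - coneHomotopy F G α q (bdry q y) := by
  suffices h : bdry (q + 1) ∘ₗ coneHomotopy F G α (q + 1) =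
      F (q + 1) - G (q + 1) - coneHomotopy F G α q ∘ₗ bdry q from LinearMap.congr_fun h y
  clear y
  induction q with
  | zero =>
    refine hom_ext fun w => ?_
    rw [LinearMap.comp_apply, coneHomotopy_single, bdry_cone]
    simp only [map_sub, hF, hG, h0]
    simp [coneHomotopy]
  | succ q ih =>
    refine hom_ext fun w => ?_
    have := LinearMap.congr_fun ih (bdry (q + 1)
      (Finsupp.single w 1))
    simp only [LinearMap.comp_apply, LinearMap.sub_apply, bdry_bdry, map_zero, sub_zero] at this
    rw [LinearMap.comp_apply, coneHomotopy_single, bdry_cone]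
    simp only [map_sub, hF, hG, this]
    simp

/-- The recursion uses only the boundary, `F`, `G` and the apices, so it is natural as soon as these
are. Applied to faces of the simplex, this makes the resulting operators compatible with boundaries.
-/
theorem map_coneHomotopy {F G : ∀ q, OrdChain R W q →ₗ[R] OrdChain R W' q}
    {F' G' : ∀ q, OrdChain R V q →ₗ[R] OrdChain R V' q} {α : ∀ q, (Fin (q + 1) → W) → W'}
    {α' : ∀ q, (Fin (q + 1) → V) → V'} {g : W → V} {g' : W' → V'}
    (hF : ∀ q y, map g' q (F q y) = F' q (map g q y))
    (hG : ∀ q y, map g' q (G q y) = G' q (map g q y))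
    (hα : ∀ q w, g' (α q w) = α' q (g ∘ w)) (y : OrdChain R W q) :
    map g' (q + 1) (coneHomotopy F G α q y) = coneHomotopy F' G' α' q (map g q y) := by
  suffices h : map g' (q + 1) ∘ₗ coneHomotopy F G α q = coneHomotopy F' G' α' q ∘ₗ map g q from
    LinearMap.congr_fun h y
  clear y
  induction q with
  | zero => simp [coneHomotopy]
  | succ q ih =>
    refine hom_ext fun w => ?_
    have := LinearMap.congr_fun ih (bdry q (Finsupp.single w 1))
    simp only [LinearMap.comp_apply] at this
    rw [LinearMap.comp_apply, LinearMap.comp_apply, coneHomotopy_single, map_single,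
      coneHomotopy_single, map_cone]
    simp only [map_sub, hF, hG, this, map_bdry, hα, map_single]

/-! #### Barycentric subdivision -/

/-- Barycentric subdivision with respect to a choice `β` of barycentres. -/
def sd (β : ∀ q, (Fin (q + 1) → W) → W) : ∀ q, OrdChain R W q →ₗ[R] OrdChain R W q
  | 0 => LinearMap.id
  | q + 1 => Finsupp.linearCombination R fun w =>
      cone (β q w) q (sd β q (bdry q (Finsupp.single w 1)))

theorem sd_single (β : ∀ q, (Fin (q + 1) → W) → W) (w : Fin (q + 1) → W) :
    sd (R := R) β (q + 1) (Finsupp.single w 1) =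
      cone (β q w) q (sd β q (bdry q (Finsupp.single w 1))) := by
  simp [sd]

/-- By induction the subdivided boundary is a cycle, so the cone on it from the barycentre has it as
boundary. -/
theorem bdry_sd (β : ∀ q, (Fin (q + 1) → W) → W) (y : OrdChain R W (q + 1)) :
    bdry q (sd β (q + 1) y) = sd β q (bdry q y) := by
  suffices h : bdry q ∘ₗ sd β (q + 1) = sd (R := R) β q ∘ₗ bdry q from LinearMap.congr_fun h y
  clear y
  induction q with
  | zero =>
    refine hom_ext fun w => ?_
    rw [LinearMap.comp_apply, sd_single, bdry_cone_zero, LinearMap.comp_apply]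
  | succ q ih =>
    refine hom_ext fun w => ?_
    have := LinearMap.congr_fun ih (bdry (q + 1)
      (Finsupp.single w 1))
    simp only [LinearMap.comp_apply, bdry_bdry, map_zero] at this
    rw [LinearMap.comp_apply, sd_single, bdry_cone, this, map_zero, sub_zero,
      LinearMap.comp_apply]

theorem map_sd {β : ∀ q, (Fin (q + 1) → W) → W} {β' : ∀ q, (Fin (q + 1) → W') → W'} {g : W → W'}
    (hβ : ∀ q w, g (β q w) = β' q (g ∘ w)) (y : OrdChain R W q) :
    map g q (sd β q y) = sd β' q (map g q y) := by
  suffices h : map g q ∘ₗ sd β q = sd (R := R) β' q ∘ₗ map g q from LinearMap.congr_fun h y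
  clear y
  induction q with
  | zero => rfl
  | succ q ih =>
    refine hom_ext fun w => ?_
    have := LinearMap.congr_fun ih (bdry q (Finsupp.single w 1))
    simp only [LinearMap.comp_apply] at this
    rw [LinearMap.comp_apply, LinearMap.comp_apply, sd_single, map_single, sd_single, map_cone,
      this, map_bdry, hβ, map_single]

/-- The homotopy from the identity to barycentric subdivision. -/
def sdHomotopy (β : ∀ q, (Fin (q + 1) → W) → W) (q : ℕ) :
    OrdChain R W q →ₗ[R] OrdChain R W (q + 1) :=
  coneHomotopy (fun _ => LinearMap.id) (sd β) β q

/-- The homotopy from the identity to the `k`-fold subdivision. -/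
def sdHomotopyIter (β : ∀ q, (Fin (q + 1) → W) → W) (k q : ℕ) :
    OrdChain R W q →ₗ[R] OrdChain R W (q + 1) :=
  ∑ i ∈ Finset.range k, sdHomotopy β q ∘ₗ sd β q ^ i

theorem bdry_sd_pow (β : ∀ q, (Fin (q + 1) → W) → W) (k : ℕ) (y : OrdChain R W (q + 1)) :
    bdry q ((sd β (q + 1) ^ k) y) = (sd β q ^ k) (bdry q y) := by
  induction k with
  | zero => simp
  | succ k ih => rw [pow_succ', pow_succ', Module.End.mul_apply, Module.End.mul_apply, bdry_sd, ih]

theorem map_sd_pow {β : ∀ q, (Fin (q + 1) → W) → W} {β' : ∀ q, (Fin (q + 1) → W') → W'}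
    {g : W → W'} (hβ : ∀ q w, g (β q w) = β' q (g ∘ w)) (k : ℕ) (y : OrdChain R W q) :
    map g q ((sd β q ^ k) y) = (sd β' q ^ k) (map g q y) := by
  induction k with
  | zero => simp
  | succ k ih =>
    rw [pow_succ', pow_succ', Module.End.mul_apply, Module.End.mul_apply, map_sd hβ, ih]

theorem bdry_sdHomotopy (β : ∀ q, (Fin (q + 1) → W) → W) (y : OrdChain R W (q + 1)) :
    bdry (q + 1) (sdHomotopy β (q + 1) y) =
      y - sd β (q + 1) y - sdHomotopy β q (bdry q y) :=
  bdry_coneHomotopy (F := fun _ => LinearMap.id) (G := sd β) (fun _ _ => rfl)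
    (fun _ y => bdry_sd β y) (by simp [sd]) β y

theorem map_sdHomotopy {β : ∀ q, (Fin (q + 1) → W) → W} {β' : ∀ q, (Fin (q + 1) → W') → W'}
    {g : W → W'} (hβ : ∀ q w, g (β q w) = β' q (g ∘ w)) (y : OrdChain R W q) :
    map g (q + 1) (sdHomotopy β q y) = sdHomotopy β' q (map g q y) :=
  map_coneHomotopy (F := fun _ => LinearMap.id) (G := sd β) (F' := fun _ => LinearMap.id)
    (G' := sd β') (fun _ _ => rfl) (fun _ y => map_sd hβ y) hβ y

/-- The homotopies between consecutive powers of the subdivision telescope. -/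
theorem bdry_sdHomotopyIter (β : ∀ q, (Fin (q + 1) → W) → W) (k : ℕ) (y : OrdChain R W (q + 1)) :
    bdry (q + 1) (sdHomotopyIter β k (q + 1) y) =
      y - (sd β (q + 1) ^ k) y - sdHomotopyIter β k q (bdry q y) := by
  induction k with
  | zero => simp [sdHomotopyIter]
  | succ k ih =>
    have h : ∀ (q : ℕ) (y : OrdChain R W q), sdHomotopyIter β (k + 1) q y =
        sdHomotopyIter β k q y + sdHomotopy β q ((sd β q ^ k) y) := fun q y => by
      rw [sdHomotopyIter, Finset.sum_range_succ]
      rfl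
    rw [h, h, map_add, ih, bdry_sdHomotopy, bdry_sd_pow, pow_succ', Module.End.mul_apply]
    abel

theorem map_sdHomotopyIter {β : ∀ q, (Fin (q + 1) → W) → W} {β' : ∀ q, (Fin (q + 1) → W') → W'}
    {g : W → W'} (hβ : ∀ q w, g (β q w) = β' q (g ∘ w)) (k : ℕ) (y : OrdChain R W q) :
    map g (q + 1) (sdHomotopyIter β k q y) = sdHomotopyIter β' k q (map g q y) := by
  simp only [sdHomotopyIter, LinearMap.sum_apply, map_sum, LinearMap.comp_apply,
    map_sdHomotopy hβ, map_sd_pow hβ]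

/-- The difference of two truncations involves only pieces subdivided at least `k` times. These are
small when `k` is large, although each truncation contains large pieces. -/
theorem sdHomotopyIter_sub (β : ∀ q, (Fin (q + 1) → W) → W) {k l : ℕ} (h : k ≤ l)
    (y : OrdChain R W q) : sdHomotopyIter β l q y - sdHomotopyIter β k q y =
      ∑ i ∈ Finset.Ico k l, sdHomotopy β q ((sd β q ^ i) y) := by
  simp only [sdHomotopyIter, LinearMap.sum_apply, LinearMap.comp_apply]
  exact (Finset.sum_Ico_eq_sub _ h).symm

/-! #### Supports -/

/-- Chains all of whose tuples have their vertices in `C`. -/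
def supportedIn (R : Type*) [CommRing R] (C : Set W) (q : ℕ) : Submodule R (OrdChain R W q) :=
  Finsupp.supported R R {w | ∀ i, w i ∈ C}

theorem linearMap_mem {F : OrdChain R W q →ₗ[R] OrdChain R W' n} {s : Set (Fin q → W)}
    {s' : Set (Fin n → W')} (h : ∀ w ∈ s, F (Finsupp.single w 1) ∈ Finsupp.supported R R s')
    {y : OrdChain R W q} (hy : y ∈ Finsupp.supported R R s) :
    F y ∈ Finsupp.supported R R s' := by
  have : Finsupp.supported R R s ≤ (Finsupp.supported R R s').comap F := by
    rw [Finsupp.supported_eq_span_single, Submodule.span_le]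
    rintro _ ⟨w, hw, rfl⟩
    exact h w hw
  exact this hy

theorem bdry_mem {C : Set W} {y : OrdChain R W (q + 1)} (hy : y ∈ supportedIn R C (q + 1)) :
    bdry q y ∈ supportedIn R C q := by
  refine linearMap_mem (fun w hw => ?_) hy
  rw [bdry_single]
  exact Submodule.sum_mem _ fun i _ => Finsupp.single_mem_supported R _ fun j => hw _

theorem cone_mem {C : Set W} {b : W} (hb : b ∈ C) {y : OrdChain R W q}
    (hy : y ∈ supportedIn R C q) : cone b q y ∈ supportedIn R C (q + 1) := by
  refine linearMap_mem (fun w hw => ?_) hy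
  rw [cone_single]
  refine Finsupp.single_mem_supported R _ fun j => ?_
  refine Fin.cases ?_ (fun k => ?_) j
  · simpa using hb
  · simpa using hw k

theorem coneHomotopy_mem {F G : ∀ q, OrdChain R W q →ₗ[R] OrdChain R W' q}
    {α : ∀ q, (Fin (q + 1) → W) → W'} {C : Set W} {C' : Set W'}
    (hF : ∀ q y, y ∈ supportedIn R C q → F q y ∈ supportedIn R C' q)
    (hG : ∀ q y, y ∈ supportedIn R C q → G q y ∈ supportedIn R C' q)
    (hα : ∀ q w, (∀ i, w i ∈ C) → α q w ∈ C') {y : OrdChain R W q}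
    (hy : y ∈ supportedIn R C q) : coneHomotopy F G α q y ∈ supportedIn R C' (q + 1) := by
  induction q with
  | zero => exact Submodule.zero_mem _
  | succ q ih =>
    refine linearMap_mem (fun w hw => ?_) hy
    have hw' : (Finsupp.single w 1 : OrdChain R W (q + 1)) ∈ supportedIn R C (q + 1) :=
      Finsupp.single_mem_supported R _ hw
    rw [coneHomotopy_single]
    exact cone_mem (hα q w hw) (Submodule.sub_mem _ (Submodule.sub_mem _ (hF _ _ hw')
      (hG _ _ hw')) (ih (bdry_mem hw')))

theorem sd_mem {β : ∀ q, (Fin (q + 1) → W) → W} {C : Set W}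
    (hβ : ∀ q w, (∀ i, w i ∈ C) → β q w ∈ C) {y : OrdChain R W q} (hy : y ∈ supportedIn R C q) :
    sd β q y ∈ supportedIn R C q := by
  induction q with
  | zero => exact hy
  | succ q ih =>
    refine linearMap_mem (fun w hw => ?_) hy
    rw [sd_single]
    exact cone_mem (hβ q w hw) (ih (bdry_mem (Finsupp.single_mem_supported R _ hw)))

theorem sdHomotopy_mem {β : ∀ q, (Fin (q + 1) → W) → W} {C : Set W}
    (hβ : ∀ q w, (∀ i, w i ∈ C) → β q w ∈ C) {y : OrdChain R W q} (hy : y ∈ supportedIn R C q) :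
    sdHomotopy β q y ∈ supportedIn R C (q + 1) :=
  coneHomotopy_mem (F := fun _ => LinearMap.id) (G := sd β) (fun _ _ h => h)
    (fun _ _ h => sd_mem hβ h) hβ hy

end OrdChain

end OrderedChains

/-! ### Affine simplices in convex models -/

section Models

/-- A contractible space with affine simplices spanned by arbitrary vertices. -/
class ConvexModel (W : Type*) [TopologicalSpace W] where
  contractible : ContractibleSpace W
  aff {q : ℕ} (w : Fin (q + 1) → W) : C(Simplex q, W)
  aff_comp {q r : ℕ} (w : Fin (q + 1) → W) (g : Fin (r + 1) → Fin (q + 1)) :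
    (aff w).comp (simplexMap g) = aff (w ∘ g)

attribute [instance] ConvexModel.contractible

open ConvexModel (aff aff_comp)

section Convex

variable {V : Type*} [AddCommGroup V] [Module ℝ V] [TopologicalSpace V] [IsTopologicalAddGroup V]
  [ContinuousSMul ℝ V] {K : Set V}

/-- The affine simplex in a convex set with given vertices. -/
def convexAff (hK : Convex ℝ K) {q : ℕ} (w : Fin (q + 1) → K) : C(Simplex q, K) where
  toFun x := ⟨∑ i, x i • (w i : V),
    hK.sum_mem (fun i _ => x.2.1 i) x.2.2 fun i _ => (w i).2⟩
  continuous_toFun := by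
    refine Continuous.subtype_mk (continuous_finsetSum _ fun i _ => ?_) _
    exact ((continuous_apply i).comp continuous_subtype_val).smul continuous_const

/-- A nonempty convex set is a model. -/
abbrev convexModel (hK : Convex ℝ K) (hne : K.Nonempty) : ConvexModel K where
  contractible := hK.contractibleSpace hne
  aff w := convexAff hK w
  aff_comp w g := by
    ext x
    simp only [convexAff, simplexMap, ContinuousMap.comp_apply, ContinuousMap.coe_mk,
      Function.comp_apply]
    change ∑ i, (stdSimplex.map g x).1 i • (w i : V) = ∑ i, x.1 i • (w (g i) : V)
    rw [← Finset.sum_fiberwise Finset.univ g]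
    refine Finset.sum_congr rfl fun j _ => ?_
    have h : (stdSimplex.map g x).1 j = ∑ i with g i = j, x.1 i :=
      FunOnFinite.linearMap_apply_apply ℝ ℝ g x.1 j
    rw [h, Finset.sum_smul]
    refine Finset.sum_congr rfl fun i hi => ?_
    rw [(Finset.mem_filter.1 hi).2]

end Convex

instance (n : ℕ) : ConvexModel (Simplex n) :=
  convexModel (convex_stdSimplex ℝ (Fin (n + 1))) ⟨_, (v₀ n).2⟩

instance : ConvexModel unitInterval := convexModel (convex_Icc 0 1) ⟨0, by simp⟩

instance {W W' : Type*} [TopologicalSpace W] [TopologicalSpace W'] [ConvexModel W]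
    [ConvexModel W'] : ConvexModel (W × W') where
  contractible := inferInstance
  aff w := (aff (Prod.fst ∘ w)).prodMk (aff (Prod.snd ∘ w))
  aff_comp w g := by
    ext1 x
    exact Prod.ext (DFunLike.congr_fun (aff_comp (Prod.fst ∘ w) g) x)
      (DFunLike.congr_fun (aff_comp (Prod.snd ∘ w) g) x)

/-- The vertices of the standard simplex. -/
abbrev vert (n : ℕ) : Fin (n + 1) → Simplex n := fun i => stdSimplex.vertex i

theorem aff_apply_simplex {q n : ℕ} (w : Fin (q + 1) → Simplex n) (x : Simplex q)
    (j : Fin (n + 1)) : aff w x j = ∑ i, x i * w i j := by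
  change (∑ i, x i • (w i : Fin (n + 1) → ℝ)) j = _
  simp

theorem aff_vert (n : ℕ) : aff (vert n) = ContinuousMap.id (Simplex n) := by
  ext x j
  change aff (vert n) x j = x j
  rw [aff_apply_simplex]
  simp [Pi.single_apply]

theorem simplexMap_vert {m n : ℕ} (g : Fin (m + 1) → Fin (n + 1)) :
    simplexMap g ∘ vert m = vert n ∘ g := by
  funext i
  exact stdSimplex.map_vertex g i

theorem aff_vert_comp {m n : ℕ} (g : Fin (m + 1) → Fin (n + 1)) :
    aff (vert n ∘ g) = simplexMap g := by
  rw [← aff_comp, aff_vert, ContinuousMap.id_comp]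

theorem simplexMap_aff {q m n : ℕ} (g : Fin (m + 1) → Fin (n + 1)) (w : Fin (q + 1) → Simplex m) :
    (simplexMap g).comp (aff w) = aff (simplexMap g ∘ w) := by
  ext1 x
  refine Subtype.ext ?_
  change FunOnFinite.linearMap ℝ ℝ g (∑ i, x i • (w i : Fin (m + 1) → ℝ)) =
    ∑ i, x i • FunOnFinite.linearMap ℝ ℝ g (w i : Fin (m + 1) → ℝ)
  simp only [map_sum, map_smul]

theorem aff_const (t : unitInterval) {q : ℕ} :
    aff (fun _ : Fin (q + 1) => t) = ContinuousMap.const _ t := by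
  ext x
  change ∑ i, x i • (t : ℝ) = t
  rw [← Finset.sum_smul, stdSimplex.sum_eq_one, one_smul]

end Models

/-! ### Operators defined by ordered chains in models -/

section ModelOperators

open ConvexModel (aff aff_comp)

variable {R : Type*} [CommRing R] {B Z Z' W W₁ : Type*} [TopologicalSpace B]
  [TopologicalSpace Z] [TopologicalSpace Z'] [TopologicalSpace W] [TopologicalSpace W₁]
  [ContractibleSpace W] [ContractibleSpace W₁]
  {p : C(Z, B)} {p' : C(Z', B)} {n q r : ℕ}

/-- The homotopy class of the image of any path from `s` to `t` in a contractible model. -/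
def modelEdge (Φ : C(W, Z)) (s t : W) :
    FundamentalGroupoid.mk (Φ s) ⟶ FundamentalGroupoid.mk (Φ t) :=
  (Path.Homotopic.Quotient.mk (PathConnectedSpace.somePath s t)).map Φ

theorem modelEdge_trans (Φ : C(W, Z)) (s t u : W) :
    modelEdge Φ s t ≫ modelEdge Φ t u = modelEdge Φ s u := by
  have h : (Path.Homotopic.Quotient.mk (PathConnectedSpace.somePath s t)).trans
      (.mk (PathConnectedSpace.somePath t u)) = .mk (PathConnectedSpace.somePath s u) :=
    Subsingleton.elim _ _
  exact ((FundamentalGroupoid.map Φ).map_comp (X := ⟨s⟩) (Y := ⟨t⟩) (Z := ⟨u⟩)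
    (.mk (PathConnectedSpace.somePath s t)) (.mk (PathConnectedSpace.somePath t u))).symm.trans
      (congrArg (fun k : Path.Homotopic.Quotient s u => k.map Φ) h)

theorem modelEdge_self (Φ : C(W, Z)) (s : W) : modelEdge Φ s s = 𝟙 _ := by
  have : Path.Homotopic.Quotient.mk (PathConnectedSpace.somePath s s) =
    Path.Homotopic.Quotient.mk (Path.refl s) := Subsingleton.elim _ _
  rw [modelEdge, this]
  rfl

theorem modelEdge_comp (Φ : C(W, Z)) (G : C(W₁, W)) (s t : W₁) :
    modelEdge (Φ.comp G) s t = modelEdge Φ (G s) (G t) := by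
  have h : (Path.Homotopic.Quotient.mk (PathConnectedSpace.somePath s t)).map G =
      .mk (PathConnectedSpace.somePath (G s) (G t)) := Subsingleton.elim _ _
  exact congrArg (fun k : Path.Homotopic.Quotient (G s) (G t) => k.map Φ) h

theorem map_modelEdge (p : C(Z, B)) (Φ : C(W, Z)) (s t : W) :
    (FundamentalGroupoid.map p).map (modelEdge Φ s t) = modelEdge (p.comp Φ) s t := rfl

theorem modelEdge_congr {Φ Φ' : C(W, Z)} (h : Φ = Φ') (s t : W) :
    modelEdge Φ s t = eqToHom (by rw [h]) ≫ modelEdge Φ' s t ≫ eqToHom (by rw [h]) := by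
  subst h
  simp

/-- The term of a simplex `κ` in a model `W` with a map `Φ` to `Z`; its path class runs through
the model, after an initial class `γ₀` ending at the image of `w₀`. -/
def Term.ofModel (Φ : C(W, Z)) {w₀ : W} {b : FundamentalGroupoid B}
    (γ₀ : b ⟶ (FundamentalGroupoid.map p).obj ⟨Φ w₀⟩) (κ : C(Simplex q, W)) : Term p b q :=
  ⟨Φ.comp κ, γ₀ ≫ (FundamentalGroupoid.map p).map (modelEdge Φ w₀ (κ (v₀ q)))⟩

/-- A contractible model has one path class between two given points, so the path through the
smaller model may be replaced by one through the larger. -/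
theorem Term.ofModel_comp (Φ : C(W, Z)) {w₀ : W} {b : FundamentalGroupoid B}
    (γ₀ : b ⟶ (FundamentalGroupoid.map p).obj ⟨Φ w₀⟩) (G : C(W₁, W)) {w₁ : W₁}
    {b₁ : FundamentalGroupoid B} (γ₁ : b₁ ⟶ (FundamentalGroupoid.map p).obj ⟨(Φ.comp G) w₁⟩)
    (γ : b ⟶ b₁)
    (h : γ ≫ γ₁ = γ₀ ≫ (FundamentalGroupoid.map p).map (modelEdge Φ w₀ (G w₁)))
    (κ : C(Simplex q, W₁)) :
    (Term.ofModel (Φ.comp G) γ₁ κ).shift γ = Term.ofModel Φ γ₀ (G.comp κ) := by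
  refine Sigma.ext rfl (heq_of_eq ?_)
  change γ ≫ γ₁ ≫ (FundamentalGroupoid.map p).map (modelEdge (Φ.comp G) w₁ (κ (v₀ q))) =
    γ₀ ≫ (FundamentalGroupoid.map p).map (modelEdge Φ w₀ (G (κ (v₀ q))))
  rw [← Category.assoc, h, modelEdge_comp, Category.assoc]
  erw [← Functor.map_comp]
  rw [modelEdge_trans]

end ModelOperators

section ModelOperators

open ConvexModel (aff aff_comp)

variable {R : Type*} [CommRing R] {B Z Z' W W₁ : Type*} [TopologicalSpace B]
  [TopologicalSpace Z] [TopologicalSpace Z'] [TopologicalSpace W] [TopologicalSpace W₁]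
  {p : C(Z, B)} {p' : C(Z', B)} {n q r : ℕ}

/-- The formal sum of terms of an ordered chain in a model. -/
def realize [ConvexModel W] (Φ : C(W, Z)) {w₀ : W} {b : FundamentalGroupoid B}
    (γ₀ : b ⟶ (FundamentalGroupoid.map p).obj ⟨Φ w₀⟩) (q : ℕ) :
    OrdChain R W (q + 1) →ₗ[R] (Term p b q →₀ R) :=
  Finsupp.lmapDomain R R fun w => Term.ofModel Φ γ₀ (aff w)

theorem realize_single [ConvexModel W] (Φ : C(W, Z)) {w₀ : W} {b : FundamentalGroupoid B}
    (γ₀ : b ⟶ (FundamentalGroupoid.map p).obj ⟨Φ w₀⟩) (w : Fin (q + 1) → W) (a : R) :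
    realize Φ γ₀ q (Finsupp.single w a) = Finsupp.single (Term.ofModel Φ γ₀ (aff w)) a := by
  simp [realize, Finsupp.mapDomain_single]

/-- Faces of affine simplices are affine simplices on fewer vertices, and the path classes agree
because they all run inside one model. Identities of ordered chains thus become identities of
operators with local coefficients. -/
theorem extend_bd_realize [ConvexModel W] (Φ : C(W, Z)) {w₀ : W} {b : FundamentalGroupoid B}
    (γ₀ : b ⟶ (FundamentalGroupoid.map p).obj ⟨Φ w₀⟩) (y : OrdChain R W (q + 2)) :
    (Op.bd p q).extend b (realize Φ γ₀ (q + 1) y) = realize Φ γ₀ q (OrdChain.bdry (q + 1) y) := by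
  suffices h : (Op.bd p q).extend b ∘ₗ realize Φ γ₀ (q + 1) =
      realize (R := R) Φ γ₀ q ∘ₗ OrdChain.bdry (q + 1) from LinearMap.congr_fun h y
  refine OrdChain.hom_ext fun w => ?_
  rw [LinearMap.comp_apply, LinearMap.comp_apply, realize_single, OrdChain.bdry_single,
    Op.extend_single, one_smul, Op.bd, Finsupp.mapDomain_finsetSum, map_sum]
  refine Finset.sum_congr rfl fun i _ => ?_
  rw [Finsupp.mapDomain_single, realize_single, ← aff_comp]
  congr 1
  have := Term.ofModel_comp (p := p) Φ γ₀ (aff w)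
    (w₁ := v₀ (q + 1)) (𝟙 _) (Term.ofModel (p := p) Φ γ₀ (aff w)).2 (by simp [Term.ofModel])
    (face i)
  rw [← this]
  simp only [Term.ofModel, Category.id_comp]
  rfl

/-- Used for the inclusion of a face, or of the prism over a face: pieces of a face of `σ` are then
pieces of `σ`, with matching path classes. -/
theorem mapDomain_shift_realize [ConvexModel W] [ConvexModel W₁] (Φ : C(W, Z)) {w₀ : W}
    {b : FundamentalGroupoid B} (γ₀ : b ⟶ (FundamentalGroupoid.map p).obj ⟨Φ w₀⟩) (G : C(W₁, W))
    (hG : ∀ w : Fin (q + 1) → W₁, G.comp (aff w) = aff (G ∘ w)) {w₁ : W₁}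
    {b₁ : FundamentalGroupoid B} (γ₁ : b₁ ⟶ (FundamentalGroupoid.map p).obj ⟨(Φ.comp G) w₁⟩)
    (γ : b ⟶ b₁)
    (h : γ ≫ γ₁ = γ₀ ≫ (FundamentalGroupoid.map p).map (modelEdge Φ w₀ (G w₁)))
    (y : OrdChain R W₁ (q + 1)) :
    Finsupp.mapDomain (Term.shift γ) (realize (Φ.comp G) γ₁ q y) =
      realize Φ γ₀ q (OrdChain.map G (q + 1) y) := by
  suffices h : Finsupp.lmapDomain R R (Term.shift γ) ∘ₗ realize (Φ.comp G) γ₁ q =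
      realize (R := R) Φ γ₀ q ∘ₗ OrdChain.map G (q + 1) from LinearMap.congr_fun h y
  refine OrdChain.hom_ext fun w => ?_
  rw [LinearMap.comp_apply, LinearMap.comp_apply, realize_single, OrdChain.map_single,
    realize_single, Finsupp.lmapDomain_apply, Finsupp.mapDomain_single,
    Term.ofModel_comp Φ γ₀ G γ₁ γ h, hG]

namespace Op

/-- The operator that replaces a singular simplex by subdivided pieces of it. -/
def localOp (p : C(Z, B)) (u : C(Simplex n, Z) → OrdChain R (Simplex n) (q + 1)) : Op R p p n q :=
  fun σ => realize σ (w₀ := v₀ n) (𝟙 _) q (u σ)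

theorem one_eq_localOp :
    (one p n : Op R p p n n) = localOp p fun _ => Finsupp.single (vert n) 1 := by
  funext σ
  rw [localOp, realize_single, aff_vert, one]
  congr 1
  refine Sigma.ext (by rfl) (heq_of_eq ?_)
  change 𝟙 _ = 𝟙 _ ≫ (FundamentalGroupoid.map p).map (modelEdge σ (v₀ n) (v₀ n))
  rw [modelEdge_self]
  exact ((Category.id_comp _).trans ((FundamentalGroupoid.map p).map_id _)).symm

theorem bd_comp_localOp (u : C(Simplex n, Z) → OrdChain R (Simplex n) (q + 2)) :
    (bd p q).comp (localOp p u) = localOp p fun σ => OrdChain.bdry (q + 1) (u σ) :=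
  funext fun _ => extend_bd_realize _ _ _

theorem localOp_comp_bd (u : C(Simplex n, Z) → OrdChain R (Simplex n) (q + 1)) :
    (localOp p u).comp (bd p n) = localOp p fun σ =>
      ∑ i : Fin (n + 2), (-1 : R) ^ (i : ℕ) •
        OrdChain.map (face i) (q + 1) (u (σ.comp (face i))) := by
  funext σ
  simp only [comp, bd, localOp, map_sum, map_smul]
  refine Finset.sum_congr rfl fun i _ => ?_
  rw [extend_single]
  congr 1
  refine mapDomain_shift_realize σ (𝟙 _) (face i) (fun w => simplexMap_aff _ w) (𝟙 _) _ ?_ _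
  exact (Category.comp_id _).trans (Category.id_comp _).symm

theorem localOp_sub (u u' : C(Simplex n, Z) → OrdChain R (Simplex n) (q + 1)) :
    localOp p u - localOp p u' = localOp p fun σ => u σ - u' σ :=
  funext fun _ => (map_sub _ _ _).symm

/-- The boundary is itself given by an ordered chain in the standard simplex, so `∂∂ = 0` for
operators follows from `∂∂ = 0` for ordered chains. -/
theorem bd_eq_localOp : (bd p n : Op R p p (n + 1) n) =
    localOp p fun _ => OrdChain.bdry (n + 1) (Finsupp.single (vert (n + 1)) 1) := by
  rw [← bd_comp_localOp (p := p) (fun _ => Finsupp.single (vert (n + 1)) 1), ← one_eq_localOp,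
    comp_one]

theorem bd_comp_bd : (bd p n).comp (bd p (n + 1)) = (0 : Op R p p (n + 2) n) := by
  rw [bd_eq_localOp (n := n + 1), bd_comp_localOp]
  funext σ
  simp [OrdChain.bdry_bdry, localOp]

theorem exists_of_mem_support_localOp {u : C(Simplex n, Z) → OrdChain R (Simplex n) (q + 1)}
    {σ : C(Simplex n, Z)} {t : Term p (basePt p σ) q} (ht : t ∈ (localOp p u σ).support) :
    ∃ w ∈ (u σ).support, t.1 = σ.comp (aff w) := by
  classical
  obtain ⟨w, hw, rfl⟩ := Finset.mem_image.1 (Finsupp.mapDomain_support ht)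
  exact ⟨w, hw, rfl⟩

theorem carries_localOp (u : C(Simplex n, Z) → OrdChain R (Simplex n) (q + 1)) (T : Set Z) :
    (localOp p u).Carries T T := by
  intro σ hσ t ht
  obtain ⟨w, -, h⟩ := exists_of_mem_support_localOp ht
  rw [h]
  exact (range_comp_subset σ _).trans hσ

/-- The operator `∂K + K∂`. -/
def homotopyBd (K : ∀ n, Op R p p' n (n + 1)) : ∀ n, Op R p p' n n
  | 0 => (bd p' 0).comp (K 0)
  | n + 1 => (bd p' (n + 1)).comp (K (n + 1)) + (K n).comp (bd p n)

/-! #### The prism operator of a homotopy over the base -/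

/-- The inclusion of `W` in `W × [0, 1]` at height `t`. -/
def atHeight (W : Type*) [TopologicalSpace W] (t : unitInterval) : C(W, W × unitInterval) :=
  (ContinuousMap.id W).prodMk (ContinuousMap.const W t)

/-- The ordered chain of the prism. -/
def prismChain (R : Type*) [CommRing R] (W : Type*) [TopologicalSpace W] (q : ℕ) :
    OrdChain R W q →ₗ[R] OrdChain R (W × unitInterval) (q + 1) :=
  OrdChain.coneHomotopy (OrdChain.map (atHeight W 1)) (OrdChain.map (atHeight W 0))
    (fun _ w => atHeight W 0 (w 0)) q

theorem bdry_prismChain (y : OrdChain R W (q + 1)) :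
    OrdChain.bdry (q + 1) (prismChain R W (q + 1) y) = OrdChain.map (atHeight W 1) (q + 1) y -
      OrdChain.map (atHeight W 0) (q + 1) y - prismChain R W q (OrdChain.bdry q y) :=
  OrdChain.bdry_coneHomotopy (fun _ y => (OrdChain.map_bdry _ y).symm)
    (fun _ y => (OrdChain.map_bdry _ y).symm) (OrdChain.map_zero_eq _ _) _ y

theorem map_prismChain (g : C(W, W₁)) (y : OrdChain R W q) :
    OrdChain.map (g.prodMap (ContinuousMap.id unitInterval)) (q + 1) (prismChain R W q y) =
      prismChain R W₁ q (OrdChain.map g q y) := by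
  refine OrdChain.map_coneHomotopy ?_ ?_ (fun _ _ => rfl) y <;>
  · intro q y
    simp only [OrdChain.map, Finsupp.lmapDomain_apply, ← Finsupp.mapDomain_comp]
    rfl

variable (Φ : C(Z × unitInterval, Z')) (hΦ : ∀ z t, p' (Φ (z, t)) = p z)

theorem eqToHom_comp₄ {C : Type*} [Category C] {a b c d e : C} (h₁ : a = b) (h₂ : b = c)
    (h₃ : c = d) (h₄ : d = e) : (eqToHom h₁ ≫ eqToHom h₂ ≫ eqToHom h₃) ≫ eqToHom h₄ =
      eqToHom (h₁.trans (h₂.trans (h₃.trans h₄))) := by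
  subst h₁ h₂ h₃ h₄
  simp

theorem eqToHom_cancel {C : Type*} [Category C] {a b c d : C} (x : a ⟶ c) (h₁ : a = b)
    (h : c = d) : x ≫ eqToHom h = eqToHom h₁ ≫ eqToHom h₁.symm ≫ x ≫ eqToHom h := by
  subst h₁ h
  simp

/-- The initial class of the prism over `σ`. -/
def prismStart (σ : C(Simplex n, Z)) : basePt p σ ⟶ (FundamentalGroupoid.map p').obj
    ⟨(Φ.comp (σ.prodMap (ContinuousMap.id unitInterval))) (v₀ n, 0)⟩ :=
  overHom (hΦ (σ (v₀ n)) 0)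

/-- The prism operator of a homotopy `Φ` over `B`. -/
def prism (n : ℕ) : Op R p p' n (n + 1) := fun σ =>
  realize (Φ.comp (σ.prodMap (ContinuousMap.id unitInterval))) (w₀ := (v₀ n, 0))
    (prismStart Φ hΦ σ) (n + 1)
    (prismChain R (Simplex n) (n + 1) (Finsupp.single (vert n) 1))

/-- As the homotopy lies over `B`, the projection of the prism to `B` does not depend on the height,
and only the motion in the simplex contributes to the path class. -/
theorem prism_path (σ : C(Simplex n, Z)) (x y : Simplex n) (s t : unitInterval) :
    (FundamentalGroupoid.map p').map
      (modelEdge (Φ.comp (σ.prodMap (ContinuousMap.id unitInterval))) (x, s) (y, t)) =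
      overHom (p := p') (p' := p) (hΦ (σ x) s).symm ≫
        (FundamentalGroupoid.map p).map (edge σ x y) ≫
          overHom (p := p) (p' := p') (hΦ (σ y) t) := by
  have h : p'.comp (Φ.comp (σ.prodMap (ContinuousMap.id unitInterval))) =
      (p.comp σ).comp ContinuousMap.fst := by
    ext z
    exact hΦ _ _
  rw [map_modelEdge, modelEdge_congr h, modelEdge_comp]
  rfl

/-- The boundary of the prism is its top minus its bottom minus the prism on the boundary. The last
part cancels against `K ∂` by naturality of the prism under face inclusions. -/
theorem homotopyBd_prism {g₀ g₁ : C(Z, Z')} (h₀ : ∀ z, Φ (z, 0) = g₀ z)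
    (h₁ : ∀ z, Φ (z, 1) = g₁ z) (hg₀ : ∀ z, p' (g₀ z) = p z) (hg₁ : ∀ z, p' (g₁ z) = p z) :
    homotopyBd (prism (R := R) Φ hΦ) n = push g₁ hg₁ n - push g₀ hg₀ n := by
  -- A horizontal slice of the prism realizes as the push-forward by the map at that height; the
  -- path class contributed by the vertical edge is trivial in `B`.
  have key : ∀ (n : ℕ) (t : unitInterval) (g : C(Z, Z')) (_ : ∀ z, Φ (z, t) = g z)
      (hg : ∀ z, p' (g z) = p z) (σ : C(Simplex n, Z)),
      realize (Φ.comp (σ.prodMap (ContinuousMap.id unitInterval))) (w₀ := (v₀ n, 0))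
        (prismStart Φ hΦ σ) n
        (OrdChain.map (atHeight (Simplex n) t) (n + 1) (Finsupp.single (vert n) 1)) =
      push (R := R) g hg n σ := by
    intro n t g h hg σ
    rw [OrdChain.map_single, realize_single, push]
    have h2 : aff (atHeight (Simplex n) t ∘ vert n) = atHeight (Simplex n) t := by
      ext1 x
      refine Prod.ext (DFunLike.congr_fun (aff_vert n) x) ?_
      exact DFunLike.congr_fun (aff_const t) x
    rw [h2]
    congr 1
    refine Term.ext_of_eq (ContinuousMap.ext fun x => h (σ x)) ?_
    change (prismStart Φ hΦ σ ≫ (FundamentalGroupoid.map p').map (modelEdge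
      (Φ.comp (σ.prodMap (ContinuousMap.id unitInterval))) (v₀ n, 0) (v₀ n, t))) ≫ eqToHom _ = _
    rw [prism_path Φ hΦ]
    have h3 : (FundamentalGroupoid.map p).map (edge σ (v₀ n) (v₀ n)) = 𝟙 _ :=
      (congrArg _ (modelEdge_self σ _)).trans ((FundamentalGroupoid.map p).map_id _)
    rw [h3, Category.id_comp]
    exact eqToHom_comp₄ (congrArg FundamentalGroupoid.mk (hΦ (σ (v₀ n)) 0).symm) _ _ _
  cases n with
  | zero =>
    funext σ
    rw [homotopyBd, comp, prism, extend_bd_realize, bdry_prismChain, map_sub, map_sub,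
      key 0 1 g₁ h₁ hg₁ σ, key 0 0 g₀ h₀ hg₀ σ]
    simp [prismChain, OrdChain.coneHomotopy]
  | succ n =>
    funext σ
    rw [homotopyBd, Pi.add_apply, comp, prism, extend_bd_realize, bdry_prismChain, map_sub,
      map_sub, key (n + 1) 1 g₁ h₁ hg₁ σ, key (n + 1) 0 g₀ h₀ hg₀ σ, Pi.sub_apply,
      sub_add_eq_add_sub, add_sub_assoc, add_eq_left, sub_eq_zero]
    -- It remains to identify the prism chain on the boundary of the simplex with the prism operator
    -- applied to its faces, face by face.
    rw [OrdChain.bdry_single, map_sum, map_sum, comp, bd, map_sum]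
    refine Finset.sum_congr rfl fun i _ => ?_
    rw [extend_single, ← mul_one ((-1 : R) ^ (i : ℕ)), ← smul_eq_mul, ← Finsupp.smul_single,
      map_smul, map_smul, smul_eq_mul, mul_one, ← simplexMap_vert, ← OrdChain.map_single]
    congr 1
    rw [← map_prismChain]
    refine mapDomain_shift_realize (W₁ := Simplex n × unitInterval)
      (Φ.comp (σ.prodMap (ContinuousMap.id unitInterval))) _
      ((face i).prodMap (ContinuousMap.id unitInterval)) ?_ _ _ ?_ _
    · intro w
      ext1 x
      refine Prod.ext ?_ rfl
      exact DFunLike.congr_fun (simplexMap_aff _ (Prod.fst ∘ w)) x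
    · erw [prism_path Φ hΦ]
      exact eqToHom_cancel _
        (congrArg FundamentalGroupoid.mk (hΦ (σ (v₀ (n + 1))) 0).symm) _

theorem carries_prism {T : Set Z} {T' : Set Z'} (h : ∀ z ∈ T, ∀ t, Φ (z, t) ∈ T') :
    (prism (R := R) Φ hΦ n).Carries T T' := by
  classical
  intro σ hσ t ht
  obtain ⟨w, -, rfl⟩ := Finset.mem_image.1 (Finsupp.mapDomain_support ht)
  rintro _ ⟨x, rfl⟩
  exact h _ (hσ ⟨_, rfl⟩) _

end Op

end ModelOperators

/-! ### Small simplices -/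

section Subdivision

open ConvexModel (aff aff_comp)

variable {R : Type*} [CommRing R] {B Z : Type*} [TopologicalSpace B] [TopologicalSpace Z]
  {p : C(Z, B)} {n q : ℕ}

/-- The barycentre of an affine simplex in the standard simplex. -/
def bary (n q : ℕ) (w : Fin (q + 1) → Simplex n) : Simplex n := aff w stdSimplex.barycenter

theorem simplexMap_bary {m n : ℕ} (g : Fin (m + 1) → Fin (n + 1)) (q : ℕ)
    (w : Fin (q + 1) → Simplex m) : simplexMap g (bary m q w) = bary n q (simplexMap g ∘ w) :=
  DFunLike.congr_fun (simplexMap_aff g w) _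

theorem aff_mem_closedBall {w : Fin (q + 1) → Simplex n} {c : Simplex n} {D : ℝ}
    (h : ∀ i, w i ∈ Metric.closedBall c D) (x : Simplex q) : aff w x ∈ Metric.closedBall c D := by
  have := (convex_closedBall (c : Fin (n + 1) → ℝ) D).sum_mem (t := Finset.univ)
    (w := fun i => x i) (z := fun i => (w i : Fin (n + 1) → ℝ)) (fun i _ => x.2.1 i) x.2.2
    (fun i _ => h i)
  exact this

/-- In the average of the `q + 1` differences from `w i` the one of index `i` vanishes, which leaves
`q` terms of weight `1 / (q + 1)`. -/
theorem dist_bary_le {w : Fin (q + 1) → Simplex n} {D : ℝ} (h : ∀ i j, dist (w i) (w j) ≤ D)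
    (i : Fin (q + 1)) : dist (w i) (bary n q w) ≤ q / (q + 1) * D := by
  have hq : (0 : ℝ) < q + 1 := by positivity
  have h1 : (bary n q w).1 = ∑ j, ((q : ℝ) + 1)⁻¹ • (w j).1 := by
    change ∑ j, (stdSimplex.barycenter : Simplex q).1 j • (w j).1 = _
    simp [stdSimplex.barycenter_apply]
  have h2 : (w i).1 = ∑ _j : Fin (q + 1), ((q : ℝ) + 1)⁻¹ • (w i).1 := by
    rw [Finset.sum_const, Finset.card_univ, Fintype.card_fin, ← Nat.cast_smul_eq_nsmul ℝ,
      smul_smul, Nat.cast_add_one, mul_inv_cancel₀ hq.ne', one_smul]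
  rw [Subtype.dist_eq, h1, h2, dist_eq_norm, ← Finset.sum_sub_distrib]
  rw [Fin.sum_univ_succAbove _ i, sub_self, zero_add]
  refine (norm_sum_le _ _).trans ?_
  have h3 : ∀ j : Fin q, ‖((q : ℝ) + 1)⁻¹ • (w i).1 - ((q : ℝ) + 1)⁻¹ • (w (i.succAbove j)).1‖ ≤
      ((q : ℝ) + 1)⁻¹ * D := fun j => by
    rw [← smul_sub, norm_smul, Real.norm_of_nonneg (inv_nonneg.2 hq.le), ← dist_eq_norm]
    exact mul_le_mul_of_nonneg_left (h _ _) (inv_nonneg.2 hq.le)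
  refine (Finset.sum_le_sum fun j _ => h3 j).trans (le_of_eq ?_)
  simp
  ring

/-- Tuples of diameter at most `D`. -/
def diamLE (n q : ℕ) (D : ℝ) : Set (Fin q → Simplex n) := {w | ∀ i j, dist (w i) (w j) ≤ D}

theorem bary_mem_closedBall {c : Simplex n} {D : ℝ} (q : ℕ) (w : Fin (q + 1) → Simplex n)
    (h : ∀ i, w i ∈ Metric.closedBall c D) : bary n q w ∈ Metric.closedBall c D :=
  aff_mem_closedBall h _

/-- A new simplex is a cone from the barycentre on a piece of the subdivided boundary. The piece is
controlled by induction. Its distance from the barycentre is controlled because the subdivision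
stays in any ball around the barycentre that contains all vertices. -/
theorem sd_mem_diamLE {D : ℝ} {w : Fin (q + 1) → Simplex n} (hw : w ∈ diamLE n (q + 1) D) :
    OrdChain.sd (bary n) (q + 1) (Finsupp.single w (1 : R)) ∈
      Finsupp.supported R R (diamLE n (q + 1) (q / (q + 1) * D)) := by
  induction q with
  | zero =>
    intro v _ i j
    rw [Subsingleton.elim (α := Fin 1) i j, dist_self]
    simp
  | succ q ih =>
    have hD : 0 ≤ D := dist_nonneg.trans (hw 0 0)
    have hq : (0 : ℝ) < (q : ℝ) + 1 := by positivity
    rw [OrdChain.sd_single]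
    set b := bary n (q + 1) w with hb
    have h1 : OrdChain.sd (bary n) (q + 1) (OrdChain.bdry (q + 1) (Finsupp.single w (1 : R))) ∈
        Finsupp.supported R R (diamLE n (q + 1) (q / (q + 1) * D)) := by
      rw [OrdChain.bdry_single, map_sum]
      refine Submodule.sum_mem _ fun i _ => ?_
      rw [← Finsupp.smul_single_one, map_smul]
      exact Submodule.smul_mem _ _ (ih fun j k => hw _ _)
    have h2 : OrdChain.sd (bary n) (q + 1) (OrdChain.bdry (q + 1) (Finsupp.single w (1 : R))) ∈
        OrdChain.supportedIn R
          (Metric.closedBall b ((q + 1 : ℕ) / ((q + 1 : ℕ) + 1) * D)) (q + 1) :=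
      OrdChain.sd_mem bary_mem_closedBall (OrdChain.bdry_mem
        (Finsupp.single_mem_supported R _ fun i => dist_bary_le hw i))
    have h3 := Submodule.mem_inf.2 ⟨h1, h2⟩
    rw [OrdChain.supportedIn, ← Finsupp.supported_inter] at h3
    refine OrdChain.linearMap_mem (fun v hv => ?_) h3
    rw [OrdChain.cone_single]
    refine Finsupp.single_mem_supported R _ ?_
    have hle : (q : ℝ) / (q + 1) * D ≤ (q + 1 : ℕ) / ((q + 1 : ℕ) + 1) * D := by
      refine mul_le_mul_of_nonneg_right ?_ hD
      rw [div_le_div_iff₀ hq (by positivity)]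
      push_cast
      nlinarith
    have h0 : 0 ≤ ((q + 1 : ℕ) : ℝ) / ((q + 1 : ℕ) + 1) * D := by positivity
    intro i j
    refine Fin.cases ?_ (fun i => ?_) i <;> refine Fin.cases ?_ (fun j => ?_) j
    · simpa using h0
    · simpa [dist_comm] using hv.2 j
    · simpa using hv.2 i
    · simpa using (hv.1 i j).trans hle

theorem sd_pow_mem_diamLE {D : ℝ} {y : OrdChain R (Simplex n) (q + 1)}
    (hy : y ∈ Finsupp.supported R R (diamLE n (q + 1) D)) (k : ℕ) :
    (OrdChain.sd (bary n) (q + 1) ^ k) y ∈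
      Finsupp.supported R R (diamLE n (q + 1) ((q / (q + 1)) ^ k * D)) := by
  induction k with
  | zero => simpa using hy
  | succ k ih =>
    rw [pow_succ' (OrdChain.sd (bary n) (q + 1)), Module.End.mul_apply, pow_succ', mul_assoc]
    exact OrdChain.linearMap_mem (fun w hw => sd_mem_diamLE hw) ih

/-- Iterated cones on `w` remain in every ball that contains the vertices of `w`. A first use puts a
new vertex `v i` in the balls of radius `D` around all `w k`; so all `w k` lie in the ball around `v
i`, and a second use puts the other new vertices there. -/
theorem sdHomotopy_mem_diamLE {D : ℝ} {y : OrdChain R (Simplex n) q}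
    (hy : y ∈ Finsupp.supported R R (diamLE n q D)) :
    OrdChain.sdHomotopy (bary n) q y ∈ Finsupp.supported R R (diamLE n (q + 1) D) := by
  refine OrdChain.linearMap_mem (fun w hw => ?_) hy
  have key : ∀ c : Simplex n, (∀ k, w k ∈ Metric.closedBall c D) →
      OrdChain.sdHomotopy (bary n) q (Finsupp.single w (1 : R)) ∈
        OrdChain.supportedIn R (Metric.closedBall c D) (q + 1) := fun c hc =>
    OrdChain.sdHomotopy_mem bary_mem_closedBall (Finsupp.single_mem_supported R _ hc)
  intro v hv i j
  rw [dist_comm]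
  refine key (v i) (fun k => ?_) hv j
  rw [Metric.mem_closedBall_comm]
  exact key (w k) (fun l => hw l k) hv i

variable {U : Bool → Set Z}

/-- The simplex lies in one of the members of the cover `U`. -/
def IsSmall (U : Bool → Set Z) {q : ℕ} (σ : C(Simplex q, Z)) : Prop := ∃ j, Set.range σ ⊆ U j

/-- Tuples spanning an affine simplex with small image under `σ`. -/
def smallTuples (U : Bool → Set Z) (σ : C(Simplex n, Z)) (q : ℕ) : Set (Fin (q + 1) → Simplex n) :=
  {w | IsSmall U (σ.comp (aff w))}

/-- A Lebesgue number of the pulled back cover works for all `q`, since an affine simplex lies in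
any ball around its first vertex that contains its vertices. -/
theorem exists_diamLE_subset_smallTuples (hU : ∀ j, IsOpen (U j)) (hcov : ⋃ j, U j = Set.univ)
    (σ : C(Simplex n, Z)) : ∃ δ > 0, ∀ D < δ, ∀ q, diamLE n (q + 1) D ⊆ smallTuples U σ q := by
  have : CompactSpace (Simplex n) := isCompact_iff_compactSpace.1 (isCompact_stdSimplex ℝ _)
  obtain ⟨δ, hδ, h⟩ := lebesgue_number_lemma_of_metric (isCompact_univ (X := Simplex n))
    (c := fun j => σ ⁻¹' U j) (fun j => (hU j).preimage σ.continuous)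
    (fun x _ => by
      have : σ x ∈ ⋃ j, U j := hcov ▸ Set.mem_univ _
      simpa using this)
  refine ⟨δ, hδ, fun D hD q w hw => ?_⟩
  obtain ⟨j, hj⟩ := h (w 0) (Set.mem_univ _)
  refine ⟨j, ?_⟩
  rintro _ ⟨x, rfl⟩
  exact hj ((Metric.closedBall_subset_ball hD) (aff_mem_closedBall (fun i => hw i 0) x))

/-- Subdivision multiplies diameters by at most `n / (n + 1) < 1`, and the homotopy from a piece to
its subdivision does not increase them. -/
theorem exists_sd_pow_small (R : Type*) [CommRing R] (hU : ∀ j, IsOpen (U j))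
    (hcov : ⋃ j, U j = Set.univ) (σ : C(Simplex n, Z)) :
    ∃ m : ℕ, ∀ k ≥ m,
      (OrdChain.sd (bary n) (n + 1) ^ k) (Finsupp.single (vert n) 1) ∈
        Finsupp.supported R R (smallTuples U σ n) ∧
      OrdChain.sdHomotopy (bary n) (n + 1)
          ((OrdChain.sd (bary n) (n + 1) ^ k) (Finsupp.single (vert n) 1)) ∈
        Finsupp.supported R R (smallTuples U σ (n + 1)) := by
  obtain ⟨δ, hδ, h⟩ := exists_diamLE_subset_smallTuples hU hcov σ
  have hlim : Filter.Tendsto (fun k : ℕ => ((n : ℝ) / (n + 1)) ^ k *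
      Metric.diam (Set.univ : Set (Simplex n))) Filter.atTop (nhds 0) := by
    have := (tendsto_pow_atTop_nhds_zero_of_lt_one (r := (n : ℝ) / (n + 1)) (by positivity)
      ((div_lt_one (by positivity)).2 (by linarith))).mul_const
      (Metric.diam (Set.univ : Set (Simplex n)))
    simpa using this
  obtain ⟨m, hm⟩ := Filter.eventually_atTop.1 (hlim.eventually_lt_const hδ)
  refine ⟨m, fun k hk => ?_⟩
  have : CompactSpace (Simplex n) := isCompact_iff_compactSpace.1 (isCompact_stdSimplex ℝ _)
  have h1 := sd_pow_mem_diamLE (R := R) (D := Metric.diam (Set.univ : Set (Simplex n)))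
    (Finsupp.single_mem_supported R (1 : R) (s := diamLE n (n + 1) _) (a := vert n)
      fun i j => Metric.dist_le_diam_of_mem isCompact_univ.isBounded (Set.mem_univ _)
        (Set.mem_univ _)) k
  exact ⟨Finsupp.supported_mono (h _ (hm k hk) _) h1,
    Finsupp.supported_mono (h _ (hm k hk) _) (sdHomotopy_mem_diamLE h1)⟩

/-- A number of subdivisions after which `σ` has become small. -/
def sdNumber (R : Type*) [CommRing R] (hU : ∀ j, IsOpen (U j)) (hcov : ⋃ j, U j = Set.univ)
    (σ : C(Simplex n, Z)) : ℕ := (exists_sd_pow_small R hU hcov σ).choose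

/-- A number of subdivisions after which `σ` and all its faces have become small. -/
def sdNumberFaces (R : Type*) [CommRing R] (hU : ∀ j, IsOpen (U j)) (hcov : ⋃ j, U j = Set.univ)
    (σ : C(Simplex n, Z)) : ℕ :=
  (Finset.range (n + 1)).sup fun k => Finset.univ.sup fun g : Fin (k + 1) → Fin (n + 1) =>
    sdNumber R hU hcov (σ.comp (simplexMap g))

theorem sdNumber_le (hU : ∀ j, IsOpen (U j)) (hcov : ⋃ j, U j = Set.univ) (σ : C(Simplex n, Z)) :
    sdNumber R hU hcov σ ≤ sdNumberFaces R hU hcov σ := by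
  have h : σ.comp (simplexMap id) = σ := by
    rw [← aff_vert_comp, Function.comp_id, aff_vert, ContinuousMap.comp_id]
  have h1 : sdNumber R hU hcov (σ.comp (simplexMap id)) ≤ Finset.univ.sup
      fun g : Fin (n + 1) → Fin (n + 1) => sdNumber R hU hcov (σ.comp (simplexMap g)) :=
    Finset.le_sup (f := fun g : Fin (n + 1) → Fin (n + 1) =>
      sdNumber R hU hcov (σ.comp (simplexMap g))) (Finset.mem_univ id)
  rw [h] at h1
  exact h1.trans (Finset.le_sup (f := fun k => Finset.univ.sup
    fun g : Fin (k + 1) → Fin (n + 1) => sdNumber R hU hcov (σ.comp (simplexMap g)))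
    (Finset.self_mem_range_succ n))

/-- The maximum defining the number for `σ` runs over all simplices obtained from `σ` by vertex maps
from dimension at most that of `σ`, hence over all that occur for a face. -/
theorem sdNumberFaces_face_le (hU : ∀ j, IsOpen (U j)) (hcov : ⋃ j, U j = Set.univ)
    (σ : C(Simplex (n + 1), Z)) (i : Fin (n + 2)) :
    sdNumberFaces R hU hcov (σ.comp (face i)) ≤ sdNumberFaces R hU hcov σ := by
  refine Finset.sup_le fun k hk => Finset.sup_le fun g _ => ?_
  have h1 := Finset.le_sup (f := fun g : Fin (k + 1) → Fin (n + 2) =>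
    sdNumber R hU hcov (σ.comp (simplexMap g))) (Finset.mem_univ (i.succAbove ∘ g))
  have h : (σ.comp (face i)).comp (simplexMap g) = σ.comp (simplexMap (i.succAbove ∘ g)) := by
    rw [ContinuousMap.comp_assoc, face, simplexMap_comp]
  rw [h]
  exact h1.trans (Finset.le_sup (f := fun k => Finset.univ.sup
    fun g : Fin (k + 1) → Fin (n + 2) => sdNumber R hU hcov (σ.comp (simplexMap g)))
    (Finset.mem_range.2 (by have := Finset.mem_range.1 hk; omega)))

namespace Op

/-- The homotopy from the identity to an operator with small values. -/
def smallHomotopy (p : C(Z, B)) (hU : ∀ j, IsOpen (U j)) (hcov : ⋃ j, U j = Set.univ) (n : ℕ) :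
    Op R p p n (n + 1) :=
  localOp p fun σ => OrdChain.sdHomotopyIter (bary n) (sdNumberFaces R hU hcov σ) (n + 1)
    (Finsupp.single (vert n) 1)

/-- The number of subdivisions depends on the simplex, so `1 - ∂D - D∂` is not just a power of the
subdivision. It differs from one by homotopies on the faces, truncated at the number of `σ` and at
that of the face. Their difference only involves pieces that are already small. -/
theorem isSmall_of_mem_support (hU : ∀ j, IsOpen (U j)) (hcov : ⋃ j, U j = Set.univ)
    (σ : C(Simplex n, Z)) {t : Term p (basePt p σ) n}
    (ht : t ∈ ((one p n - homotopyBd (smallHomotopy p hU hcov) n : Op R p p n n) σ).support) :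
    IsSmall U t.1 := by
  have hsd : (OrdChain.sd (bary n) (n + 1) ^ sdNumberFaces R hU hcov σ)
      (Finsupp.single (vert n) 1) ∈ Finsupp.supported R R (smallTuples U σ n) :=
    ((exists_sd_pow_small R hU hcov σ).choose_spec _ (sdNumber_le hU hcov σ)).1
  suffices h : ∃ u : C(Simplex n, Z) → OrdChain R (Simplex n) (n + 1),
      one p n - homotopyBd (smallHomotopy p hU hcov) n = localOp p u ∧
        u σ ∈ Finsupp.supported R R (smallTuples U σ n) by
    obtain ⟨u, hu, hs⟩ := h
    rw [hu] at ht
    obtain ⟨w, hw, h⟩ := exists_of_mem_support_localOp ht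
    rw [h]
    exact hs hw
  cases n with
  | zero =>
    refine ⟨_, by rw [homotopyBd, smallHomotopy, bd_comp_localOp, one_eq_localOp, localOp_sub], ?_⟩
    rw [OrdChain.bdry_sdHomotopyIter]
    -- The boundary of a point is the empty tuple, on which the homotopy is zero, in accordance with
    -- the missing term `K ∂` in degree `0`.
    have h0 : OrdChain.sdHomotopyIter (bary 0) (sdNumberFaces R hU hcov σ) 0
        (OrdChain.bdry 0 (Finsupp.single (vert 0) (1 : R))) = 0 := by
      simp [OrdChain.sdHomotopyIter, OrdChain.sdHomotopy, OrdChain.coneHomotopy]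
    rw [h0, sub_zero, sub_sub_cancel]
    exact hsd
  | succ n =>
    refine ⟨_, by
      rw [homotopyBd, smallHomotopy, smallHomotopy, bd_comp_localOp, one_eq_localOp,
        localOp_comp_bd, ← sub_sub, localOp_sub, localOp_sub], ?_⟩
    have h1 : OrdChain.sdHomotopyIter (bary (n + 1)) (sdNumberFaces R hU hcov σ) (n + 1)
        (OrdChain.bdry (n + 1) (Finsupp.single (vert (n + 1)) (1 : R))) =
        ∑ i : Fin (n + 2), (-1 : R) ^ (i : ℕ) • OrdChain.map (face i) (n + 2)
          (OrdChain.sdHomotopyIter (bary n) (sdNumberFaces R hU hcov σ) (n + 1)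
            (Finsupp.single (vert n) 1)) := by
      rw [OrdChain.bdry_single, map_sum]
      refine Finset.sum_congr rfl fun i _ => ?_
      rw [← Finsupp.smul_single_one, map_smul, OrdChain.map_sdHomotopyIter (simplexMap_bary _),
        OrdChain.map_single, simplexMap_vert]
    have h2 : ∀ a b c d : OrdChain R (Simplex (n + 1)) (n + 2),
        a - (a - b - c) - d = b + (c - d) := fun _ _ _ _ => by abel
    rw [OrdChain.bdry_sdHomotopyIter, h1, h2, ← Finset.sum_sub_distrib]
    refine Submodule.add_mem _ hsd (Submodule.sum_mem _ fun i _ => ?_)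
    -- The surviving summands have index at least the number of the face, which is at least the
    -- bound from which its subdivisions and the homotopies on them are small.
    rw [← smul_sub, ← map_sub, OrdChain.sdHomotopyIter_sub _ (sdNumberFaces_face_le hU hcov σ i),
      map_sum]
    refine Submodule.smul_mem _ _ (Submodule.sum_mem _ fun k hk => ?_)
    refine OrdChain.linearMap_mem (fun w hw => ?_) ((exists_sd_pow_small R hU hcov
      (σ.comp (face i))).choose_spec k ((sdNumber_le hU hcov _).trans (Finset.mem_Ico.1 hk).1)).2
    rw [OrdChain.map_single]
    refine Finsupp.single_mem_supported R _ ?_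
    rw [smallTuples, Set.mem_ofPred_eq, ← simplexMap_aff, ← ContinuousMap.comp_assoc]
    exact hw

end Op

end Subdivision

/-! ### Push-forward, homotopies and homology -/

section PushForward

variable {R : Type*} [CommRing R] {B Z Z' Z'' : Type*} [TopologicalSpace B]
  [TopologicalSpace Z] [TopologicalSpace Z'] [TopologicalSpace Z'']
  {p : C(Z, B)} {p' : C(Z', B)} {p'' : C(Z'', B)} {n : ℕ}

namespace Op

theorem overHom_comp_edge {g : C(Z, Z')} (hg : ∀ z, p' (g z) = p z) (σ : C(Simplex n, Z))
    (s t : Simplex n) :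
    overHom (p := p) (p' := p') (hg (σ s)) ≫
        (FundamentalGroupoid.map p').map (edge (g.comp σ) s t) =
      (FundamentalGroupoid.map p).map (edge σ s t) ≫ overHom (hg (σ t)) := by
  have h : p'.comp (g.comp σ) = p.comp σ := ContinuousMap.ext fun x => hg (σ x)
  have h1 : (FundamentalGroupoid.map p').map (edge (g.comp σ) s t) =
      overHom (p := p') (p' := p) (hg (σ s)).symm ≫ (FundamentalGroupoid.map p).map (edge σ s t) ≫
        overHom (hg (σ t)) := modelEdge_congr h s t
  rw [h1, ← Category.assoc]
  have h2 : overHom (p := p) (p' := p') (hg (σ s)) ≫ overHom (hg (σ s)).symm = 𝟙 _ := by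
    simp only [overHom]
    exact eqToHom_trans _ _
  rw [h2, Category.id_comp]

theorem extend_push (g : C(Z, Z')) (hg : ∀ z, p' (g z) = p z) {b : FundamentalGroupoid B}
    (t : Term p b n) (a : R) :
    (push g hg n).extend b (Finsupp.single t a) =
      Finsupp.single ⟨g.comp t.1, t.2 ≫ overHom (hg (t.1 (v₀ n)))⟩ a := by
  rw [extend_single, push, Finsupp.mapDomain_single, Finsupp.smul_single_one]
  rfl

theorem bd_comp_push (g : C(Z, Z')) (hg : ∀ z, p' (g z) = p z) :
    (bd p' n).comp (push g hg (n + 1)) = (push g hg n).comp (bd p n : Op R p p (n + 1) n) := by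
  funext σ
  rw [comp, comp, push, extend_single, one_smul, bd, bd, Finsupp.mapDomain_finsetSum, map_sum]
  refine Finset.sum_congr rfl fun i _ => ?_
  rw [extend_push, Finsupp.mapDomain_single]
  congr 1
  exact Sigma.ext rfl (heq_of_eq (overHom_comp_edge hg σ _ _))

theorem push_comp_push (g : C(Z, Z')) (hg : ∀ z, p' (g z) = p z) (g' : C(Z', Z''))
    (hg' : ∀ z, p'' (g' z) = p' z) :
    (push g' hg' n).comp (push g hg n : Op R p p' n n) =
      push (g'.comp g) (fun z => (hg' (g z)).trans (hg z)) n := by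
  funext σ
  rw [comp, push, extend_push, push]
  congr 1
  exact Sigma.ext rfl (heq_of_eq (eqToHom_trans
    (congrArg FundamentalGroupoid.mk (hg (σ (v₀ n))).symm)
    (congrArg FundamentalGroupoid.mk (hg' (g (σ (v₀ n)))).symm)))

theorem push_id : (push (ContinuousMap.id Z) (fun _ => rfl) n : Op R p p n n) = one p n := rfl

theorem comp_homotopyBd (g : C(Z', Z'')) (hg : ∀ z, p'' (g z) = p' z)
    (K : ∀ n, Op R p p' n (n + 1)) :
    (push g hg n).comp (homotopyBd K n) =
      homotopyBd (fun n => (push g hg (n + 1)).comp (K n)) n := by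
  cases n with
  | zero => rw [homotopyBd, homotopyBd, ← comp_assoc, ← bd_comp_push, comp_assoc]
  | succ n =>
    rw [homotopyBd, homotopyBd, comp_add, ← comp_assoc, ← bd_comp_push, comp_assoc, comp_assoc]

theorem homotopyBd_sub (K K' : ∀ n, Op R p p' n (n + 1)) :
    homotopyBd (fun n => K n - K' n) n = homotopyBd K n - homotopyBd K' n := by
  cases n with
  | zero => simp only [homotopyBd, comp_sub]
  | succ n =>
    simp only [homotopyBd, comp_sub, sub_comp]
    abel

theorem homotopyBd_add (K K' : ∀ n, Op R p p' n (n + 1)) :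
    homotopyBd (fun n => K n + K' n) n = homotopyBd K n + homotopyBd K' n := by
  cases n with
  | zero => simp only [homotopyBd, comp_add]
  | succ n =>
    simp only [homotopyBd, comp_add, add_comp]
    abel

theorem Carries.homotopyBd {K : ∀ n, Op R p p' n (n + 1)} {T : Set Z} {T' : Set Z'}
    (h : ∀ n, (K n).Carries T T') (n : ℕ) : (homotopyBd K n).Carries T T' := by
  cases n with
  | zero => exact (carries_bd T').comp (h 0)
  | succ n => exact ((carries_bd T').comp (h _)).add ((h n).comp (carries_bd T))

variable (A : LocalSystem R B)

theorem boundary_chain_push (g : C(Z, Z')) (hg : ∀ z, p' (g z) = p z)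
    (c : Chain (A.pullback p) (n + 1)) :
    boundary (A.pullback p') n ((push g hg (n + 1)).chain A c) =
      (push g hg n).chain A (boundary (A.pullback p) n c) := by
  rw [← chain_bd, ← chain_bd, ← chain_comp, ← chain_comp, bd_comp_push]

theorem coboundary_cochain_push (g : C(Z, Z')) (hg : ∀ z, p' (g z) = p z)
    (φ : Cochain (A.pullback p') n) :
    coboundary (A.pullback p) n ((push g hg n).cochain A φ) =
      (push g hg (n + 1)).cochain A (coboundary (A.pullback p') n φ) := by
  rw [← cochain_bd, ← cochain_bd, ← cochain_comp, ← cochain_comp, bd_comp_push]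

theorem boundary_boundary (c : Chain (A.pullback p) (n + 2)) :
    boundary (A.pullback p) n (boundary (A.pullback p) (n + 1) c) = 0 := by
  rw [← chain_bd, ← chain_bd, ← chain_comp, bd_comp_bd]
  have := chain_sub A (0 : Op R p p (n + 2) n) 0
  rw [sub_zero] at this
  rw [this, sub_self, LinearMap.zero_apply]

theorem coboundary_coboundary (φ : Cochain (A.pullback p) n) :
    coboundary (A.pullback p) (n + 1) (coboundary (A.pullback p) n φ) = 0 := by
  rw [← cochain_bd, ← cochain_bd, ← cochain_comp, bd_comp_bd]
  have := cochain_sub A (0 : Op R p p (n + 2) n) 0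
  rw [sub_zero] at this
  rw [this, sub_self, LinearMap.zero_apply]

open scoped Classical in
theorem chain_push_single (g : C(Z, Z')) (hg : ∀ z, p' (g z) = p z) (σ : C(Simplex n, Z))
    (x : (A.pullback p).obj ⟨σ (v₀ n)⟩) :
    (push g hg n).chain A (DFinsupp.single σ x) =
      DFinsupp.single (β := fun τ : C(Simplex n, Z') => (A.pullback p').obj ⟨τ (v₀ n)⟩)
        (g.comp σ) ((A.map (overHom (p := p) (p' := p') (hg (σ (v₀ n))))).hom x) := by
  rw [chain_single, push, chainEval_single, one_smul]

theorem cochain_push_apply (g : C(Z, Z')) (hg : ∀ z, p' (g z) = p z)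
    (φ : Cochain (A.pullback p') n) (σ : C(Simplex n, Z)) :
    (push g hg n).cochain A φ σ = (A.map (Groupoid.inv
      (overHom (p := p) (p' := p') (hg (σ (v₀ n)))))).hom (φ (g.comp σ)) := by
  rw [cochain_apply, push, cochainEval_single, one_smul]

theorem map_hom_injective {b b' : FundamentalGroupoid B} (γ : b ⟶ b') :
    Function.Injective (A.map γ).hom := by
  intro x y h
  have h1 := congrArg (A.map (Groupoid.inv γ)).hom h
  have h2 : ∀ x, (A.map (Groupoid.inv γ)).hom ((A.map γ).hom x) = x := fun x => by
    rw [← LinearMap.comp_apply, ← ModuleCat.hom_comp, ← A.map_comp, Groupoid.comp_inv, A.map_id]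
    rfl
  rwa [h2, h2] at h1

theorem chain_push_apply {g : C(Z, Z')} (hg : ∀ z, p' (g z) = p z) (hinj : Function.Injective g)
    (c : Chain (A.pullback p) n) (σ : C(Simplex n, Z)) :
    (push g hg n).chain A c (g.comp σ) =
      (A.map (overHom (p := p) (p' := p') (hg (σ (v₀ n))))).hom (c σ) := by
  classical
  induction c using DFinsupp.induction with
  | h0 => simp
  | ha τ x c _ _ ih =>
    rw [map_add, DFinsupp.add_apply, DFinsupp.add_apply, ih, map_add, chain_push_single]
    congr 1
    by_cases h : τ = σ
    · subst h
      rw [DFinsupp.single_eq_same, DFinsupp.single_eq_same]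
    · rw [DFinsupp.single_eq_of_ne (Ne.symm h), DFinsupp.single_eq_of_ne, map_zero]
      intro h'
      exact h (ContinuousMap.ext fun x => (hinj (DFunLike.congr_fun h' x)).symm)

theorem mem_chainsIn_of_push {g : C(Z, Z')} (hg : ∀ z, p' (g z) = p z)
    (hinj : Function.Injective g) {T : Set Z'} {c : Chain (A.pullback p) n}
    (h : (push g hg n).chain A c ∈ chainsIn (A.pullback p') T n) :
    c ∈ chainsIn (A.pullback p) (g ⁻¹' T) n := by
  intro σ hσ
  have := h (g.comp σ) fun hr => hσ (by
    rintro _ ⟨x, rfl⟩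
    exact hr ⟨x, rfl⟩)
  rw [chain_push_apply A hg hinj] at this
  exact map_hom_injective A _ (this.trans (map_zero _).symm)

/-- A set-theoretic lift is continuous because `g` induces the topology of its source. -/
theorem exists_lift {g : C(Z, Z')} (hemb : Topology.IsEmbedding g) {τ : C(Simplex n, Z')}
    (h : Set.range τ ⊆ Set.range g) : ∃ σ : C(Simplex n, Z), g.comp σ = τ := by
  choose s hs using fun x => h ⟨x, rfl⟩
  refine ⟨⟨s, hemb.continuous_iff.2 ?_⟩, ContinuousMap.ext hs⟩
  have : g ∘ s = τ := funext hs
  rw [this]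
  exact τ.continuous

theorem exists_chain_push_eq {g : C(Z, Z')} (hg : ∀ z, p' (g z) = p z)
    (hemb : Topology.IsEmbedding g) {c : Chain (A.pullback p') n}
    (hc : c ∈ chainsIn (A.pullback p') (Set.range g) n) :
    ∃ c', (push g hg n).chain A c' = c := by
  classical
  refine chain_induction (P := fun c => ∃ c', (push g hg n).chain A c' = c) ⟨0, map_zero _⟩ ?_ ?_ hc
  · rintro _ _ ⟨c, rfl⟩ ⟨c', rfl⟩
    exact ⟨c + c', map_add _ _ _⟩
  · intro τ x hτ
    obtain ⟨σ, rfl⟩ := exists_lift hemb hτ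
    refine ⟨DFinsupp.single σ ((A.map (Groupoid.inv
      (overHom (p := p) (p' := p') (hg (σ (v₀ n)))))).hom x), ?_⟩
    rw [chain_push_single]
    congr 1
    rw [← LinearMap.comp_apply, ← ModuleCat.hom_comp, ← A.map_comp, Groupoid.inv_comp, A.map_id]
    rfl

theorem mem_relCochains_of_push {g : C(Z, Z')} (hg : ∀ z, p' (g z) = p z)
    (hemb : Topology.IsEmbedding g) {T : Set Z'} (hT : T ⊆ Set.range g)
    {φ : Cochain (A.pullback p') n}
    (h : (push g hg n).cochain A φ ∈ relCochains (A.pullback p) (g ⁻¹' T) n) :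
    φ ∈ relCochains (A.pullback p') T n := by
  intro τ hτ
  obtain ⟨σ, rfl⟩ := exists_lift hemb (hτ.trans hT)
  have := h σ (by
    rintro _ ⟨x, rfl⟩
    exact hτ ⟨x, rfl⟩)
  rw [cochain_push_apply] at this
  exact map_hom_injective A _ (this.trans (map_zero _).symm)

/-- Extension by zero to the simplices that do not come from `Z`; injectivity of `g` makes the lift
of a simplex unique. -/
theorem exists_cochain_push_eq {g : C(Z, Z')} (hg : ∀ z, p' (g z) = p z)
    (hinj : Function.Injective g) (ψ : Cochain (A.pullback p) n) :
    ∃ φ : Cochain (A.pullback p') n, (push g hg n).cochain A φ = ψ ∧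
      ∀ τ : C(Simplex n, Z'), (¬ ∃ σ, g.comp σ = τ) → φ τ = 0 := by
  classical
  have hτ : ∀ {τ : C(Simplex n, Z')} (h : ∃ σ : C(Simplex n, Z), g.comp σ = τ),
      p' (τ (v₀ n)) = p (h.choose (v₀ n)) := fun h => by
    rw [← hg]
    exact congrArg p' (DFunLike.congr_fun h.choose_spec (v₀ n)).symm
  refine ⟨fun τ => if h : ∃ σ : C(Simplex n, Z), g.comp σ = τ then
    (A.map (overHom (p := p) (p' := p') (hτ h))).hom (ψ h.choose) else 0, ?_, ?_⟩
  · funext σ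
    have hex : ∃ σ' : C(Simplex n, Z), g.comp σ' = g.comp σ := ⟨σ, rfl⟩
    rw [cochain_push_apply, dif_pos hex]
    have hch : hex.choose = σ := ContinuousMap.ext fun x =>
      hinj (DFunLike.congr_fun hex.choose_spec x)
    have key : ∀ (σ' : C(Simplex n, Z)) (_ : σ' = σ) (h : p' (g (σ (v₀ n))) = p (σ' (v₀ n))),
        (A.map (Groupoid.inv (overHom (p := p) (p' := p') (hg (σ (v₀ n)))))).hom
          ((A.map (overHom (p := p) (p' := p') h)).hom (ψ σ')) = ψ σ := by
      rintro _ rfl h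
      rw [← LinearMap.comp_apply, ← ModuleCat.hom_comp, ← A.map_comp, Groupoid.comp_inv, A.map_id]
      rfl
    exact key _ hch _
  · intro τ h
    exact dif_neg h

end Op

end PushForward

/-! ### Cycles and boundaries of pairs and triples of subsets -/

section RelativeGroups

variable {R : Type*} [CommRing R] {Z : Type*} [TopologicalSpace Z] (A : LocalSystem R Z) {n : ℕ}

theorem chainsIn_empty (n : ℕ) : chainsIn A ∅ n = ⊥ := by
  refine (Submodule.eq_bot_iff _).2 fun c hc => DFinsupp.ext fun σ => hc σ fun h => ?_
  exact h ⟨v₀ n, rfl⟩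

theorem chainsIn_mono {S T : Set Z} (h : S ⊆ T) (n : ℕ) : chainsIn A S n ≤ chainsIn A T n :=
  fun _ hc σ hσ => hc σ fun h' => hσ (h'.trans h)

theorem relCochains_anti {S T : Set Z} (h : S ⊆ T) (n : ℕ) :
    relCochains A T n ≤ relCochains A S n :=
  fun _ hφ σ hσ => hφ σ (hσ.trans h)

theorem mem_relCochains_empty (φ : Cochain A n) : φ ∈ relCochains A ∅ n :=
  fun _ h => (h ⟨v₀ n, rfl⟩).elim

theorem mem_relCochains_univ {φ : Cochain A n} (h : φ ∈ relCochains A Set.univ n) : φ = 0 :=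
  funext fun σ => h σ (Set.subset_univ _)

theorem boundaries_mono {S T : Set Z} (h : S ⊆ T) (n : ℕ) : boundaries A S n ≤ boundaries A T n :=
  sup_le_sup_left (chainsIn_mono A h n) _

theorem cocycles_anti {S T : Set Z} (h : S ⊆ T) (n : ℕ) : cocycles A T n ≤ cocycles A S n :=
  inf_le_inf_right _ (relCochains_anti A h n)

theorem mem_boundaries_empty {c : Chain A n} :
    c ∈ boundaries A ∅ n ↔ ∃ d, boundary A n d = c := by
  rw [boundaries, chainsIn_empty, sup_bot_eq, LinearMap.mem_range]

theorem mem_cycles_succ {S : Set Z} {c : Chain A (n + 1)} :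
    c ∈ cycles A S (n + 1) ↔ boundary A n c ∈ chainsIn A S n := Iff.rfl

theorem mem_cocycles {S : Set Z} {φ : Cochain A n} :
    φ ∈ cocycles A S n ↔ φ ∈ relCochains A S n ∧ coboundary A n φ = 0 := Iff.rfl

/-- The cycles of the pair `(S, T)` of subsets of `Z`. -/
def pairCycles (S T : Set Z) (n : ℕ) : Submodule R (Chain A n) := chainsIn A S n ⊓ cycles A T n

/-- The boundaries of the pair `(S, T)` of subsets of `Z`. -/
def pairBoundaries (S T : Set Z) (n : ℕ) : Submodule R (Chain A n) :=
  (chainsIn A S (n + 1)).map (boundary A n) ⊔ chainsIn A T n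

/-- Cochains of `(Z, T)` representing cocycles of the pair `(S, T)`. -/
def pairCocycles (S T : Set Z) (n : ℕ) : Submodule R (Cochain A n) :=
  -- Every cochain of `S` extends by zero to `Z`, so the pair `(S, T)` can be described by cochains
  -- of `Z` modulo those that vanish on `S`.
  relCochains A T n ⊓ (relCochains A S (n + 1)).comap (coboundary A n)

/-- Cochains of `(Z, T)` representing coboundaries of the pair `(S, T)`. -/
def pairCoboundaries (S T : Set Z) (n : ℕ) : Submodule R (Cochain A n) :=
  coboundaries A T n ⊔ relCochains A S n

theorem mem_pairCocycles {S T : Set Z} {φ : Cochain A n} : φ ∈ pairCocycles A S T n ↔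
    φ ∈ relCochains A T n ∧ coboundary A n φ ∈ relCochains A S (n + 1) := Iff.rfl

theorem pairBoundaries_le (S T : Set Z) (n : ℕ) : pairBoundaries A S T n ≤ boundaries A T n :=
  sup_le_sup_right (LinearMap.map_le_range) _

end RelativeGroups

/-! ### Homotopy invariance and chain equivalences over the base -/

section HomotopyInvariance

variable {R : Type*} [CommRing R] {B Z Z' : Type*} [TopologicalSpace B]
  [TopologicalSpace Z] [TopologicalSpace Z'] {p : C(Z, B)} {p' : C(Z', B)} {n : ℕ}
  (A : LocalSystem R B)

namespace Op

/-- On a relative cycle `c`, the term `∂K c` bounds a chain in `S'`, and `K ∂c` lies in `T'` because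
`∂c` lies in `T`. -/
theorem homotopyBd_chain_mem {K : ∀ n, Op R p p' n (n + 1)} {S T : Set Z} {S' T' : Set Z'}
    (hS : ∀ n, (K n).Carries S S') (hT : ∀ n, (K n).Carries T T') {c : Chain (A.pullback p) n}
    (hc : c ∈ pairCycles (A.pullback p) S T n) :
    (homotopyBd K n).chain A c ∈ pairBoundaries (A.pullback p') S' T' n := by
  cases n with
  | zero =>
    rw [homotopyBd, chain_comp, chain_bd]
    exact Submodule.mem_sup_left ⟨_, (hS 0).chain_mem A hc.1, rfl⟩
  | succ n =>
    rw [homotopyBd, chain_add, LinearMap.add_apply, chain_comp, chain_bd, chain_comp, chain_bd]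
    exact Submodule.add_mem _ (Submodule.mem_sup_left ⟨_, (hS _).chain_mem A hc.1, rfl⟩)
      (Submodule.mem_sup_right ((hT n).chain_mem A hc.2))

theorem homotopyBd_chain_mem_boundaries {K : ∀ n, Op R p p' n (n + 1)} {T : Set Z} {T' : Set Z'}
    (hT : ∀ n, (K n).Carries T T') {c : Chain (A.pullback p) n}
    (hc : c ∈ cycles (A.pullback p) T n) :
    (homotopyBd K n).chain A c ∈ boundaries (A.pullback p') T' n :=
  pairBoundaries_le _ _ _ _ (homotopyBd_chain_mem A (S := Set.univ) (S' := Set.univ)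
    (fun _ _ _ _ _ => Set.subset_univ _) hT ⟨fun _ h => (h (Set.subset_univ _)).elim, hc⟩)

/-- The roles of the two terms are exchanged: `K ∂` acts as a coboundary of a cochain vanishing on
`T`, and `∂K` acts through the coboundary of `φ`, which vanishes on `S'`. -/
theorem homotopyBd_cochain_mem {K : ∀ n, Op R p p' n (n + 1)} {S T : Set Z} {S' T' : Set Z'}
    (hS : ∀ n, (K n).Carries S S') (hT : ∀ n, (K n).Carries T T')
    {φ : Cochain (A.pullback p') n} (hφ : φ ∈ pairCocycles (A.pullback p') S' T' n) :
    (homotopyBd K n).cochain A φ ∈ pairCoboundaries (A.pullback p) S T n := by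
  cases n with
  | zero =>
    rw [homotopyBd, cochain_comp, cochain_bd]
    exact Submodule.mem_sup_right ((hS 0).cochain_mem A hφ.2)
  | succ n =>
    rw [homotopyBd, cochain_add, LinearMap.add_apply, cochain_comp, cochain_bd, cochain_comp,
      cochain_bd]
    exact Submodule.add_mem _ (Submodule.mem_sup_right ((hS _).cochain_mem A hφ.2))
      (Submodule.mem_sup_left ⟨_, (hT n).cochain_mem A hφ.1, rfl⟩)

theorem homotopyBd_cochain_mem_coboundaries {K : ∀ n, Op R p p' n (n + 1)} {T : Set Z}
    {T' : Set Z'} (hT : ∀ n, (K n).Carries T T') {φ : Cochain (A.pullback p') n}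
    (hφ : φ ∈ cocycles (A.pullback p') T' n) :
    (homotopyBd K n).cochain A φ ∈ coboundaries (A.pullback p) T n := by
  -- The pair `(Z, T)` is the triple with `S` the whole space; the summand that vanishes on `S` is
  -- then zero.
  have h := homotopyBd_cochain_mem A (S := Set.univ) (S' := Set.univ) (T := T) (T' := T')
    (K := K) (φ := φ) (fun _ _ _ _ _ => Set.subset_univ _) hT
    ((mem_pairCocycles _).2 ⟨hφ.1, by
      rw [((mem_cocycles _).1 hφ).2]
      exact Submodule.zero_mem _⟩)
  obtain ⟨x, hx, y, hy, hxy⟩ := Submodule.mem_sup.1 h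
  rw [mem_relCochains_univ _ hy, add_zero] at hxy
  rwa [← hxy]

variable {g : C(Z, Z')} (hg : ∀ z, p' (g z) = p z) {T : Set Z} {T' : Set Z'}

theorem push_mem_cycles (h : Set.MapsTo g T T') {c : Chain (A.pullback p) n}
    (hc : c ∈ cycles (A.pullback p) T n) :
    (push g hg n).chain A c ∈ cycles (A.pullback p') T' n := by
  cases n with
  | zero => exact Submodule.mem_top
  | succ n =>
    rw [mem_cycles_succ, boundary_chain_push]
    exact (carries_push h).chain_mem A hc

theorem push_mem_boundaries (h : Set.MapsTo g T T') {c : Chain (A.pullback p) n}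
    (hc : c ∈ boundaries (A.pullback p) T n) :
    (push g hg n).chain A c ∈ boundaries (A.pullback p') T' n := by
  obtain ⟨_, ⟨d, rfl⟩, t, ht, rfl⟩ := Submodule.mem_sup.1 hc
  rw [map_add, ← boundary_chain_push]
  exact Submodule.add_mem _ (Submodule.mem_sup_left ⟨_, rfl⟩)
    (Submodule.mem_sup_right ((carries_push h).chain_mem A ht))

theorem push_mem_cocycles (h : Set.MapsTo g T T') {φ : Cochain (A.pullback p') n}
    (hφ : φ ∈ cocycles (A.pullback p') T' n) :
    (push g hg n).cochain A φ ∈ cocycles (A.pullback p) T n := by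
  refine (mem_cocycles _).2 ⟨(carries_push h).cochain_mem A hφ.1, ?_⟩
  rw [coboundary_cochain_push, ((mem_cocycles _).1 hφ).2, map_zero]

theorem push_mem_coboundaries (h : Set.MapsTo g T T') {φ : Cochain (A.pullback p') n}
    (hφ : φ ∈ coboundaries (A.pullback p') T' n) :
    (push g hg n).cochain A φ ∈ coboundaries (A.pullback p) T n := by
  cases n with
  | zero =>
    obtain rfl : φ = 0 := hφ
    rw [map_zero]
    exact Submodule.zero_mem _
  | succ n =>
    obtain ⟨ψ, hψ, rfl⟩ := hφ
    rw [← coboundary_cochain_push]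
    exact ⟨_, (carries_push h).cochain_mem A hψ, rfl⟩

end Op

/-- Two maps over `B` induce homotopic operators on singular chains. -/
def ChainHomotopic (R : Type*) [CommRing R] {g g' : C(Z, Z')} (hg : ∀ z, p' (g z) = p z)
    (hg' : ∀ z, p' (g' z) = p z) : Prop :=
  ∃ K : ∀ n, Op R p p' n (n + 1), ∀ n, Op.push g hg n - Op.push g' hg' n = Op.homotopyBd K n

theorem ChainHomotopic.trans {g g' g'' : C(Z, Z')} {hg : ∀ z, p' (g z) = p z}
    {hg' : ∀ z, p' (g' z) = p z} {hg'' : ∀ z, p' (g'' z) = p z} (h : ChainHomotopic R hg hg')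
    (h' : ChainHomotopic R hg' hg'') : ChainHomotopic R hg hg'' := by
  obtain ⟨K, hK⟩ := h
  obtain ⟨K', hK'⟩ := h'
  exact ⟨fun n => K n + K' n, fun n => by
    rw [Op.homotopyBd_add, ← hK, ← hK', sub_add_sub_cancel]⟩

theorem ChainHomotopic.of_homotopy (Φ : C(Z × unitInterval, Z')) (hΦ : ∀ z t, p' (Φ (z, t)) = p z)
    {g g' : C(Z, Z')} (hg : ∀ z, p' (g z) = p z) (hg' : ∀ z, p' (g' z) = p z)
    (h₀ : ∀ z, Φ (z, 0) = g' z) (h₁ : ∀ z, Φ (z, 1) = g z) : ChainHomotopic R hg hg' :=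
  ⟨Op.prism Φ hΦ, fun _ => (Op.homotopyBd_prism Φ hΦ h₀ h₁ hg' hg).symm⟩

theorem ChainHomotopic.chain_sub_mem {g g' : C(Z, Z')} {hg : ∀ z, p' (g z) = p z}
    {hg' : ∀ z, p' (g' z) = p z} (h : ChainHomotopic R hg hg') {c : Chain (A.pullback p) n}
    (hc : c ∈ cycles (A.pullback p) ∅ n) :
    (Op.push g hg n).chain A c - (Op.push g' hg' n).chain A c ∈ boundaries (A.pullback p') ∅ n := by
  obtain ⟨K, hK⟩ := h
  rw [← LinearMap.sub_apply, ← Op.chain_sub, hK]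
  exact Op.homotopyBd_chain_mem_boundaries A (fun _ σ hσ => (hσ ⟨v₀ _, rfl⟩).elim) hc

theorem ChainHomotopic.cochain_sub_mem {g g' : C(Z, Z')} {hg : ∀ z, p' (g z) = p z}
    {hg' : ∀ z, p' (g' z) = p z} (h : ChainHomotopic R hg hg') {φ : Cochain (A.pullback p') n}
    (hφ : φ ∈ cocycles (A.pullback p') ∅ n) :
    (Op.push g hg n).cochain A φ - (Op.push g' hg' n).cochain A φ ∈
      coboundaries (A.pullback p) ∅ n := by
  obtain ⟨K, hK⟩ := h
  rw [← LinearMap.sub_apply, ← Op.cochain_sub, hK]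
  exact Op.homotopyBd_cochain_mem_coboundaries A (fun _ σ hσ => (hσ ⟨v₀ _, rfl⟩).elim) hφ

/-- A map over `B` with an inverse up to chain homotopy over `B`. -/
structure IsChainEquiv (R : Type*) [CommRing R] {e : C(Z, Z')} (he : ∀ z, p' (e z) = p z) :
    Prop where
  exists_inverse : ∃ (g : C(Z', Z)) (hg : ∀ z, p (g z) = p' z),
    ChainHomotopic R (p := p) (p' := p) (g := g.comp e) (g' := ContinuousMap.id Z)
      (fun z => (hg (e z)).trans (he z)) (fun _ => rfl) ∧
    ChainHomotopic R (p := p') (p' := p') (g := e.comp g) (g' := ContinuousMap.id Z')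
      (fun z => (he (g z)).trans (hg z)) (fun _ => rfl)

namespace IsChainEquiv

variable {e : C(Z, Z')} {he : ∀ z, p' (e z) = p z}

theorem exists_cycle (h : IsChainEquiv R he) {y : Chain (A.pullback p') n}
    (hy : y ∈ cycles (A.pullback p') ∅ n) :
    ∃ x ∈ cycles (A.pullback p) ∅ n,
      y - (Op.push e he n).chain A x ∈ boundaries (A.pullback p') ∅ n := by
  obtain ⟨g, hg, -, h2⟩ := h.exists_inverse
  refine ⟨(Op.push g hg n).chain A y, Op.push_mem_cycles A hg (Set.mapsTo_empty _ _) hy, ?_⟩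
  have := h2.chain_sub_mem A hy
  rw [← Op.push_comp_push g hg e he, Op.push_id, Op.chain_comp, Op.chain_one] at this
  rw [← neg_sub]
  exact Submodule.neg_mem _ this

theorem mem_boundaries (h : IsChainEquiv R he) {x : Chain (A.pullback p) n}
    (hx : x ∈ cycles (A.pullback p) ∅ n)
    (hb : (Op.push e he n).chain A x ∈ boundaries (A.pullback p') ∅ n) :
    x ∈ boundaries (A.pullback p) ∅ n := by
  obtain ⟨g, hg, h1, -⟩ := h.exists_inverse
  have := h1.chain_sub_mem A hx
  rw [← Op.push_comp_push e he g hg, Op.push_id, Op.chain_comp, Op.chain_one] at this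
  have h3 := Submodule.sub_mem _ (Op.push_mem_boundaries A hg (Set.mapsTo_empty _ _) hb) this
  rwa [sub_sub_cancel] at h3

theorem exists_cocycle (h : IsChainEquiv R he) {y : Cochain (A.pullback p) n}
    (hy : y ∈ cocycles (A.pullback p) ∅ n) :
    ∃ x ∈ cocycles (A.pullback p') ∅ n,
      y - (Op.push e he n).cochain A x ∈ coboundaries (A.pullback p) ∅ n := by
  obtain ⟨g, hg, h1, -⟩ := h.exists_inverse
  refine ⟨(Op.push g hg n).cochain A y, Op.push_mem_cocycles A hg (Set.mapsTo_empty _ _) hy, ?_⟩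
  have := h1.cochain_sub_mem A hy
  rw [← Op.push_comp_push e he g hg, Op.push_id, Op.cochain_comp, Op.cochain_one] at this
  rw [← neg_sub]
  exact Submodule.neg_mem _ this

theorem mem_coboundaries (h : IsChainEquiv R he) {x : Cochain (A.pullback p') n}
    (hx : x ∈ cocycles (A.pullback p') ∅ n)
    (hb : (Op.push e he n).cochain A x ∈ coboundaries (A.pullback p) ∅ n) :
    x ∈ coboundaries (A.pullback p') ∅ n := by
  obtain ⟨g, hg, -, h2⟩ := h.exists_inverse
  have := h2.cochain_sub_mem A hx
  rw [← Op.push_comp_push g hg e he, Op.push_id, Op.cochain_comp, Op.cochain_one] at this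
  have h3 := Submodule.sub_mem _ (Op.push_mem_coboundaries A hg (Set.mapsTo_empty _ _) hb) this
  rwa [sub_sub_cancel] at h3

/-- The relative homology of a chain equivalence that is an embedding vanishes. -/
theorem cycles_le_boundaries (h : IsChainEquiv R he) (hemb : Topology.IsEmbedding e) :
    cycles (A.pullback p') (Set.range e) n ≤ boundaries (A.pullback p') (Set.range e) n := by
  intro c hc
  have hmaps : Set.MapsTo e Set.univ (Set.range e) := fun z _ => ⟨z, rfl⟩
  have hpush : ∀ x : Chain (A.pullback p) n, (Op.push e he n).chain A x ∈
      boundaries (A.pullback p') (Set.range e) n := fun x =>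
    Submodule.mem_sup_right ((Op.carries_push hmaps).chain_mem A
      fun _ h => (h (Set.subset_univ _)).elim)
  have key : ∀ c ∈ cycles (A.pullback p') ∅ n,
      c ∈ boundaries (A.pullback p') (Set.range e) n := fun c hc => by
    obtain ⟨x, -, hx⟩ := h.exists_cycle A hc
    have := Submodule.add_mem _ (boundaries_mono _ (Set.empty_subset _) n hx) (hpush x)
    rwa [sub_add_cancel] at this
  cases n with
  | zero => exact key c Submodule.mem_top
  | succ n =>
    -- The boundary of `c` comes from a cycle `m` of `Z`. Its image bounds `c`, so `m = ∂d`, and `c`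
    -- minus the image of `d` is an absolute cycle, to which `key` applies.
    obtain ⟨m, hm⟩ := Op.exists_chain_push_eq A he hemb hc
    have hmc : m ∈ cycles (A.pullback p) ∅ n := by
      cases n with
      | zero => exact Submodule.mem_top
      | succ n =>
        have : (Op.push e he n).chain A (boundary (A.pullback p) n m) ∈
            chainsIn (A.pullback p') ∅ n := by
          rw [← Op.boundary_chain_push, hm, Op.boundary_boundary]
          exact Submodule.zero_mem _
        exact Op.mem_chainsIn_of_push A he hemb.injective this
    obtain ⟨d, rfl⟩ := (mem_boundaries_empty _).1
      (h.mem_boundaries A hmc ((mem_boundaries_empty _).2 ⟨c, hm.symm⟩))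
    have h1 := key (c - (Op.push e he (n + 1)).chain A d) (by
      rw [mem_cycles_succ, map_sub, Op.boundary_chain_push, hm, sub_self]
      exact Submodule.zero_mem _)
    have := Submodule.add_mem _ h1 (hpush d)
    rwa [sub_add_cancel] at this

/-- The relative cohomology of a chain equivalence that is an embedding vanishes. -/
theorem cocycles_le_coboundaries (h : IsChainEquiv R he) (hemb : Topology.IsEmbedding e) :
    cocycles (A.pullback p') (Set.range e) n ≤ coboundaries (A.pullback p') (Set.range e) n := by
  intro φ hφ
  have hrange : ∀ (k : ℕ) (ψ : Cochain (A.pullback p') k), (Op.push e he k).cochain A ψ = 0 →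
      ψ ∈ relCochains (A.pullback p') (Set.range e) k := fun k ψ h0 =>
    Op.mem_relCochains_of_push A he hemb subset_rfl (h0 ▸ Submodule.zero_mem _)
  have hmaps : Set.MapsTo e Set.univ (Set.range e) := fun z _ => ⟨z, rfl⟩
  have hz : (Op.push e he n).cochain A φ = 0 := mem_relCochains_univ _
    ((Op.carries_push hmaps).cochain_mem A hφ.1)
  have hcob := h.mem_coboundaries A (cocycles_anti _ (Set.empty_subset _) n hφ)
    (hz ▸ Submodule.zero_mem _)
  cases n with
  | zero => exact hcob
  | succ n =>
    obtain ⟨ψ, -, rfl⟩ := hcob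
    -- Absolutely `φ = δψ`, and `ψ` restricts to a cocycle of `Z`. Subtracting a global cocycle `y`
    -- and, in positive degrees, the coboundary of an extended cochain makes `ψ` vanish on the image
    -- of `e` without changing `δψ`.
    obtain ⟨y, hy, hyψ⟩ := h.exists_cocycle A (y := (Op.push e he n).cochain A ψ)
      ((mem_cocycles _).2 ⟨mem_relCochains_empty _ _, by rw [Op.coboundary_cochain_push, hz]⟩)
    have hy0 : coboundary (A.pullback p') n y = 0 := hy.2
    rw [← map_sub] at hyψ
    cases n with
    | zero =>
      refine ⟨ψ - y, hrange _ _ hyψ, ?_⟩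
      rw [map_sub, hy0, sub_zero]
    | succ n =>
      obtain ⟨χ, -, hχ⟩ := hyψ
      obtain ⟨χ', rfl, -⟩ := Op.exists_cochain_push_eq (p' := p') A he hemb.injective χ
      refine ⟨ψ - y - coboundary (A.pullback p') n χ', hrange _ _ ?_, ?_⟩
      · rw [map_sub, ← hχ, Op.coboundary_cochain_push, sub_self]
      · rw [map_sub, map_sub, hy0, Op.coboundary_coboundary, sub_zero, sub_zero]

end IsChainEquiv

end HomotopyInvariance

/-! ### Excision -/

section Excision

variable {R : Type*} [CommRing R] {B Z Z' : Type*} [TopologicalSpace B]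
  [TopologicalSpace Z] [TopologicalSpace Z'] {p : C(Z, B)} {p' : C(Z', B)} {n : ℕ}

namespace Op

theorem zero_comp {Z'' : Type*} [TopologicalSpace Z''] {p'' : C(Z'', B)} {q r : ℕ}
    (L : Op R p p' n q) : (0 : Op R p' p'' q r).comp L = 0 := by
  have := sub_comp (0 : Op R p' p'' q r) 0 L
  rwa [sub_self, sub_self] at this

theorem comp_zero {Z'' : Type*} [TopologicalSpace Z''] {p'' : C(Z'', B)} {q r : ℕ}
    (L : Op R p' p'' q r) : L.comp (0 : Op R p p' n q) = 0 :=
  funext fun _ => map_zero _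

/-- Both sides reduce to `∂K∂`; hence `1 - (∂K + K∂)` is a chain map. -/
theorem bd_comp_homotopyBd (K : ∀ n, Op R p p' n (n + 1)) :
    (bd p' n).comp (homotopyBd K (n + 1)) = (homotopyBd K n).comp (bd p n) := by
  have h : (bd p' n).comp (homotopyBd K (n + 1)) = ((bd p' n).comp (K n)).comp (bd p n) := by
    rw [homotopyBd, comp_add, ← comp_assoc, bd_comp_bd, zero_comp, zero_add, comp_assoc]
  rw [h]
  cases n with
  | zero => rw [homotopyBd]
  | succ n => rw [homotopyBd, add_comp, comp_assoc (K n), bd_comp_bd, comp_zero, add_zero]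

theorem Carries.inter {q : ℕ} {L : Op R p p' n q} {T₁ T₂ : Set Z} {T₁' T₂' : Set Z'}
    (h₁ : L.Carries T₁ T₁') (h₂ : L.Carries T₂ T₂') : L.Carries (T₁ ∩ T₂) (T₁' ∩ T₂') :=
  fun σ hσ t ht => Set.subset_inter (h₁ σ (hσ.trans Set.inter_subset_left) t ht)
    (h₂ σ (hσ.trans Set.inter_subset_right) t ht)

end Op

/-- The subsets `T` and `E` of `S` form an excisive couple: a homotopy that preserves `S`, `T`
and `E` deforms the chains of `S` into sums of chains of `T` and of `E`. -/
def IsExcisive (R : Type*) [CommRing R] (p : C(Z, B)) (S T E : Set Z) : Prop :=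
  ∃ K : ∀ n, Op R p p n (n + 1), (∀ n, (K n).Carries S S) ∧ (∀ n, (K n).Carries T T) ∧
    (∀ n, (K n).Carries E E) ∧ ∀ (n : ℕ) (σ : C(Simplex n, Z)), Set.range σ ⊆ S →
      ∀ t ∈ ((Op.one p n - Op.homotopyBd K n : Op R p p n n) σ).support,
        Set.range t.1 ⊆ T ∨ Set.range t.1 ⊆ E

variable (A : LocalSystem R B)

theorem chain_mem_sup {L : Op R p p' n n} {S : Set Z} {T E : Set Z'}
    (hL : ∀ σ : C(Simplex n, Z), Set.range σ ⊆ S → ∀ t ∈ (L σ).support,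
      Set.range t.1 ⊆ T ∨ Set.range t.1 ⊆ E) {c : Chain (A.pullback p) n}
    (hc : c ∈ chainsIn (A.pullback p) S n) :
    L.chain A c ∈ chainsIn (A.pullback p') T n ⊔ chainsIn (A.pullback p') E n := by
  classical
  refine Op.chain_induction (P := fun c => L.chain A c ∈
    chainsIn (A.pullback p') T n ⊔ chainsIn (A.pullback p') E n) (T := S) ?_ ?_ ?_ hc
  · simp
  · intro c c' h1 h2
    rw [map_add]
    exact Submodule.add_mem _ h1 h2
  · intro σ x hσ
    rw [Op.chain_single, ← Finsupp.sum_single (L σ), Finsupp.sum, map_sum]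
    refine Submodule.sum_mem _ fun t ht => ?_
    have hs : ∀ {T : Set Z'}, Set.range t.1 ⊆ T →
        Op.chainEval A p' n x (Finsupp.single t (L σ t)) ∈ chainsIn (A.pullback p') T n :=
      fun h => Op.chainEval_mem_chainsIn A x fun u hu => by
        rw [Finset.mem_singleton.1 (Finsupp.support_single_subset hu)]
        exact h
    rcases hL σ hσ t ht with h | h
    exacts [Submodule.mem_sup_left (hs h), Submodule.mem_sup_right (hs h)]

theorem cochain_mem_relCochains {L : Op R p p' n n} {S : Set Z} {T E : Set Z'}
    (hL : ∀ σ : C(Simplex n, Z), Set.range σ ⊆ S → ∀ t ∈ (L σ).support,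
      Set.range t.1 ⊆ T ∨ Set.range t.1 ⊆ E) {φ : Cochain (A.pullback p') n}
    (hT : φ ∈ relCochains (A.pullback p') T n) (hE : φ ∈ relCochains (A.pullback p') E n) :
    L.cochain A φ ∈ relCochains (A.pullback p) S n :=
  fun σ hσ => Op.cochainEval_eq_zero A fun t ht => (hL σ hσ t ht).elim (hT _) (hE _)

theorem coboundary_mem_relCochains {T : Set Z} {φ : Cochain (A.pullback p) n}
    (h : φ ∈ relCochains (A.pullback p) T n) :
    coboundary (A.pullback p) n φ ∈ relCochains (A.pullback p) T (n + 1) := by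
  rw [← Op.cochain_bd]
  exact (Op.carries_bd T).cochain_mem A h

theorem boundary_mem_chainsIn {T : Set Z} {c : Chain (A.pullback p) (n + 1)}
    (h : c ∈ chainsIn (A.pullback p) T (n + 1)) :
    boundary (A.pullback p) n c ∈ chainsIn (A.pullback p) T n := by
  rw [← Op.chain_bd]
  exact (Op.carries_bd T).chain_mem A h

namespace IsExcisive

variable {e : C(Z, Z')} {he : ∀ z, p' (e z) = p z} {S T : Set Z'}

/-- After the deformation `c` is a chain of `T` plus a chain of `E`. The second summand comes from
the source of `e` and represents the class of `c`, the first being zero modulo `T`. -/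
theorem exists_cycle (h : IsExcisive R p' S T (Set.range e)) (hemb : Topology.IsEmbedding e)
    {c : Chain (A.pullback p') n} (hc : c ∈ pairCycles (A.pullback p') S T n) :
    ∃ x ∈ cycles (A.pullback p) (e ⁻¹' T) n,
      c - (Op.push e he n).chain A x ∈ pairBoundaries (A.pullback p') S T n := by
  obtain ⟨K, hKS, hKT, hKE, hsm⟩ := h
  have hF := chain_mem_sup A (hsm n) hc.1
  obtain ⟨t, ht, y, hy, hty⟩ := Submodule.mem_sup.1 hF
  obtain ⟨x, rfl⟩ := Op.exists_chain_push_eq A he hemb hy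
  have hsub : c = (Op.one p' n - Op.homotopyBd K n).chain A c + (Op.homotopyBd K n).chain A c := by
    rw [Op.chain_sub, LinearMap.sub_apply, Op.chain_one, sub_add_cancel]
  refine ⟨x, ?_, ?_⟩
  · cases n with
    | zero => exact Submodule.mem_top
    | succ n =>
      refine Op.mem_chainsIn_of_push A he hemb.injective ?_
      rw [← Op.boundary_chain_push, ← add_sub_cancel_left t ((Op.push e he (n + 1)).chain A x), hty,
        map_sub]
      refine Submodule.sub_mem _ ?_ (boundary_mem_chainsIn A ht)
      rw [Op.chain_sub, LinearMap.sub_apply, map_sub, Op.chain_one]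
      refine Submodule.sub_mem _ hc.2 ?_
      rw [← Op.chain_bd, ← Op.chain_comp, Op.bd_comp_homotopyBd, Op.chain_comp, Op.chain_bd]
      exact (Op.Carries.homotopyBd hKT n).chain_mem A hc.2
  · have h1 : c - (Op.push e he n).chain A x = t + (Op.homotopyBd K n).chain A c := by
      rw [sub_eq_iff_eq_add, add_right_comm, hty]
      exact hsub
    rw [h1]
    exact Submodule.add_mem _ (Submodule.mem_sup_right ht)
      (Op.homotopyBd_chain_mem A hKS hKT hc)

/-- Let `F = 1 - (∂K + K∂)`. If `e x = ∂d + t`, then `F (e x) = ∂(F d) + F t`, where `F d` splits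
into a part in `T` and a part in `E`. The error `e x - F (e x)` is, modulo `T`, a boundary inside
`E`, because `K` preserves `E` and `T`. All that is not in `T` can thus be pulled back along `e`. -/
theorem mem_boundaries (h : IsExcisive R p' S T (Set.range e)) (hemb : Topology.IsEmbedding e)
    {x : Chain (A.pullback p) n} (hx : x ∈ cycles (A.pullback p) (e ⁻¹' T) n)
    (hb : (Op.push e he n).chain A x ∈ pairBoundaries (A.pullback p') S T n) :
    x ∈ boundaries (A.pullback p) (e ⁻¹' T) n := by
  obtain ⟨K, hKS, hKT, hKE, hsm⟩ := h
  have hmaps : Set.MapsTo e Set.univ (Set.range e) := fun z _ => ⟨z, rfl⟩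
  have hE : ∀ {k : ℕ} (x : Chain (A.pullback p) k), (Op.push e he k).chain A x ∈
      chainsIn (A.pullback p') (Set.range e) k := fun x =>
    (Op.carries_push hmaps).chain_mem A fun _ h => (h (Set.subset_univ _)).elim
  have hinter : Set.MapsTo e (e ⁻¹' T) (Set.range e ∩ T) := fun z hz => ⟨⟨z, rfl⟩, hz⟩
  -- The homotopy is used for the pair `(E, E ∩ T)`, so the bounding chain lies in `E` and comes
  -- from the source of `e`.
  have hhb := Op.homotopyBd_chain_mem A hKE (fun n => (hKE n).inter (hKT n))
    (n := n) (c := (Op.push e he n).chain A x) ⟨hE x, Op.push_mem_cycles A he hinter hx⟩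
  obtain ⟨_, ⟨u', hu', rfl⟩, w, hw, huw⟩ := Submodule.mem_sup.1 hhb
  obtain ⟨u, rfl⟩ := Op.exists_chain_push_eq A he hemb hu'
  obtain ⟨_, ⟨d, hd, rfl⟩, t, ht, hdt⟩ := Submodule.mem_sup.1 hb
  obtain ⟨d₁, hd₁, y, hy, hdy⟩ := Submodule.mem_sup.1 (chain_mem_sup A (hsm (n + 1)) hd)
  obtain ⟨d₂, rfl⟩ := Op.exists_chain_push_eq A he hemb hy
  have hcomm : (Op.one p' n - Op.homotopyBd K n).chain A (boundary (A.pullback p') n d) =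
      boundary (A.pullback p') n ((Op.one p' (n + 1) - Op.homotopyBd K (n + 1)).chain A d) := by
    rw [← Op.chain_bd, ← Op.chain_comp, ← Op.chain_comp, Op.comp_sub, Op.bd_comp_homotopyBd,
      Op.sub_comp, Op.one_comp, Op.comp_one]
  have key : (Op.push e he n).chain A x = boundary (A.pullback p') n d₁ +
      (Op.push e he n).chain A (boundary (A.pullback p) n d₂) +
      (Op.one p' n - Op.homotopyBd K n).chain A t +
      ((Op.push e he n).chain A (boundary (A.pullback p) n u) + w) := by
    rw [← Op.boundary_chain_push, ← Op.boundary_chain_push, ← map_add, hdy, ← hcomm, ← map_add,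
      hdt, huw, Op.chain_sub, LinearMap.sub_apply, Op.chain_one, sub_add_cancel]
  have hmem : x - boundary (A.pullback p) n d₂ - boundary (A.pullback p) n u ∈
      chainsIn (A.pullback p) (e ⁻¹' T) n := by
    refine Op.mem_chainsIn_of_push A he hemb.injective ?_
    rw [map_sub, map_sub, key]
    have h1 : ∀ a b c d f : Chain (A.pullback p') n,
        a + b + c + (d + f) - b - d = a + c + f := fun _ _ _ _ _ => by abel
    rw [h1]
    exact Submodule.add_mem _ (Submodule.add_mem _ (boundary_mem_chainsIn A hd₁)
      (((Op.carries_one T).sub (Op.Carries.homotopyBd hKT n)).chain_mem A ht))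
      (chainsIn_mono _ Set.inter_subset_right n hw)
  refine Submodule.mem_sup.2 ⟨boundary (A.pullback p) n (d₂ + u), ⟨_, rfl⟩, _, hmem, ?_⟩
  rw [map_add]
  abel

theorem exists_extension (hemb : Topology.IsEmbedding e) {y : Cochain (A.pullback p) n}
    (hy : y ∈ relCochains (A.pullback p) (e ⁻¹' T) n) :
    ∃ φ ∈ relCochains (A.pullback p') T n, (Op.push e he n).cochain A φ = y := by
  obtain ⟨φ, rfl, hφ⟩ := Op.exists_cochain_push_eq (p' := p') A he hemb.injective y
  refine ⟨φ, fun τ hτ => ?_, rfl⟩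
  by_cases hex : ∃ σ, e.comp σ = τ
  · obtain ⟨σ, rfl⟩ := hex
    have := hy σ (by
      rintro _ ⟨x, rfl⟩
      exact hτ ⟨x, rfl⟩)
    rw [Op.cochain_push_apply] at this
    exact Op.map_hom_injective A _ (this.trans (map_zero _).symm)
  · exact hφ τ hex

/-- Let `φ` be an extension of `y` that vanishes on `T`. Its coboundary vanishes on the simplices of
`T` and of `E`, but perhaps not on all of `S`. Composing with `1 - (∂K + K∂)`, which turns simplices
of `S` into sums of simplices of `T` and `E`, repairs this and changes the restriction to `E` by a
coboundary. -/
theorem exists_pairCocycle (h : IsExcisive R p' S T (Set.range e)) (hemb : Topology.IsEmbedding e)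
    {y : Cochain (A.pullback p) n} (hy : y ∈ cocycles (A.pullback p) (e ⁻¹' T) n) :
    ∃ φ ∈ pairCocycles (A.pullback p') S T n,
      y - (Op.push e he n).cochain A φ ∈ coboundaries (A.pullback p) (e ⁻¹' T) n := by
  obtain ⟨K, hKS, hKT, hKE, hsm⟩ := h
  obtain ⟨φ, hφ, rfl⟩ := exists_extension (he := he) A hemb hy.1
  have hδ : coboundary (A.pullback p') n φ ∈ relCochains (A.pullback p') (Set.range e) (n + 1) := by
    refine Op.mem_relCochains_of_push A he hemb subset_rfl ?_
    rw [← Op.coboundary_cochain_push, ((mem_cocycles _).1 hy).2]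
    exact Submodule.zero_mem _
  refine ⟨(Op.one p' n - Op.homotopyBd K n).cochain A φ, (mem_pairCocycles _).2
    ⟨((Op.carries_one T).sub (Op.Carries.homotopyBd hKT n)).cochain_mem A hφ, ?_⟩, ?_⟩
  · have hcomm : coboundary (A.pullback p') n ((Op.one p' n - Op.homotopyBd K n).cochain A φ) =
        (Op.one p' (n + 1) - Op.homotopyBd K (n + 1)).cochain A
          (coboundary (A.pullback p') n φ) := by
      rw [← Op.cochain_bd, ← Op.cochain_comp, ← Op.cochain_comp, Op.comp_sub,
        Op.bd_comp_homotopyBd, Op.sub_comp, Op.one_comp, Op.comp_one]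
    rw [hcomm]
    exact cochain_mem_relCochains A (hsm (n + 1)) (coboundary_mem_relCochains A hφ) hδ
  · rw [← map_sub, Op.cochain_sub, LinearMap.sub_apply, Op.cochain_one, sub_sub_cancel]
    obtain ⟨a, ha, b, hb, hab⟩ := Submodule.mem_sup.1
      (Op.homotopyBd_cochain_mem A hKE hKT ((mem_pairCocycles _).2 ⟨hφ, hδ⟩))
    have hmaps : Set.MapsTo e Set.univ (Set.range e) := fun z _ => ⟨z, rfl⟩
    rw [← hab, map_add, mem_relCochains_univ _ ((Op.carries_push hmaps).cochain_mem A hb),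
      add_zero]
    exact Op.push_mem_coboundaries A he (Set.mapsTo_preimage e T) ha

/-- If `φ` restricts to `δψ`, extend `ψ` to a cochain that vanishes on `T`. Then `φ - δψ` vanishes
on `T` and on `E`, so `1 - (∂K + K∂)` makes it vanish on `S`. In degree `0` the restriction is zero
and no `ψ` is needed. -/
theorem mem_pairCoboundaries (h : IsExcisive R p' S T (Set.range e))
    (hemb : Topology.IsEmbedding e) {φ : Cochain (A.pullback p') n}
    (hφ : φ ∈ pairCocycles (A.pullback p') S T n)
    (hb : (Op.push e he n).cochain A φ ∈ coboundaries (A.pullback p) (e ⁻¹' T) n) :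
    φ ∈ pairCoboundaries (A.pullback p') S T n := by
  obtain ⟨K, hKS, hKT, hKE, hsm⟩ := h
  have hrange : ∀ {k : ℕ} {ψ : Cochain (A.pullback p') k}, (Op.push e he k).cochain A ψ = 0 →
      ψ ∈ relCochains (A.pullback p') (Set.range e) k := fun h0 =>
    Op.mem_relCochains_of_push A he hemb subset_rfl (h0 ▸ Submodule.zero_mem _)
  have hsub : φ = (Op.one p' n - Op.homotopyBd K n).cochain A φ +
      (Op.homotopyBd K n).cochain A φ := by
    rw [Op.cochain_sub, LinearMap.sub_apply, Op.cochain_one, sub_add_cancel]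
  rw [hsub]
  refine Submodule.add_mem _ ?_ (Op.homotopyBd_cochain_mem A hKS hKT hφ)
  cases n with
  | zero =>
    exact Submodule.mem_sup_right (cochain_mem_relCochains A (hsm 0) hφ.1 (hrange hb))
  | succ n =>
    obtain ⟨ψ, hψ, hψφ⟩ := hb
    obtain ⟨ψ', hψ', rfl⟩ := exists_extension (he := he) A hemb hψ
    have h1 : φ - coboundary (A.pullback p') n ψ' ∈ relCochains (A.pullback p') T (n + 1) :=
      Submodule.sub_mem _ hφ.1 (coboundary_mem_relCochains A hψ')
    have h2 : φ - coboundary (A.pullback p') n ψ' ∈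
        relCochains (A.pullback p') (Set.range e) (n + 1) := hrange (by
      rw [map_sub, ← hψφ, Op.coboundary_cochain_push, sub_self])
    rw [← sub_add_cancel φ (coboundary (A.pullback p') n ψ'), map_add]
    refine Submodule.add_mem _
      (Submodule.mem_sup_right (cochain_mem_relCochains A (hsm (n + 1)) h1 h2))
      (Submodule.mem_sup_left ⟨(Op.one p' n - Op.homotopyBd K n).cochain A ψ',
        ((Op.carries_one T).sub (Op.Carries.homotopyBd hKT n)).cochain_mem A hψ', ?_⟩)
    rw [← Op.cochain_bd, ← Op.cochain_comp, ← Op.cochain_comp, Op.comp_sub,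
      Op.bd_comp_homotopyBd, Op.sub_comp, Op.one_comp, Op.comp_one]

end IsExcisive

/-! ### Naturality of the cap product -/

/-- Front and back faces of `e ∘ σ` are the images of those of `σ`, and the path between their
initial vertices has the same image in `B`. -/
theorem push_cap {e : C(Z, Z')} (he : ∀ z, p' (e z) = p z) {k q : ℕ} (h : k + q = n)
    (φ : Cochain (A.pullback p') k) (c : Chain (constSystem R Z) n) :
    (Op.push e he q).chain A (cap (A.pullback p) h ((Op.push e he k).cochain A φ) c) =
      cap (A.pullback p') h φ ((Op.push e he n).chain (constSystem R B) c) := by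
  classical
  suffices H : (Op.push e he q).chain A ∘ₗ cap (A.pullback p) h ((Op.push e he k).cochain A φ) =
      cap (A.pullback p') h φ ∘ₗ (Op.push e he n).chain (constSystem R B) from
    LinearMap.congr_fun H c
  refine DFinsupp.lhom_ext' fun σ => LinearMap.ext_ring ?_
  change (Op.push e he q).chain A (cap (A.pullback p) h ((Op.push e he k).cochain A φ)
      (simplexChain R σ)) = cap (A.pullback p') h φ ((Op.push e he n).chain (constSystem R B)
        (simplexChain R σ))
  have h1 : (Op.push e he n).chain (constSystem R B) (simplexChain R σ) =
      simplexChain R (e.comp σ) := Op.chain_push_single (constSystem R B) e he σ (1 : R)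
  rw [h1, cap_simplex, cap_simplex, capTerm, capTerm, Op.chain_push_single]
  refine congrArg (DFinsupp.single (β := fun τ : C(Simplex q, Z') =>
    (A.pullback p').obj ⟨τ (v₀ q)⟩) ((e.comp σ).comp (back h))) ?_
  rw [Op.cochain_push_apply]
  have h2 : Groupoid.inv (Op.overHom (he (σ (front h (v₀ k))))) ≫ (FundamentalGroupoid.map p).map
      (edge σ (front h (v₀ k)) (back h (v₀ q))) ≫ Op.overHom (he (σ (back h (v₀ q)))) =
      (FundamentalGroupoid.map p').map (edge (e.comp σ) (front h (v₀ k)) (back h (v₀ q))) := by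
    rw [Groupoid.inv_eq_inv, IsIso.inv_comp_eq]
    exact (Op.overHom_comp_edge he σ _ _).symm
  have h3 := congrArg (fun g => (A.map g).hom (φ ((e.comp σ).comp (front h)))) h2
  simp only [A.map_comp, ModuleCat.hom_comp, LinearMap.comp_apply] at h3
  exact h3

end Excision

/-! ### Mapping cylinders and the suspension over the base -/

section Cylinders

open unitInterval

variable {X Y W : Type*} [TopologicalSpace X] [TopologicalSpace Y] [TopologicalSpace W]

namespace MappingCylinder

variable {f : C(X, Y)}

/-- The inclusion of the target in the mapping cylinder. -/
def base (f : C(X, Y)) : C(Y, MappingCylinder f) where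
  toFun y := Quot.mk _ (Sum.inr y)
  continuous_toFun := continuous_quot_mk.comp (by fun_prop)

/-- The canonical map of the cylinder on the source to the mapping cylinder. -/
def cyl (f : C(X, Y)) : C(X × I, MappingCylinder f) where
  toFun a := Quot.mk _ (Sum.inl a)
  continuous_toFun := continuous_quot_mk.comp (by fun_prop)

theorem cyl_zero (x : X) : cyl f (x, 0) = base f (f x) := Quot.sound (.glue x)

theorem cyl_one (x : X) : cyl f (x, 1) = top f x := rfl

theorem forall_iff {P : MappingCylinder f → Prop} :
    (∀ z, P z) ↔ (∀ x s, P (cyl f (x, s))) ∧ ∀ y, P (base f y) :=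
  ⟨fun h => ⟨fun _ _ => h _, fun _ => h _⟩, fun h => by
    rintro ⟨⟨x, s⟩ | y⟩
    exacts [h.1 x s, h.2 y]⟩

/-- A map out of the mapping cylinder. -/
def desc (g : C(X × I, W)) (k : C(Y, W)) (h : ∀ x, g (x, 0) = k (f x)) :
    C(MappingCylinder f, W) where
  toFun := Quot.lift (Sum.elim g k) (by rintro _ _ ⟨x⟩; exact h x)
  continuous_toFun := continuous_quot_lift _ (by fun_prop)

/-- A homotopy of maps out of the mapping cylinder. -/
def descHomotopy (g : C((X × I) × I, W)) (k : C(Y × I, W))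
    (h : ∀ x t, g ((x, 0), t) = k (f x, t)) : C(MappingCylinder f × I, W) :=
  -- Currying reduces this to a map out of the quotient itself, so it is not necessary to know that
  -- the product of the quotient map with the interval is a quotient map.
  (desc g.curry k.curry fun x => ContinuousMap.ext (h x)).uncurry

/-- The height function on the mapping cylinder: `1` on the top, `0` on the base. -/
def height (f : C(X, Y)) : C(MappingCylinder f, ℝ) :=
  desc ⟨fun a => (a.2 : ℝ), by fun_prop⟩ 0 fun _ => rfl

theorem height_base (y : Y) : height f (base f y) = 0 := rfl

theorem height_top (x : X) : height f (top f x) = 1 := rfl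

theorem mem_range_top_of_height {z : MappingCylinder f} (h : height f z = 1) :
    z ∈ Set.range (top f) := by
  revert z
  change ∀ z : MappingCylinder f, height f z = 1 → z ∈ Set.range (top f)
  refine forall_iff.2 ⟨fun x s h => ⟨x, ?_⟩, fun y h => (zero_ne_one h).elim⟩
  rw [← cyl_one, show s = 1 from Subtype.ext h]

theorem isClosedEmbedding_top (f : C(X, Y)) : Topology.IsClosedEmbedding (top f) := by
  have hinj : ∀ a b, Quot.mk (Rel f) a = Quot.mk (Rel f) b → ∀ x, b = Sum.inl (x, 1) →
      a = b := by
    intro a b h x hb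
    -- This function, not required to be continuous, remembers the points at height `1` and
    -- collapses everything else. It respects the gluing because that only involves height `0`.
    let u : MappingCylinder f → X ⊕ Unit := Quot.lift
      (Sum.elim (fun a => open Classical in if a.2 = 1 then Sum.inl a.1 else Sum.inr ())
        fun _ => Sum.inr ())
      (by rintro _ _ ⟨x⟩; simp)
    have h1 : u (Quot.mk _ a) = u (Quot.mk _ b) := congrArg u h
    subst hb
    rcases a with ⟨x', s⟩ | y
    · by_cases hs : s = 1
      · subst hs
        simp only [u, Sum.elim_inl, if_true, Sum.inl.injEq] at h1
        rw [h1]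
      · simp [u, hs] at h1
    · simp [u] at h1
  refine .of_continuous_injective_isClosedMap (top f).continuous ?_ ?_
  · intro x x' h
    have := hinj _ _ h x' rfl
    simpa using this
  · intro C hC
    have hq : Topology.IsQuotientMap (Quot.mk (Rel f)) := isQuotientMap_quot_mk
    refine (hq.isClosed_preimage (s := top f '' C)).1 ?_
    have : Quot.mk (Rel f) ⁻¹' (top f '' C) = Sum.inl '' (C ×ˢ {1}) := by
      ext a
      constructor
      · rintro ⟨x, hx, h⟩
        exact ⟨(x, 1), ⟨hx, rfl⟩, (hinj _ _ h.symm x rfl).symm⟩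
      · rintro ⟨⟨x, s⟩, ⟨hx, rfl⟩, rfl⟩
        exact ⟨x, hx, rfl⟩
    rw [this]
    exact Topology.IsClosedEmbedding.inl.isClosedMap _ (hC.prod isClosed_singleton)

/-- The deformation of the mapping cylinder onto its base. -/
def contraction (f : C(X, Y)) : C(MappingCylinder f × I, MappingCylinder f) :=
  descHomotopy ⟨fun a => cyl f (a.1.1, a.1.2 * σ a.2), by fun_prop⟩
    ⟨fun a => base f a.1, by fun_prop⟩ fun x t => by
      simp only [ContinuousMap.coe_mk, zero_mul, cyl_zero]

theorem contraction_zero (z : MappingCylinder f) : contraction f (z, 0) = z := by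
  revert z
  refine forall_iff.2 ⟨fun x s => ?_, fun y => rfl⟩
  change cyl f (x, s * σ 0) = _
  simp

theorem contraction_one (z : MappingCylinder f) : contraction f (z, 1) = base f (proj f z) := by
  revert z
  refine forall_iff.2 ⟨fun x s => ?_, fun y => rfl⟩
  change cyl f (x, s * σ 1) = base f (f x)
  simp [cyl_zero]

theorem proj_contraction (z : MappingCylinder f) (t : I) :
    proj f (contraction f (z, t)) = proj f z := by
  revert z
  exact forall_iff.2 ⟨fun x s => rfl, fun y => rfl⟩

/-- A homotopy of the source over the target extends to the mapping cylinder. -/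
def mapHomotopy (Φ : C(X × I, X)) (hΦ : ∀ x t, f (Φ (x, t)) = f x) :
    C(MappingCylinder f × I, MappingCylinder f) :=
  descHomotopy ⟨fun a => cyl f (Φ (a.1.1, a.2), a.1.2), by fun_prop⟩
    ⟨fun a => base f a.1, by fun_prop⟩ fun x t => by
      simp only [ContinuousMap.coe_mk, cyl_zero, hΦ]

section mapHomotopy

variable (Φ : C(X × I, X)) (hΦ : ∀ x t, f (Φ (x, t)) = f x)

theorem mapHomotopy_zero (h : ∀ x, Φ (x, 0) = x) (z : MappingCylinder f) :
    mapHomotopy Φ hΦ (z, 0) = z := by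
  revert z
  refine forall_iff.2 ⟨fun x s => ?_, fun y => rfl⟩
  change cyl f (Φ (x, 0), s) = _
  rw [h]

theorem proj_mapHomotopy (z : MappingCylinder f) (t : I) :
    proj f (mapHomotopy Φ hΦ (z, t)) = proj f z := by
  revert z
  exact forall_iff.2 ⟨fun x s => hΦ x t, fun y => rfl⟩

end mapHomotopy

/-- The homotopy of the unit interval, relative to the end points, that stretches `[0, 1/2]` to
`[0, 1]`. -/
def stretch : C(I × I, I) where
  toFun a := Set.projIcc 0 1 zero_le_one ((1 + a.2) * a.1 : ℝ)
  continuous_toFun := continuous_projIcc.comp (by fun_prop)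

theorem stretch_zero_left (t : I) : stretch (0, t) = 0 := by
  simp [stretch]

theorem stretch_one_left (t : I) : stretch (1, t) = 1 := by
  refine Set.projIcc_of_right_le zero_le_one ?_
  simpa using t.2.1

theorem stretch_zero_right (s : I) : stretch (s, 0) = s := by
  simp [stretch]

theorem stretch_one_right {s : I} (h : 1 / 2 < (s : ℝ)) : stretch (s, 1) = 1 := by
  refine Set.projIcc_of_right_le zero_le_one ?_
  simp only [Set.Icc.coe_one]
  linarith

/-- The deformation of the mapping cylinder that pushes a collar of its top into the top. -/
def collarPush (f : C(X, Y)) : C(MappingCylinder f × I, MappingCylinder f) :=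
  descHomotopy ⟨fun a => cyl f (a.1.1, stretch (a.1.2, a.2)), by fun_prop⟩
    ⟨fun a => base f a.1, by fun_prop⟩ fun x t => by
      simp only [ContinuousMap.coe_mk, stretch_zero_left, cyl_zero]

theorem collarPush_cyl (x : X) (s t : I) :
    collarPush f (cyl f (x, s), t) = cyl f (x, stretch (s, t)) := rfl

theorem collarPush_top (x : X) (t : I) : collarPush f (top f x, t) = top f x := by
  rw [← cyl_one, collarPush_cyl, stretch_one_left]

theorem collarPush_zero (z : MappingCylinder f) : collarPush f (z, 0) = z := by
  revert z
  refine forall_iff.2 ⟨fun x s => ?_, fun y => rfl⟩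
  rw [collarPush_cyl, stretch_zero_right]

theorem collarPush_one {z : MappingCylinder f} (h : 1 / 2 < height f z) :
    collarPush f (z, 1) ∈ Set.range (top f) := by
  revert z
  change ∀ z : MappingCylinder f, 1 / 2 < height f z → collarPush f (z, 1) ∈ Set.range (top f)
  refine forall_iff.2 ⟨fun x s h => ⟨x, ?_⟩, fun y h => ?_⟩
  · rw [collarPush_cyl, stretch_one_right h, cyl_one]
  · rw [height_base] at h
    norm_num at h

theorem proj_collarPush (z : MappingCylinder f) (t : I) :
    proj f (collarPush f (z, t)) = proj f z := by
  revert z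
  exact forall_iff.2 ⟨fun x s => rfl, fun y => rfl⟩

end MappingCylinder

namespace Double

variable {i : C(X, Y)}

/-- The inclusions of the two copies in the double. -/
def incl (i : C(X, Y)) (j : Bool) : C(Y, Double i) where
  toFun y := Quot.mk _ (j.rec (Sum.inl y) (Sum.inr y))
  continuous_toFun := continuous_quot_mk.comp (by cases j <;> fun_prop)

theorem incl_apply (x : X) (j j' : Bool) : incl i j (i x) = incl i j' (i x) := by
  have h : incl i false (i x) = incl i true (i x) := Quot.sound (.glue x)
  cases j <;> cases j' <;> simp [h]

theorem forall_iff {P : Double i → Prop} : (∀ z, P z) ↔ ∀ j y, P (incl i j y) :=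
  ⟨fun h _ _ => h _, fun h => by
    rintro ⟨y | y⟩
    exacts [h false y, h true y]⟩

/-- A map out of the double. -/
def desc (g : Bool → C(Y, W)) (h : ∀ x, g false (i x) = g true (i x)) : C(Double i, W) where
  toFun := Quot.lift (Sum.elim (g false) (g true)) (by rintro _ _ ⟨x⟩; exact h x)
  continuous_toFun := continuous_quot_lift _ (by fun_prop)

theorem desc_incl (g : Bool → C(Y, W)) (h : ∀ x, g false (i x) = g true (i x)) (j : Bool) (y : Y) :
    desc g h (incl i j y) = g j y := by
  cases j <;> rfl

/-- The folding map. -/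
def fold (i : C(X, Y)) : C(Double i, Y) := desc (fun _ => ContinuousMap.id Y) fun _ => rfl

theorem fold_incl (j : Bool) (y : Y) : fold i (incl i j y) = y := desc_incl _ _ j y

theorem isEmbedding_incl (j : Bool) : Topology.IsEmbedding (incl i j) :=
  Function.LeftInverse.isEmbedding (fold_incl j) (fold i).continuous (incl i j).continuous

/-- A homotopy relative to the image of `i` extends to the double. -/
def mapHomotopy (Φ : C(Y × I, Y)) (hΦ : ∀ x t, Φ (i x, t) = i x) : C(Double i × I, Double i) :=
  (desc (fun j => ((incl i j).comp Φ).curry) fun x => ContinuousMap.ext fun t => by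
    simp [hΦ, incl_apply x false true]).uncurry

theorem mapHomotopy_incl (Φ : C(Y × I, Y)) (hΦ : ∀ x t, Φ (i x, t) = i x) (j : Bool) (y : Y)
    (t : I) : mapHomotopy Φ hΦ (incl i j y, t) = incl i j (Φ (y, t)) := by
  cases j <;> rfl

end Double

end Cylinders

/-! ### From an open cover and a deformation to an excisive couple -/

section Deformation

variable {R : Type*} [CommRing R] {B Z : Type*} [TopologicalSpace B] [TopologicalSpace Z]
  {p : C(Z, B)}

/-- A deformation that moves the parts of `S` in two open sets that cover the space into `T` and
into `E`, respectively, shows that `T` and `E` form an excisive couple. -/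
theorem IsExcisive.of_deformation {S T E : Set Z} {U : Bool → Set Z} (hU : ∀ j, IsOpen (U j))
    (hcov : ⋃ j, U j = Set.univ) (Φ : C(Z × unitInterval, Z)) (hΦ : ∀ z t, p (Φ (z, t)) = p z)
    (h₀ : ∀ z, Φ (z, 0) = z) (hS : ∀ z ∈ S, ∀ t, Φ (z, t) ∈ S) (hT : ∀ z ∈ T, ∀ t, Φ (z, t) ∈ T)
    (hE : ∀ z ∈ E, ∀ t, Φ (z, t) ∈ E) (hUT : ∀ z ∈ S, z ∈ U false → Φ (z, 1) ∈ T)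
    (hUE : ∀ z ∈ S, z ∈ U true → Φ (z, 1) ∈ E) : IsExcisive R p S T E := by
  let g : C(Z, Z) := ⟨fun z => Φ (z, 1), by fun_prop⟩
  have hg : ∀ z, p (g z) = p z := fun z => hΦ z 1
  -- With `D` the subdivision homotopy and `P` the prism of the deformation, `∂P + P∂ = g - 1`. So
  -- `K = g D - P` gives `1 - (∂K + K∂) = g (1 - ∂D - D∂)`: first make simplices small, then move
  -- each piece by the end of the deformation.
  let K : ∀ n, Op R p p n (n + 1) := fun n =>
    (Op.push g hg (n + 1)).comp (Op.smallHomotopy p hU hcov n) - Op.prism Φ hΦ n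
  have hK : ∀ {T : Set Z}, (∀ z ∈ T, ∀ t, Φ (z, t) ∈ T) → ∀ n, (K n).Carries T T := fun {T} hT n =>
    (Op.Carries.comp (Op.carries_push fun z hz => hT z hz 1)
      (Op.carries_localOp _ T)).sub (Op.carries_prism Φ hΦ hT)
  refine ⟨K, hK hS, hK hT, hK hE, fun n σ hσ t ht => ?_⟩
  have h1 : Op.one p n - Op.homotopyBd K n =
      (Op.push g hg n).comp (Op.one p n - Op.homotopyBd (Op.smallHomotopy p hU hcov) n) := by
    rw [Op.homotopyBd_sub, Op.comp_sub, Op.comp_homotopyBd, Op.comp_one,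
      Op.homotopyBd_prism Φ hΦ (g₀ := ContinuousMap.id Z) (g₁ := g) h₀ (fun _ => rfl)
        (fun _ => rfl) hg, Op.push_id]
    abel
  rw [h1] at ht
  obtain ⟨u, hu, v, hv, rfl⟩ := Op.exists_of_mem_support_extend ht
  have huS : Set.range u.1 ⊆ S := ((Op.carries_one S).sub
    (Op.Carries.homotopyBd (fun n => Op.carries_localOp _ S) n)) σ hσ u hu
  obtain rfl := Finset.mem_singleton.1 (Finsupp.support_single_subset hv)
  obtain ⟨j, hj⟩ := Op.isSmall_of_mem_support hU hcov σ hu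
  cases j
  · left
    rintro _ ⟨x, rfl⟩
    exact hUT _ (huS ⟨x, rfl⟩) (hj ⟨x, rfl⟩)
  · right
    rintro _ ⟨x, rfl⟩
    exact hUE _ (huS ⟨x, rfl⟩) (hj ⟨x, rfl⟩)

end Deformation

/-! ### The two copies of the cylinder inside the cylinder of the suspension -/

section Suspension

open MappingCylinder

variable {X B : Type*} [TopologicalSpace X] [TopologicalSpace B] (f : C(X, B))

/-- The inclusions of the two mapping cylinders of `f` in the mapping cylinder of the
suspension. -/
def susIncl (j : Bool) : C(MappingCylinder f, MappingCylinder (suspensionMap f)) :=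
  (top (suspensionMap f)).comp (Double.incl (top f) j)

theorem suspensionMap_incl (j : Bool) (m : MappingCylinder f) :
    suspensionMap f (Double.incl (top f) j m) = proj f m := by
  cases j <;> rfl

theorem proj_susIncl (j : Bool) (m : MappingCylinder f) :
    proj (suspensionMap f) (susIncl f j m) = proj f m :=
  suspensionMap_incl f j m

theorem isEmbedding_susIncl (j : Bool) : Topology.IsEmbedding (susIncl f j) :=
  (isClosedEmbedding_top _).isEmbedding.comp (Double.isEmbedding_incl j)

theorem range_susIncl_subset (j : Bool) :
    Set.range (susIncl f j) ⊆ Set.range (top (suspensionMap f)) := by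
  rintro _ ⟨m, rfl⟩
  exact ⟨_, rfl⟩

/-- The signed height on the suspension; it vanishes on `X`, and it is `1` and `-1` on the two
copies of the base. -/
def signedHeight : C(Suspension f, ℝ) :=
  Double.desc (fun j => (j.rec 1 (-1) : ℝ) • (1 - height f)) fun x => by
    simp [height_top]

theorem signedHeight_incl_false (m : MappingCylinder f) :
    signedHeight f (Double.incl (top f) false m) = 1 - height f m := by
  simp [signedHeight, Double.desc_incl]

theorem signedHeight_incl_true (m : MappingCylinder f) :
    signedHeight f (Double.incl (top f) true m) = -(1 - height f m) := by
  simp [signedHeight, Double.desc_incl]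

/-- The signed height is nonnegative on one copy and nonpositive on the other where heights are at
most `1`; here one needs only that the fold identifies the two preimages of a common point, whose
height must therefore be `1`. -/
theorem preimage_range_susIncl : susIncl f true ⁻¹' Set.range (susIncl f false) =
    Set.range (top f) := by
  ext m
  constructor
  · rintro ⟨m', h⟩
    have h1 : Double.incl (top f) false m' = Double.incl (top f) true m :=
      (isClosedEmbedding_top _).injective h
    have h2 : m' = m := by
      have := congrArg (Double.fold (top f)) h1
      rwa [Double.fold_incl, Double.fold_incl] at this
    subst h2
    have h3 := congrArg (signedHeight f) h1
    rw [signedHeight_incl_false, signedHeight_incl_true] at h3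
    exact mem_range_top_of_height (by linarith)
  · rintro ⟨x, rfl⟩
    exact ⟨top f x, congrArg (top (suspensionMap f)) (Double.incl_apply x false true)⟩

/-- Both cylinders deform over `B` onto their bases. The base of `M_f` inside the suspension and the
base of the big cylinder are different copies of `B`; they are joined by the cylinder lines over the
former. -/
theorem isChainEquiv_susIncl (R : Type*) [CommRing R] (j : Bool) :
    IsChainEquiv R (proj_susIncl f j) := by
  refine ⟨(base f).comp (proj (suspensionMap f)), fun z => rfl,
    .of_homotopy (contraction f) proj_contraction _ _ contraction_zero fun z => ?_,
    .trans (g' := (base (suspensionMap f)).comp (proj (suspensionMap f))) (hg' := fun z => rfl)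
      (.of_homotopy ⟨fun a => cyl (suspensionMap f)
        (Double.incl (top f) j (base f (proj (suspensionMap f) a.1)), a.2), by fun_prop⟩
        (fun z t => ?_) _ _ (fun z => ?_) fun z => rfl)
      (.of_homotopy (contraction (suspensionMap f)) proj_contraction _ _
        contraction_zero contraction_one)⟩
  · rw [contraction_one]
    exact congrArg (base f) (proj_susIncl f j z).symm
  · exact suspensionMap_incl f j _
  · exact (cyl_zero _).trans (congrArg (base (suspensionMap f)) (suspensionMap_incl f j _))

/-- The two copies are not open, but each is a deformation of a neighbourhood in the suspension:
stretching a collar of `X` pushes the adjoining half of the other copy's cylinder coordinate into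
`X`. The stretching fixes `X`, lies over `B`, and extends to the big cylinder. -/
theorem isExcisive_susIncl (R : Type*) [CommRing R] :
    IsExcisive R (proj (suspensionMap f)) (Set.range (top (suspensionMap f)))
      (Set.range (susIncl f false)) (Set.range (susIncl f true)) := by
  -- Subdivision takes place in the big cylinder, so the open cover has to be defined there. The
  -- signed height, scaled by the cylinder coordinate, extends continuously by zero on the base.
  let H : C(MappingCylinder (suspensionMap f), ℝ) :=
    MappingCylinder.desc ⟨fun a => (a.2 : ℝ) * signedHeight f a.1, by fun_prop⟩ 0
      fun _ => zero_mul _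
  have hH : ∀ y, H (top _ y) = signedHeight f y := fun y => one_mul _
  let Ψ : C(Suspension f × unitInterval, Suspension f) :=
    Double.mapHomotopy (collarPush f) collarPush_top
  have hΨ : ∀ j m t, Ψ (Double.incl (top f) j m, t) =
      Double.incl (top f) j (collarPush f (m, t)) := Double.mapHomotopy_incl _ _
  have hΨB : ∀ y t, suspensionMap f (Ψ (y, t)) = suspensionMap f y := fun y t => by
    revert y
    refine Double.forall_iff.2 fun j m => ?_
    rw [hΨ, suspensionMap_incl, suspensionMap_incl, proj_collarPush]
  have hΨ0 : ∀ y, Ψ (y, 0) = y := Double.forall_iff.2 fun j m => by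
    rw [hΨ, collarPush_zero]
  have hpres : ∀ j, ∀ z ∈ Set.range (susIncl f j), ∀ t,
      MappingCylinder.mapHomotopy Ψ hΨB (z, t) ∈ Set.range (susIncl f j) := by
    rintro j _ ⟨m, rfl⟩ t
    exact ⟨collarPush f (m, t), congrArg (top (suspensionMap f)) (hΨ j m t).symm⟩
  have hpush : ∀ j j' m, 1 / 2 < height f m →
      MappingCylinder.mapHomotopy Ψ hΨB (susIncl f j m, 1) ∈ Set.range (susIncl f j') := by
    intro j j' m hm
    obtain ⟨x, hx⟩ := collarPush_one hm
    refine ⟨top f x, congrArg (top (suspensionMap f)) ?_⟩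
    rw [hΨ, ← hx]
    exact Double.incl_apply x j' j
  -- The first open set meets the suspension in the copy `false` and an open collar of `X` in the
  -- copy `true`; the second does the same with the copies exchanged. At time `1` the collars have
  -- been pushed into `X`.
  refine .of_deformation (U := fun j => H ⁻¹' (j.rec (Set.Ioi (-(1 / 2))) (Set.Iio (1 / 2))))
    (fun j => ?_) ?_ (MappingCylinder.mapHomotopy Ψ hΨB) (proj_mapHomotopy Ψ hΨB)
    (mapHomotopy_zero Ψ hΨB hΨ0) ?_ (hpres false) (hpres true) ?_ ?_
  · cases j
    exacts [isOpen_Ioi.preimage H.continuous, isOpen_Iio.preimage H.continuous]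
  · refine Set.eq_univ_of_forall fun z => Set.mem_iUnion.2 ?_
    rcases lt_or_ge (H z) (1 / 2) with h | h
    · exact ⟨true, h⟩
    · exact ⟨false, show -(1 / 2) < H z by linarith⟩
  · rintro _ ⟨y, rfl⟩ t
    exact ⟨_, rfl⟩
  · rintro _ ⟨y, rfl⟩
    revert y
    refine Double.forall_iff.2 fun j m hm => ?_
    cases j
    · exact hpres false _ ⟨m, rfl⟩ 1
    · have hm' : -(1 / 2) < H (top _ (Double.incl (top f) true m)) := hm
      rw [hH, signedHeight_incl_true] at hm'
      exact hpush _ _ m (by linarith)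
  · rintro _ ⟨y, rfl⟩
    revert y
    refine Double.forall_iff.2 fun j m hm => ?_
    cases j
    · have hm' : H (top _ (Double.incl (top f) false m)) < 1 / 2 := hm
      rw [hH, signedHeight_incl_false] at hm'
      exact hpush _ _ m (by linarith)
    · exact hpres true _ ⟨m, rfl⟩ 1

end Suspension

/-! ### Maps of subquotients -/

/-- The linear map `F` induces an isomorphism of the subquotients `U / V` and `U' / V'`. -/
structure IsSubquotientIso {R M M' : Type*} [CommRing R] [AddCommGroup M] [Module R M]
    [AddCommGroup M'] [Module R M'] (F : M →ₗ[R] M') (U V : Submodule R M)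
    (U' V' : Submodule R M') : Prop where
  map : ∀ x ∈ U, F x ∈ U'
  map_denom : ∀ x ∈ V, F x ∈ V'
  inj : ∀ x ∈ U, F x ∈ V' → x ∈ V
  surj : ∀ y ∈ U', ∃ x ∈ U, y - F x ∈ V'

theorem subsingleton_subquotient_iff {R M : Type*} [CommRing R] [AddCommGroup M] [Module R M]
    {U V : Submodule R M} : Subsingleton (U ⧸ V.submoduleOf U) ↔ U ≤ V := by
  rw [Submodule.Quotient.subsingleton_iff, Submodule.submoduleOf, Submodule.comap_subtype_eq_top]

namespace IsSubquotientIso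

variable {R M M' M'' N N' : Type*} [CommRing R] [AddCommGroup M] [Module R M]
  [AddCommGroup M'] [Module R M'] [AddCommGroup M''] [Module R M''] [AddCommGroup N] [Module R N]
  {F : M →ₗ[R] M'} {U V : Submodule R M} {U' V' : Submodule R M'} {U'' V'' : Submodule R M''}

theorem comp {G : M' →ₗ[R] M''} (hG : IsSubquotientIso G U' V' U'' V'')
    (hF : IsSubquotientIso F U V U' V') : IsSubquotientIso (G ∘ₗ F) U V U'' V'' where
  map x hx := hG.map _ (hF.map x hx)
  map_denom x hx := hG.map_denom _ (hF.map_denom x hx)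
  inj x hx h := hF.inj x hx (hG.inj _ (hF.map x hx) h)
  surj z hz := by
    obtain ⟨y, hy, hyz⟩ := hG.surj z hz
    obtain ⟨x, hx, hxy⟩ := hF.surj y hy
    refine ⟨x, hx, ?_⟩
    have := Submodule.add_mem _ hyz (hG.map_denom _ hxy)
    rwa [map_sub, sub_add_sub_cancel] at this

theorem smul (u : Rˣ) (hF : IsSubquotientIso F U V U' V') :
    IsSubquotientIso ((u : R) • F) U V U' V' where
  map x hx := Submodule.smul_mem _ _ (hF.map x hx)
  map_denom x hx := Submodule.smul_mem _ _ (hF.map_denom x hx)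
  inj x hx h := hF.inj x hx (by
    have := Submodule.smul_mem _ (↑u⁻¹ : R) h
    rwa [LinearMap.smul_apply, smul_smul, Units.inv_mul, one_smul] at this)
  surj y hy := by
    obtain ⟨x, hx, hxy⟩ := hF.surj y hy
    refine ⟨(↑u⁻¹ : R) • x, Submodule.smul_mem _ _ hx, ?_⟩
    rwa [LinearMap.smul_apply, map_smul, smul_smul, Units.mul_inv, one_smul]

/-- The fourth side of a square, commutative up to elements of the denominator, is an isomorphism
if the other three are. -/
theorem of_square {W Q : Submodule R N} {C : M' →ₗ[R] M''} {G : M'' →ₗ[R] N} {H : M →ₗ[R] N}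
    (hF : IsSubquotientIso F U V U' V') (hG : IsSubquotientIso G U'' V'' W Q)
    (hH : IsSubquotientIso H U V W Q) (hC : ∀ x ∈ U', C x ∈ U'') (hCV : ∀ x ∈ V', C x ∈ V'')
    (hcomm : ∀ x ∈ U, H x - G (C (F x)) ∈ Q) : IsSubquotientIso C U' V' U'' V'' where
  map := hC
  map_denom := hCV
  inj x hx h := by
    obtain ⟨w, hw, hwx⟩ := hF.surj x hx
    have h1 : C (F w) ∈ V'' := by
      have := Submodule.sub_mem _ h (hCV _ hwx)
      rwa [← map_sub, sub_sub_cancel] at this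
    have h2 : H w ∈ Q := by
      have := Submodule.add_mem _ (hcomm w hw) (hG.map_denom _ h1)
      rwa [sub_add_cancel] at this
    have := Submodule.add_mem _ hwx (hF.map_denom _ (hH.inj w hw h2))
    rwa [sub_add_cancel] at this
  surj y hy := by
    obtain ⟨w, hw, hwy⟩ := hH.surj (G y) (hG.map y hy)
    refine ⟨F w, hF.map w hw,
      hG.inj _ (Submodule.sub_mem _ hy (hC _ (hF.map w hw))) ?_⟩
    have := Submodule.add_mem _ hwy (hcomm w hw)
    rwa [sub_add_sub_cancel, ← map_sub] at this

/-- The isomorphism of subquotients. -/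
def toEquiv (h : IsSubquotientIso F U V U' V') :
    (U ⧸ V.submoduleOf U) ≃ₗ[R] U' ⧸ V'.submoduleOf U' :=
  LinearEquiv.ofBijective
    (Submodule.mapQ (V.submoduleOf U) (V'.submoduleOf U') (F.restrict h.map)
      fun x hx => h.map_denom x hx) (by
    constructor
    · rw [injective_iff_map_eq_zero]
      intro x hx
      obtain ⟨x, rfl⟩ := Submodule.Quotient.mk_surjective _ x
      exact (Submodule.Quotient.mk_eq_zero _).2
        (h.inj x x.2 ((Submodule.Quotient.mk_eq_zero (V'.submoduleOf U')).1 hx))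
    · intro y
      obtain ⟨y, rfl⟩ := Submodule.Quotient.mk_surjective _ y
      obtain ⟨x, hx, hxy⟩ := h.surj y y.2
      exact ⟨Submodule.Quotient.mk ⟨x, hx⟩,
        ((Submodule.Quotient.eq (V'.submoduleOf U') (x := y)).2 hxy).symm⟩)

theorem toEquiv_mk (h : IsSubquotientIso F U V U' V') {x : M} (hx : x ∈ U) :
    h.toEquiv (Submodule.Quotient.mk ⟨x, hx⟩) = Submodule.Quotient.mk ⟨F x, h.map x hx⟩ := rfl

theorem sub_mem_of_toEquiv_eq {F' : M'' →ₗ[R] M'} (h : IsSubquotientIso F U V U' V')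
    (h' : IsSubquotientIso F' U'' V'' U' V') {x : M} {hx : x ∈ U} {y : M''} {hy : y ∈ U''}
    (hxy : h.toEquiv (Submodule.Quotient.mk ⟨x, hx⟩) =
      h'.toEquiv (Submodule.Quotient.mk ⟨y, hy⟩)) : F x - F' y ∈ V' :=
  (Submodule.Quotient.eq (V'.submoduleOf U')).1 hxy

/-- This is how vanishing of a homology or cohomology group is carried along an isomorphism. -/
theorem le_iff (h : IsSubquotientIso F U V U' V') : U ≤ V ↔ U' ≤ V' := by
  rw [← subsingleton_subquotient_iff, ← subsingleton_subquotient_iff]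
  exact h.toEquiv.toEquiv.subsingleton_congr

end IsSubquotientIso

/-! ### Cap product isomorphisms in terms of representatives -/

section CapBijective

variable {R : Type*} [CommRing R] {Z : Type*} [TopologicalSpace Z] (A : LocalSystem R Z)

theorem homologyCap_mk {S S' T : Set Z} (hS : S' ⊆ S ∨ S' ⊆ T) {p q n : ℕ}
    (h : p + q = n) {c : Chain (constSystem R Z) n} (hc : c ∈ cycles (constSystem R Z) S' n)
    {φ : Cochain A p} (hφ : φ ∈ cocycles A S p) :
    homologyCap A hS h (Submodule.Quotient.mk ⟨c, hc⟩) (Submodule.Quotient.mk ⟨φ, hφ⟩) =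
      Submodule.Quotient.mk ⟨cap A h φ c, cap_mem_cycles A hS h hφ hc⟩ := rfl

/-- Fixing a representing cycle `c` turns duality into a property of one linear map from cochains to
chains. In this form it can be compared with other chain-level maps up to denominators. -/
theorem bijective_homologyCap_iff {S S' T : Set Z} (hS : S' ⊆ S ∨ S' ⊆ T) {p q n : ℕ}
    (h : p + q = n) {c : Chain (constSystem R Z) n} (hc : c ∈ cycles (constSystem R Z) S' n) :
    Function.Bijective (homologyCap A hS h (Submodule.Quotient.mk ⟨c, hc⟩)) ↔
      IsSubquotientIso ((cap A h).flip c) (cocycles A S p) (coboundaries A S p)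
        (cycles A T q) (boundaries A T q) := by
  constructor
  · intro hb
    refine ⟨fun φ hφ => cap_mem_cycles A hS h hφ hc,
      fun φ hφ => cap_mem_boundaries_left A hS h hφ hc, fun φ hφ hb0 => ?_, fun y hy => ?_⟩
    · refine (Submodule.Quotient.mk_eq_zero _ (x := ⟨φ, hφ⟩)).1
        (hb.1 (Eq.trans ?_ (map_zero _).symm))
      rw [homologyCap_mk]
      exact (Submodule.Quotient.mk_eq_zero _).2 hb0
    · obtain ⟨φ, hφ⟩ := hb.2 (Submodule.Quotient.mk ⟨y, hy⟩)
      obtain ⟨⟨φ, hφ'⟩, rfl⟩ := Submodule.Quotient.mk_surjective _ φ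
      rw [homologyCap_mk] at hφ
      exact ⟨φ, hφ', (Submodule.Quotient.eq
        ((boundaries A T q).submoduleOf (cycles A T q))).1 hφ.symm⟩
  · intro hiso
    convert hiso.toEquiv.bijective using 1
    funext φ
    obtain ⟨⟨φ, hφ⟩, rfl⟩ := Submodule.Quotient.mk_surjective _ φ
    exact (homologyCap_mk A hS h hc hφ).trans (hiso.toEquiv_mk hφ).symm

end CapBijective

/-! ### The exact sequence of the triple and the Leibniz rule -/

section Triple

variable {R : Type*} [CommRing R] {B Z Z' : Type*} [TopologicalSpace B]
  [TopologicalSpace Z] [TopologicalSpace Z'] {p : C(Z, B)} {p' : C(Z', B)} (A : LocalSystem R B)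

/-- This is the connecting map of the triple `(Z, S, T)`; its kernel and cokernel come from the
groups of `(Z, T)`, which vanish by `hT`. -/
theorem isSubquotientIso_boundary {S T : Set Z} (hTS : T ⊆ S)
    (hT : ∀ n, cycles (A.pullback p) T n ≤ boundaries (A.pullback p) T n) (n : ℕ) :
    IsSubquotientIso (boundary (A.pullback p) n) (cycles (A.pullback p) S (n + 1))
      (boundaries (A.pullback p) S (n + 1)) (pairCycles (A.pullback p) S T n)
      (pairBoundaries (A.pullback p) S T n) where
  map c hc := by
    refine ⟨hc, show _ ∈ cycles (A.pullback p) T n from ?_⟩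
    cases n with
    | zero => exact Submodule.mem_top
    | succ n =>
      rw [mem_cycles_succ, Op.boundary_boundary]
      exact Submodule.zero_mem _
  map_denom c hc := by
    obtain ⟨_, ⟨d, rfl⟩, s, hs, rfl⟩ := Submodule.mem_sup.1 hc
    rw [map_add, Op.boundary_boundary, zero_add]
    exact Submodule.mem_sup_left ⟨s, hs, rfl⟩
  inj c hc h := by
    obtain ⟨_, ⟨s, hs, rfl⟩, t, ht, hst⟩ := Submodule.mem_sup.1 h
    have h1 : c - s ∈ cycles (A.pullback p) T (n + 1) := by
      rw [mem_cycles_succ, map_sub, ← hst, add_sub_cancel_left]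
      exact ht
    have := Submodule.add_mem _ (boundaries_mono _ hTS _ (hT _ h1)) (Submodule.mem_sup_right hs)
    rwa [sub_add_cancel] at this
  surj y hy := by
    obtain ⟨_, ⟨d, rfl⟩, t, ht, rfl⟩ := Submodule.mem_sup.1 (hT n hy.2)
    refine ⟨d, ?_, ?_⟩
    · have := Submodule.sub_mem _ hy.1 (chainsIn_mono _ hTS n ht)
      rwa [add_sub_cancel_right] at this
    · rw [add_sub_cancel_left]
      exact Submodule.mem_sup_right ht

/-- The connecting map in cohomology goes from `(S, T)` to `(Z, S)` and raises the degree; it is an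
isomorphism because the cohomology of `(Z, T)` vanishes. -/
theorem isSubquotientIso_coboundary {S T : Set Z} (hTS : T ⊆ S)
    (hT : ∀ n, cocycles (A.pullback p) T n ≤ coboundaries (A.pullback p) T n) (n : ℕ) :
    IsSubquotientIso (coboundary (A.pullback p) n) (pairCocycles (A.pullback p) S T n)
      (pairCoboundaries (A.pullback p) S T n) (cocycles (A.pullback p) S (n + 1))
      (coboundaries (A.pullback p) S (n + 1)) where
  map φ hφ := (mem_cocycles _).2 ⟨hφ.2, Op.coboundary_coboundary A φ⟩
  map_denom φ hφ := by
    obtain ⟨ψ, hψ, s, hs, rfl⟩ := Submodule.mem_sup.1 hφ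
    have h0 : coboundary (A.pullback p) n ψ = 0 := by
      cases n with
      | zero =>
        obtain rfl : ψ = 0 := hψ
        exact map_zero _
      | succ n =>
        obtain ⟨χ, -, rfl⟩ := hψ
        exact Op.coboundary_coboundary A χ
    rw [map_add, h0, zero_add]
    exact ⟨s, hs, rfl⟩
  inj φ hφ h := by
    obtain ⟨ψ, hψ, hψφ⟩ := h
    have h1 : φ - ψ ∈ cocycles (A.pullback p) T n :=
      (mem_cocycles _).2 ⟨Submodule.sub_mem _ hφ.1 (relCochains_anti _ hTS n hψ), by
        rw [map_sub, hψφ, sub_self]⟩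
    exact Submodule.mem_sup.2 ⟨φ - ψ, hT n h1, ψ, hψ, sub_add_cancel _ _⟩
  surj y hy := by
    obtain ⟨φ, hφ, rfl⟩ := hT (n + 1) (cocycles_anti _ hTS _ hy)
    exact ⟨φ, ⟨hφ, hy.1⟩, by rw [sub_self]; exact Submodule.zero_mem _⟩

variable {e : C(Z, Z')} {he : ∀ z, p' (e z) = p z} {S T : Set Z'} {n : ℕ}

theorem IsChainEquiv.isSubquotientIso_chain (h : IsChainEquiv R he) :
    IsSubquotientIso ((Op.push e he n).chain A) (cycles (A.pullback p) ∅ n)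
      (boundaries (A.pullback p) ∅ n) (cycles (A.pullback p') ∅ n)
      (boundaries (A.pullback p') ∅ n) where
  map _ := Op.push_mem_cycles A he (Set.mapsTo_empty _ _)
  map_denom _ := Op.push_mem_boundaries A he (Set.mapsTo_empty _ _)
  inj _ := h.mem_boundaries A
  surj _ := h.exists_cycle A

theorem IsChainEquiv.isSubquotientIso_cochain (h : IsChainEquiv R he) :
    IsSubquotientIso ((Op.push e he n).cochain A) (cocycles (A.pullback p') ∅ n)
      (coboundaries (A.pullback p') ∅ n) (cocycles (A.pullback p) ∅ n)
      (coboundaries (A.pullback p) ∅ n) where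
  map _ := Op.push_mem_cocycles A he (Set.mapsTo_empty _ _)
  map_denom _ := Op.push_mem_coboundaries A he (Set.mapsTo_empty _ _)
  inj _ := h.mem_coboundaries A
  surj _ := h.exists_cocycle A

theorem push_mem_chainsIn (hS : Set.range e ⊆ S) (c : Chain (A.pullback p) n) :
    (Op.push e he n).chain A c ∈ chainsIn (A.pullback p') S n :=
  (Op.carries_push (T := Set.univ) fun z _ => hS ⟨z, rfl⟩).chain_mem A
    fun _ h => (h (Set.subset_univ _)).elim

theorem push_cochain_eq_zero (hS : Set.range e ⊆ S) {φ : Cochain (A.pullback p') n}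
    (hφ : φ ∈ relCochains (A.pullback p') S n) : (Op.push e he n).cochain A φ = 0 :=
  mem_relCochains_univ _
    ((Op.carries_push (T := Set.univ) fun z _ => hS ⟨z, rfl⟩).cochain_mem A hφ)

/-- Excision in homology. -/
theorem IsExcisive.isSubquotientIso_chain (h : IsExcisive R p' S T (Set.range e))
    (hemb : Topology.IsEmbedding e) (hS : Set.range e ⊆ S) :
    IsSubquotientIso ((Op.push e he n).chain A) (cycles (A.pullback p) (e ⁻¹' T) n)
      (boundaries (A.pullback p) (e ⁻¹' T) n) (pairCycles (A.pullback p') S T n)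
      (pairBoundaries (A.pullback p') S T n) where
  map c hc := ⟨push_mem_chainsIn A hS c, Op.push_mem_cycles A he (Set.mapsTo_preimage e T) hc⟩
  map_denom c hc := by
    obtain ⟨_, ⟨d, rfl⟩, t, ht, rfl⟩ := Submodule.mem_sup.1 hc
    rw [map_add, ← Op.boundary_chain_push]
    exact Submodule.add_mem _ (Submodule.mem_sup_left ⟨_, push_mem_chainsIn A hS d, rfl⟩)
      (Submodule.mem_sup_right ((Op.carries_push (Set.mapsTo_preimage e T)).chain_mem A ht))
  inj _ := h.mem_boundaries A hemb
  surj _ := h.exists_cycle A hemb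

/-- Excision in cohomology. -/
theorem IsExcisive.isSubquotientIso_cochain (h : IsExcisive R p' S T (Set.range e))
    (hemb : Topology.IsEmbedding e) (hS : Set.range e ⊆ S) :
    IsSubquotientIso ((Op.push e he n).cochain A) (pairCocycles (A.pullback p') S T n)
      (pairCoboundaries (A.pullback p') S T n) (cocycles (A.pullback p) (e ⁻¹' T) n)
      (coboundaries (A.pullback p) (e ⁻¹' T) n) where
  map φ hφ := (mem_cocycles _).2
    ⟨(Op.carries_push (Set.mapsTo_preimage e T)).cochain_mem A hφ.1, by
      rw [Op.coboundary_cochain_push]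
      exact push_cochain_eq_zero A hS hφ.2⟩
  map_denom φ hφ := by
    obtain ⟨ψ, hψ, s, hs, rfl⟩ := Submodule.mem_sup.1 hφ
    rw [map_add, push_cochain_eq_zero A hS hs, add_zero]
    exact Op.push_mem_coboundaries A he (Set.mapsTo_preimage e T) hψ
  inj _ := h.mem_pairCoboundaries A hemb
  surj _ := h.exists_pairCocycle A hemb

variable {k q : ℕ} (h : k + q = n) {c s : Chain (constSystem R Z') (n + 1)}
  {t : Chain (constSystem R Z') n} {c' : Chain (constSystem R Z) n}

/-- Capping with a class and with its image under the boundary map of the triple: absolute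
cocycles. -/
theorem boundary_cap_sub_mem (hs : s ∈ chainsIn (constSystem R Z') S (n + 1))
    (ht : t ∈ chainsIn (constSystem R Z') T n) (hcc : (Op.push e he n).chain (constSystem R B) c' =
      boundary (constSystem R Z') n (c - s) - t)
    {φ : Cochain (A.pullback p') k} (hφ : φ ∈ cocycles (A.pullback p') ∅ k) :
    (-1 : R) ^ k • boundary (A.pullback p') q
        (cap (A.pullback p') (show k + (q + 1) = n + 1 by omega) φ c) -
      (Op.push e he q).chain A (cap (A.pullback p) h ((Op.push e he k).cochain A φ) c') ∈
      pairBoundaries (A.pullback p') S T q := by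
  have hδ : coboundary (A.pullback p') k φ = 0 := hφ.2
  -- The Leibniz rule for a cocycle `φ`. The two chains then differ by the cap products of `φ` with
  -- `∂s` and with `t`, a boundary from `S` and a chain in `T`.
  have hL : ∀ c, (-1 : R) ^ k • boundary (A.pullback p') q
      (cap (A.pullback p') (show k + (q + 1) = n + 1 by omega) φ c) =
      cap (A.pullback p') h φ (boundary (constSystem R Z') n c) := fun c => by
    rw [cap_boundary, hδ, map_zero, LinearMap.zero_apply, zero_add]
  have h1 : boundary (constSystem R Z') n c - (boundary (constSystem R Z') n (c - s) - t) =
      boundary (constSystem R Z') n s + t := by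
    rw [map_sub]
    abel
  rw [push_cap, hL, hcc, ← map_sub, h1, map_add, ← hL]
  exact Submodule.add_mem _ (Submodule.mem_sup_left (Submodule.smul_mem _ _
    ⟨_, cap_mem_chainsIn _ (Or.inr subset_rfl) _ hφ.1 hs, rfl⟩))
    (Submodule.mem_sup_right (cap_mem_chainsIn _ (Or.inr subset_rfl) _ hφ.1 ht))

/-- Capping with a class and with its image under the boundary map of the triple: relative
cocycles. -/
theorem cap_coboundary_sub_mem (hs : s ∈ chainsIn (constSystem R Z') S (n + 1))
    (ht : t ∈ chainsIn (constSystem R Z') T n) (hcc : (Op.push e he n).chain (constSystem R B) c' =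
      boundary (constSystem R Z') n (c - s) - t)
    {φ : Cochain (A.pullback p') k} (hφ : φ ∈ pairCocycles (A.pullback p') S T k) :
    cap (A.pullback p') (show k + 1 + q = n + 1 by omega) (coboundary (A.pullback p') k φ) c -
      (Op.push e he q).chain A (cap (A.pullback p) h ((Op.push e he k).cochain A φ) c') ∈
      boundaries (A.pullback p') ∅ q := by
  -- The corrections `s` and `t` do not contribute at all: `δφ` vanishes on `S`, where `s` lies, and
  -- `φ` vanishes on `T`, where `t` lies. The Leibniz rule leaves only an absolute boundary.
  have hs0 : cap (A.pullback p') (show k + 1 + q = n + 1 by omega)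
      (coboundary (A.pullback p') k φ) s = 0 := by
    have := cap_mem_chainsIn (A.pullback p') (T := ∅) (Or.inl subset_rfl)
      (show k + 1 + q = n + 1 by omega) hφ.2 hs
    rwa [chainsIn_empty] at this
  have ht0 : cap (A.pullback p') h φ t = 0 := by
    have := cap_mem_chainsIn (A.pullback p') (T := ∅) (Or.inl subset_rfl) h hφ.1 ht
    rwa [chainsIn_empty] at this
  rw [push_cap, hcc, map_sub, ht0, sub_zero, cap_boundary, map_sub, hs0, sub_zero, ← sub_sub,
    sub_self, zero_sub]
  exact Submodule.neg_mem _ (Submodule.smul_mem _ _ (Submodule.mem_sup_left ⟨_, rfl⟩))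

end Triple

/-! ### Desuspension of Poincaré duality -/

section Desuspension

open MappingCylinder

variable {R : Type*} [CommRing R] {X B : Type*} [TopologicalSpace X] [TopologicalSpace B]
  (f : C(X, B)) (A : LocalSystem R B)

theorem isSubquotientIso_suspension_boundary (k : ℕ) :
    IsSubquotientIso (boundary (A.pullback (proj (suspensionMap f))) k)
      (cycles (A.pullback (proj (suspensionMap f))) (Set.range (top (suspensionMap f))) (k + 1))
      (boundaries (A.pullback (proj (suspensionMap f))) (Set.range (top (suspensionMap f))) (k + 1))
      (pairCycles (A.pullback (proj (suspensionMap f))) (Set.range (top (suspensionMap f)))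
        (Set.range (susIncl f false)) k)
      (pairBoundaries (A.pullback (proj (suspensionMap f))) (Set.range (top (suspensionMap f)))
        (Set.range (susIncl f false)) k) :=
  isSubquotientIso_boundary A (range_susIncl_subset f false)
    (fun _ => (isChainEquiv_susIncl f R false).cycles_le_boundaries A
      (isEmbedding_susIncl f false)) k

theorem isSubquotientIso_suspension_coboundary (k : ℕ) :
    IsSubquotientIso (coboundary (A.pullback (proj (suspensionMap f))) k)
      (pairCocycles (A.pullback (proj (suspensionMap f))) (Set.range (top (suspensionMap f)))
        (Set.range (susIncl f false)) k)
      (pairCoboundaries (A.pullback (proj (suspensionMap f))) (Set.range (top (suspensionMap f)))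
        (Set.range (susIncl f false)) k)
      (cocycles (A.pullback (proj (suspensionMap f))) (Set.range (top (suspensionMap f))) (k + 1))
      (coboundaries (A.pullback (proj (suspensionMap f))) (Set.range (top (suspensionMap f)))
        (k + 1)) :=
  isSubquotientIso_coboundary A (range_susIncl_subset f false)
    (fun _ => (isChainEquiv_susIncl f R false).cocycles_le_coboundaries A
      (isEmbedding_susIncl f false)) k

theorem isSubquotientIso_suspension_chain (k : ℕ) :
    IsSubquotientIso ((Op.push (susIncl f true) (proj_susIncl f true) k).chain A)
      (cycles (A.pullback (proj f)) (Set.range (top f)) k)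
      (boundaries (A.pullback (proj f)) (Set.range (top f)) k)
      (pairCycles (A.pullback (proj (suspensionMap f))) (Set.range (top (suspensionMap f)))
        (Set.range (susIncl f false)) k)
      (pairBoundaries (A.pullback (proj (suspensionMap f))) (Set.range (top (suspensionMap f)))
        (Set.range (susIncl f false)) k) := by
  rw [← preimage_range_susIncl f]
  exact (isExcisive_susIncl f R).isSubquotientIso_chain A (isEmbedding_susIncl f true)
    (range_susIncl_subset f true)

theorem isSubquotientIso_suspension_cochain (k : ℕ) :
    IsSubquotientIso ((Op.push (susIncl f true) (proj_susIncl f true) k).cochain A)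
      (pairCocycles (A.pullback (proj (suspensionMap f))) (Set.range (top (suspensionMap f)))
        (Set.range (susIncl f false)) k)
      (pairCoboundaries (A.pullback (proj (suspensionMap f))) (Set.range (top (suspensionMap f)))
        (Set.range (susIncl f false)) k)
      (cocycles (A.pullback (proj f)) (Set.range (top f)) k)
      (coboundaries (A.pullback (proj f)) (Set.range (top f)) k) := by
  rw [← preimage_range_susIncl f]
  exact (isExcisive_susIncl f R).isSubquotientIso_cochain A (isEmbedding_susIncl f true)
    (range_susIncl_subset f true)

/-- The suspension isomorphism `H_k(B, X; R) ≅ H_{k+1}(B, SX; R)`. -/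
def suspensionEquiv (R : Type*) [CommRing R] (f : C(X, B)) (k : ℕ) :
    Homology (constSystem R (MappingCylinder f)) (Set.range (top f)) k ≃ₗ[R]
      Homology (constSystem R (MappingCylinder (suspensionMap f)))
        (Set.range (top (suspensionMap f))) (k + 1) :=
  (isSubquotientIso_suspension_chain f (constSystem R B) k).toEquiv.trans
    (isSubquotientIso_suspension_boundary f (constSystem R B) k).toEquiv.symm

/-- Unwinds the zigzag defining the suspension isomorphism: the push-forward of `c'` and the
boundary of `c` represent the same class of `(SX, T)`, and `s`, `t` are the witnesses. -/
theorem exists_of_suspensionEquiv_eq {n : ℕ}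
    {c : Chain (constSystem R (MappingCylinder (suspensionMap f))) (n + 1)}
    (hc : c ∈ cycles (constSystem R (MappingCylinder (suspensionMap f)))
      (Set.range (top (suspensionMap f))) (n + 1))
    {c' : Chain (constSystem R (MappingCylinder f)) n}
    (hc' : c' ∈ cycles (constSystem R (MappingCylinder f)) (Set.range (top f)) n)
    (h : suspensionEquiv R f n (Submodule.Quotient.mk ⟨c', hc'⟩) =
      Submodule.Quotient.mk ⟨c, hc⟩) :
    ∃ s ∈ chainsIn (constSystem R (MappingCylinder (suspensionMap f)))
        (Set.range (top (suspensionMap f))) (n + 1),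
      ∃ t ∈ chainsIn (constSystem R (MappingCylinder (suspensionMap f)))
        (Set.range (susIncl f false)) n,
      (Op.push (susIncl f true) (proj_susIncl f true) n).chain (constSystem R B) c' =
        boundary (constSystem R (MappingCylinder (suspensionMap f))) n (c - s) - t := by
  have h1 := (LinearEquiv.symm_apply_eq _).1 h
  obtain ⟨u, hu⟩ : ∃ u : Chain (constSystem R (MappingCylinder (suspensionMap f))) n,
      (Op.push (susIncl f true) (proj_susIncl f true) n).chain (constSystem R B) c' = u := ⟨_, rfl⟩
  have h2 : boundary (constSystem R (MappingCylinder (suspensionMap f))) n c - u ∈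
      pairBoundaries (constSystem R (MappingCylinder (suspensionMap f)))
        (Set.range (top (suspensionMap f))) (Set.range (susIncl f false)) n := by
    subst hu
    exact IsSubquotientIso.sub_mem_of_toEquiv_eq _ _ h1.symm
  obtain ⟨_, ⟨s, hs, rfl⟩, t, ht, hst⟩ := Submodule.mem_sup.1 h2
  refine ⟨s, hs, t, ht, ?_⟩
  rw [hu, map_sub, sub_sub, hst, sub_sub_cancel]

/-- In both duality squares three sides are known to be isomorphisms: duality for `SX` composed with
a connecting map, and two comparison maps from excision and from the equivalence `M_f → M`. Nothing
about `A` is used, so duality desuspends for each local system separately. -/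
theorem IsDualityClass.of_suspensionEquiv {n : ℕ}
    {z : Homology (constSystem R (MappingCylinder f)) (Set.range (top f)) n}
    (h : IsDualityClass (n + 1) (suspensionMap f) A (suspensionEquiv R f n z)) :
    IsDualityClass n f A z := by
  obtain ⟨⟨c', hc'⟩, rfl⟩ := Submodule.Quotient.mk_surjective _ z
  obtain ⟨⟨c, hc⟩, hz⟩ := Submodule.Quotient.mk_surjective _
    (suspensionEquiv R f n (Submodule.Quotient.mk ⟨c', hc'⟩))
  rw [← hz] at h
  obtain ⟨s, hs, t, ht, hcc⟩ := exists_of_suspensionEquiv_eq f hc hc' hz.symm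
  have hE := isChainEquiv_susIncl f R true
  have habs : ∀ p q (hpq : p + q = n + 1), _ := fun p q hpq =>
    (bijective_homologyCap_iff _ (Or.inr subset_rfl) hpq hc).1 (h.bijective_abs p q hpq)
  have hrel : ∀ p q (hpq : p + q = n + 1), _ := fun p q hpq =>
    (bijective_homologyCap_iff _ (Or.inl subset_rfl) hpq hc).1 (h.bijective_rel p q hpq)
  refine ⟨fun p q hpq => ?_, fun p q hpq => ?_, fun k hk => ?_, fun k hk => ?_, fun k hk => ?_,
    fun k hk => ?_⟩
  · refine (bijective_homologyCap_iff _ _ hpq hc').2 (.of_square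
      (hE.isSubquotientIso_cochain A) (isSubquotientIso_suspension_chain f A q)
      -- The Leibniz sign `(-1) ^ p` is a unit, so it can be absorbed into the third side of the
      -- square.
      (((isSubquotientIso_suspension_boundary f A q).comp (habs p (q + 1) (by omega))).smul
        ((-1) ^ p))
      (fun φ hφ => cap_mem_cycles _ (Or.inr subset_rfl) hpq hφ hc')
      (fun φ hφ => cap_mem_boundaries_left _ (Or.inr subset_rfl) hpq hφ hc') fun φ hφ => ?_)
    have := boundary_cap_sub_mem A hpq hs ht hcc hφ
    simpa using this
  · exact (bijective_homologyCap_iff _ _ hpq hc').2 (.of_square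
      (isSubquotientIso_suspension_cochain f A p) (hE.isSubquotientIso_chain A)
      ((hrel (p + 1) q (by omega)).comp (isSubquotientIso_suspension_coboundary f A p))
      (fun φ hφ => cap_mem_cycles _ (Or.inl subset_rfl) hpq hφ hc')
      (fun φ hφ => cap_mem_boundaries_left _ (Or.inl subset_rfl) hpq hφ hc')
      fun φ hφ => cap_coboundary_sub_mem A hpq hs ht hcc hφ)
  · refine subsingleton_subquotient_iff.2 ((hE.isSubquotientIso_cochain A).le_iff.1 ?_)
    -- In degree `n + 1` duality for `SX` gives `H_0(M, SX)` instead of zero. In degree `0` all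
    -- chains are cycles, so this group is a quotient of `H_0(M, T) = 0`.
    rcases (Nat.succ_le_of_lt hk).eq_or_lt with rfl | hk
    · exact (habs (n + 1) 0 (by omega)).le_iff.2
        (((isChainEquiv_susIncl f R false).cycles_le_boundaries A
          (isEmbedding_susIncl f false)).trans
            (boundaries_mono _ (range_susIncl_subset f false) 0))
    · exact subsingleton_subquotient_iff.1 (h.cohomology_abs k hk)
  · exact subsingleton_subquotient_iff.2 ((isSubquotientIso_suspension_chain f A k).le_iff.2
      ((isSubquotientIso_suspension_boundary f A k).le_iff.1
        (subsingleton_subquotient_iff.1 (h.homology_rel (k + 1) (by omega)))))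
  · exact subsingleton_subquotient_iff.2 ((isSubquotientIso_suspension_cochain f A k).le_iff.1
      ((isSubquotientIso_suspension_coboundary f A k).le_iff.2
        (subsingleton_subquotient_iff.1 (h.cohomology_rel (k + 1) (by omega)))))
  · refine subsingleton_subquotient_iff.2 ((hE.isSubquotientIso_chain A).le_iff.2 ?_)
    -- Again degree `n + 1` is special: the group is dual to `H^0(M, SX)`. In degree `0` there are
    -- no nonzero coboundaries, so this is a subgroup of `H^0(M, T) = 0`.
    rcases (Nat.succ_le_of_lt hk).eq_or_lt with rfl | hk
    · exact (hrel 0 (n + 1) (by omega)).le_iff.1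
        ((cocycles_anti _ (range_susIncl_subset f false) 0).trans
          ((isChainEquiv_susIncl f R false).cocycles_le_coboundaries A
            (isEmbedding_susIncl f false)))
    · exact subsingleton_subquotient_iff.1 (h.homology_abs k hk)

theorem IsPoincarePair.of_suspension (hX : PathConnectedSpace X) (hXfin : IsFiniteComplex X)
    (hf : IsPiOneIso f) {n : ℕ} (h : IsPoincarePair R (n + 1) (suspensionMap f)) :
    IsPoincarePair R n f where
  finite_source := hXfin
  finite_target := h.finite_target
  connected_source := hX
  connected_target := h.connected_target
  piOneIso := hf
  duality := by
    obtain ⟨e, he⟩ := h.duality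
    -- The generator of `H_n(B, X; R)` is chosen as the one that suspends to the given generator for
    -- `SX`, and it serves for all base points.
    refine ⟨(suspensionEquiv R f n).trans e, fun y₀ => .of_suspensionEquiv f _ ?_⟩
    rw [LinearEquiv.trans_symm, LinearEquiv.trans_apply, LinearEquiv.apply_symm_apply]
    exact he y₀

end Desuspension

end PoincareStab

end

theorem mainTheorem9 {Γ : Type*} [Group Γ] {X B : Type*} [TopologicalSpace X] [TopologicalSpace B]
    (hB : PoincareStab.IsClassifyingSpace Γ B) (hBfin : PoincareStab.IsFiniteComplex B)
    (hX : PathConnectedSpace X) (hXfin : PoincareStab.IsFiniteComplex X)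
    (f : C(X, B)) (hf : PoincareStab.IsPiOneIso f) (n : ℕ) :
    (PoincareStab.IsPoincarePair ℤ (n + 1) (PoincareStab.suspensionMap f) →
        PoincareStab.IsPoincarePair ℤ n f) ∧
      (PoincareStab.IsPoincarePair ℚ (n + 1) (PoincareStab.suspensionMap f) →
        PoincareStab.IsPoincarePair ℚ n f) := by
  exact ⟨.of_suspension f hX hXfin hf, .of_suspension f hX hXfin hf⟩
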